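/- **Setting.** Let $d\in\mathbb N$, $0<s<d$, $\beta>0$, $h(k)=|k|^s$ on momentum space $\mathbb R^d$, $K=\coth(\beta h/2)$, and $\hat f(k)=(2\pi)^{-d/2}\int e^{-i\langle k,x\rangle}f(x)\,dx$. Let $\rho_0$ be the condensate density at inverse temperature $\beta$ and particle density $\bar\rho$: if $y_L>1$ is determined by $L^{-d}\sum_{k\in\frac{2\pi}{L}\mathbb Z^d}(y_Le^{\beta h(k)}-1)^{-1}=\bar\rho$, then $\rho_0=\lim_{L\to\infty}L^{-d}(y_L-1)^{-1}$. Assume that Bose–Einstein condensation occurs, i.e. $\rho_0>0$. Put $c=2(2\pi)^d\rho_0$ and $$q_{\mathrm{nz}}(f)=\|K^{1/2}f\|^2,\quad q_0(f,g)=c\,\overline{\hat f(0)}\,\hat g(0),\quad q_0(f)=q_0(f,f),\quad \ell_{r,\theta}(f)=\sqrt{cr}\,\operatorname{Re}\bigl(e^{i\theta}\hat f(0)\bigr).$$ Let $D_{0,\beta}$ be the space of $f\in L^1(\mathbb R^d)\cap L^2(\mathbb R^d)$ with $q_{\mathrm{nz}}(f)<\infty$, and let $X\supseteq D_{0,\beta}$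 be the space of $f\in L^2(\mathbb R^d)$ with $q_{\mathrm{nz}}(f)<\infty$ such that $\hat f$ has a representative continuous at $0$ (so that $\hat f(0)$ is defined). $X$ is invariant under $e^{iuh}$ ($u\in\mathbb R$) and under translations. Let $\mathcal R(X)$ be the resolvent algebra over $X$ with symplectic form $\sigma(f,g)=\operatorname{Im}\langle f,g\rangle$ and generators $R(\lambda,f)$, $\lambda\in\mathbb R\setminus\{0\}$ (formally $R(\lambda,f)=(i\lambda-\phi(f))^{-1}$); for $S\subseteq X$ let $\mathcal R(S)$ be the C*-subalgebra generated by the $R(\lambda,f)$ with $f\in S$. The free dynamics is $\alpha_u(R(\lambda,f))=R(\lambda,e^{iuh}f)$ and the translations are $\tau_a(R(\lambda,f))=R(\lambda,f(\cdot-a))$. A state $\psi$ of $\mathcal R(X)$ has characteristic function $\chi$ if its $n$-point functions on the generators are those obtained from $\psi(W(f))=\chi(f)$, the Weyl relations $W(f)W(g)=e^{-\frac i2\sigma(f,g)}W(f+g)$ and $R(\lambda,f)=-i\int_0^{(\operatorname{sgn}\lambda)\infty}e^{-\lambda t}W(-tf)\,dt$. A state $\psi$ clusters temporally (spatially) on a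 subalgebra $\mathcal A$ if $\psi(A\,\alpha_u(B))\to\psi(A)\psi(B)$ as $|u|\to\infty$ (respectively $\psi(A\,\tau_a(B))\to\psi(A)\psi(B)$ as $|a|\to\infty$) for all $A,B\in\mathcal A$. **Proposition.** 1. For all $r\ge0$ and $\theta\in\mathbb R$ there is exactly one state $\psi_{r,\theta}$ of $\mathcal R(X)$ with characteristic function $\exp(-\tfrac14q_{\mathrm{nz}}(f)+i\ell_{r,\theta}(f))$. It clusters temporally and spatially on $\mathcal R(X)$, hence on $\mathcal R(D_{0,\beta})$. 2. For all $f,g\in X$, $u\in\mathbb R$ and $a\in\mathbb R^d$, $q_0(f,e^{iuh}g)=q_0(f,g)=q_0(f,g(\cdot-a))$. 3. There is exactly one state $\psi_{\mathrm{BEC}}$ of $\mathcal R(X)$ with characteristic function $\exp(-\tfrac14(q_0(f)+q_{\mathrm{nz}}(f)))$. For all $\lambda,\mu\in\mathbb R\setminus\{0\}$ and $f,g\in X$, both $\psi_{\mathrm{BEC}}(R(\lambda,f)\alpha_u(R(\mu,g)))$ as $|u|\to\infty$ and $\psi_{\mathrm{BEC}}(R(\lambda,f)\tau_a(R(\mu,g)))$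 as $|a|\to\infty$ converge to $$(-i)^2\int_0^{(\operatorname{sgn}\lambda)\infty}\!\!\int_0^{(\operatorname{sgn}\mu)\infty}e^{-\lambda x-\mu y}\,e^{-\frac14q_0(xf+yg)}\,e^{-\frac14q_{\mathrm{nz}}(xf)}\,e^{-\frac14q_{\mathrm{nz}}(yg)}\,dy\,dx,$$ and this limit differs from $\psi_{\mathrm{BEC}}(R(\lambda,f))\,\psi_{\mathrm{BEC}}(R(\mu,g))$ if and only if $\operatorname{Re}q_0(f,g)\ne0$. The set $D_{0,\beta}\setminus\operatorname{Ker}q_0$ is not empty; for each $f$ in it the limit with $g=f$ differs from the product, for all $\lambda,\mu$. Consequently $\psi_{\mathrm{BEC}}$ clusters neither temporally nor spatially on $\mathcal R(D_{0,\beta}\setminus\operatorname{Ker}q_0)$, and the clustering relation fails along every way (every filter) in which $|u|\to\infty$, respectively $|a|\to\infty$. -/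

import Mathlib

open MeasureTheory Filter Topology
open scoped ENNReal FourierTransform ComplexConjugate

noncomputable section

namespace FreeBose

/-! ### The resolvent algebra of a complex pre-Hilbert space -/

section ResolventAlgebra

variable (V : Type) [NormedAddCommGroup V] [InnerProductSpace ℂ V]

/-- The symplectic form `σ(f, g) = Im ⟨f, g⟩`. -/
def symp {V : Type} [NormedAddCommGroup V] [InnerProductSpace ℂ V] (f g : V) : ℝ :=
  (inner ℂ f g).im

/-- A representation of the resolvent relations over `(V, σ)` by bounded operators on a nonzero
Hilbert space. -/
structure ResolventRep where
  H : Type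
  [normed : NormedAddCommGroup H]
  [inner : InnerProductSpace ℂ H]
  [complete : CompleteSpace H]
  [nontrivial : Nontrivial H]
  R : ℝˣ → V → (H →L[ℂ] H)
  map_zero : ∀ l : ℝˣ, R l 0 = (-Complex.I / ((l : ℝ) : ℂ)) • 1
  star_eq : ∀ (l : ℝˣ) (f : V), star (R l f) = R (-l) f
  scale : ∀ (n l : ℝˣ) (f : V), ((n : ℝ) : ℂ) • R (n * l) (((n : ℝ) : ℂ) • f) = R l f
  resolvent_identity : ∀ (l m : ℝˣ) (f : V),
    R l f - R m f = (Complex.I * (((m : ℝ) - (l : ℝ) : ℝ) : ℂ)) • (R l f * R m f)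
  commutator : ∀ (l m : ℝˣ) (f g : V),
    R l f * R m g - R m g * R l f
      = (Complex.I * (symp f g : ℂ)) • (R l f * (R m g) ^ 2 * R l f)
  product : ∀ (l m n : ℝˣ) (f g : V), (n : ℝ) = (l : ℝ) + (m : ℝ) →
    R l f * R m g
      = R n (f + g) * (R l f + R m g + (Complex.I * (symp f g : ℂ)) • ((R l f) ^ 2 * R m g))

attribute [instance] ResolventRep.normed ResolventRep.inner ResolventRep.complete
  ResolventRep.nontrivial

variable {V}

theorem ResolventRep.norm_le (π : ResolventRep V) (l : ℝˣ) (f : V) :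
    ‖π.R l f‖ ≤ |(l : ℝ)|⁻¹ := by
  have h := π.resolvent_identity l (-l) f
  rw [← π.star_eq] at h
  have h1 : ‖π.R l f - star (π.R l f)‖ = 2 * |(l : ℝ)| * (‖π.R l f‖ * ‖π.R l f‖) := by
    rw [h, norm_smul, CStarRing.norm_self_mul_star, norm_mul, Complex.norm_I, one_mul,
      Complex.norm_real, Real.norm_eq_abs]
    congr 1
    rw [Units.val_neg, show (-(l : ℝ) - (l : ℝ)) = (-2) * (l : ℝ) by ring, abs_mul]
    norm_num
  have h2 : ‖π.R l f - star (π.R l f)‖ ≤ 2 * ‖π.R l f‖ := by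
    refine (norm_sub_le _ _).trans ?_
    rw [norm_star]; linarith
  have hl : 0 < |(l : ℝ)| := abs_pos.mpr l.ne_zero
  rcases eq_or_lt_of_le (norm_nonneg (π.R l f)) with h0 | h0
  · rw [← h0]; positivity
  · rw [le_inv_comm₀ h0 hl, le_inv_comm₀ hl h0]
    rw [← one_div, le_div_iff₀ hl]
    have : 2 * ‖π.R l f‖ * (‖π.R l f‖ * |(l : ℝ)|) ≤ 2 * ‖π.R l f‖ * 1 := by nlinarith
    exact le_of_mul_le_mul_left this (by positivity)

/-- Pull-back of a representation along a linear isometry. -/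
def ResolventRep.comp {W : Type} [NormedAddCommGroup W] [InnerProductSpace ℂ W]
    (π : ResolventRep W) (U : V →ₗᵢ[ℂ] W) : ResolventRep V where
  H := π.H
  R l f := π.R l (U f)
  map_zero l := by rw [_root_.map_zero]; exact π.map_zero l
  star_eq l f := π.star_eq l (U f)
  scale n l f := by rw [_root_.map_smul]; exact π.scale n l (U f)
  resolvent_identity l m f := π.resolvent_identity l m (U f)
  commutator l m f g := by
    have := π.commutator l m (U f) (U g)
    rwa [symp, U.inner_map_map] at this
  product l m n f g h := by
    have := π.product l m n (U f) (U g) h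
    rwa [symp, U.inner_map_map, ← _root_.map_add] at this

variable (V)

/-- The C*-algebra of uniformly bounded families of operators, indexed by all representations of
the resolvent relations. -/
def RepFamilies : Type 1 := lp (fun π : ResolventRep V => (π.H →L[ℂ] π.H)) ∞

instance : NormedRing (RepFamilies V) :=
  inferInstanceAs (NormedRing (lp (fun π : ResolventRep V => (π.H →L[ℂ] π.H)) ∞))

instance : StarRing (RepFamilies V) :=
  inferInstanceAs (StarRing (lp (fun π : ResolventRep V => (π.H →L[ℂ] π.H)) ∞))

instance : CompleteSpace (RepFamilies V) :=
  inferInstanceAs (CompleteSpace (lp (fun π : ResolventRep V => (π.H →L[ℂ] π.H)) ∞))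

instance : CStarRing (RepFamilies V) :=
  inferInstanceAs (CStarRing (lp (fun π : ResolventRep V => (π.H →L[ℂ] π.H)) ∞))

instance : NormedAlgebra ℂ (RepFamilies V) :=
  inferInstanceAs (NormedAlgebra ℂ (lp (fun π : ResolventRep V => (π.H →L[ℂ] π.H)) ∞))

instance : StarModule ℂ (RepFamilies V) :=
  inferInstanceAs (StarModule ℂ (lp (fun π : ResolventRep V => (π.H →L[ℂ] π.H)) ∞))

instance : CStarAlgebra (RepFamilies V) where

/-- The operator of a family in the representation `π`. -/
def RepFamilies.eval {V : Type} [NormedAddCommGroup V] [InnerProductSpace ℂ V]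
    (a : RepFamilies V) (π : ResolventRep V) : π.H →L[ℂ] π.H := a.1 π

theorem RepFamilies.ext' {V : Type} [NormedAddCommGroup V] [InnerProductSpace ℂ V]
    {a b : RepFamilies V} (h : ∀ π, a.eval π = b.eval π) : a = b :=
  Subtype.ext (funext h)

theorem RepFamilies.norm_eval_le {V : Type} [NormedAddCommGroup V] [InnerProductSpace ℂ V]
    (a : RepFamilies V) (π : ResolventRep V) : ‖a.eval π‖ ≤ ‖a‖ :=
  lp.norm_apply_le_norm (E := fun π : ResolventRep V => (π.H →L[ℂ] π.H)) ENNReal.top_ne_zero a π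

variable {V}

/-- The generator `R(l, f)` in the direct sum of all representations. -/
def repGen (l : ℝˣ) (f : V) : RepFamilies V :=
  ⟨fun π => π.R l f, memℓp_infty ⟨|(l : ℝ)|⁻¹, by
    rintro _ ⟨π, rfl⟩
    exact π.norm_le l f⟩⟩

variable (V)

/-- The resolvent algebra, as a C*-subalgebra of the direct sum of all representations: the
completion of the universal unital `*`-algebra of the resolvent relations in its maximal
C*-seminorm. -/
def resolventSubalgebra : StarSubalgebra ℂ (RepFamilies V) :=
  (StarAlgebra.adjoin ℂ {a | ∃ (l : ℝˣ) (f : V), a = repGen l f}).topologicalClosure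

/-- The resolvent algebra `𝓡(V, σ)`. -/
def ResolventAlgebra : Type 1 := ↥(resolventSubalgebra V)

instance : NormedRing (ResolventAlgebra V) :=
  inferInstanceAs (NormedRing ↥(resolventSubalgebra V))

instance : StarRing (ResolventAlgebra V) :=
  inferInstanceAs (StarRing ↥(resolventSubalgebra V))

instance : CompleteSpace (ResolventAlgebra V) :=
  (StarSubalgebra.isClosed_topologicalClosure
    (StarAlgebra.adjoin ℂ {a | ∃ (l : ℝˣ) (f : V), a = repGen l f})).completeSpace_coe

instance : CStarRing (ResolventAlgebra V) :=
  inferInstanceAs (CStarRing ↥(resolventSubalgebra V))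

instance : NormedAlgebra ℂ (ResolventAlgebra V) :=
  inferInstanceAs (NormedAlgebra ℂ ↥(resolventSubalgebra V))

instance : StarModule ℂ (ResolventAlgebra V) :=
  inferInstanceAs (StarModule ℂ ↥(resolventSubalgebra V))

instance : CStarAlgebra (ResolventAlgebra V) where

variable {V}

/-- The generators `R(l, f)` of the resolvent algebra. -/
def resolvent (l : ℝˣ) (f : V) : ResolventAlgebra V :=
  ⟨repGen l f, StarSubalgebra.le_topologicalClosure _
    (StarAlgebra.subset_adjoin ℂ _ ⟨l, f, rfl⟩)⟩

/-- The C*-subalgebra of `𝓡(V, σ)` generated by the `R(l, f)` with `f ∈ S`. -/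
def resolventAlgebraOver (S : Set V) : StarSubalgebra ℂ (ResolventAlgebra V) :=
  (StarAlgebra.adjoin ℂ {a | ∃ (l : ℝˣ), ∃ f ∈ S, a = resolvent l f}).topologicalClosure

/-- Reindexing of families of operators along a linear isometry. -/
def repMap (U : V →ₗᵢ[ℂ] V) : RepFamilies V →⋆ₐ[ℂ] RepFamilies V where
  toFun a := ⟨fun π => a.eval (π.comp U), memℓp_infty ⟨‖a‖, by
    rintro _ ⟨π, rfl⟩
    exact a.norm_eval_le (π.comp U)⟩⟩
  map_one' := RepFamilies.ext' fun _ => rfl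
  map_mul' _ _ := RepFamilies.ext' fun _ => rfl
  map_zero' := RepFamilies.ext' fun _ => rfl
  map_add' _ _ := RepFamilies.ext' fun _ => rfl
  commutes' _ := RepFamilies.ext' fun _ => rfl
  map_star' _ := RepFamilies.ext' fun _ => rfl

theorem repMap_repGen (U : V →ₗᵢ[ℂ] V) (l : ℝˣ) (f : V) :
    repMap U (repGen l f) = repGen l (U f) :=
  RepFamilies.ext' fun _ => rfl

theorem norm_repMap_le (U : V →ₗᵢ[ℂ] V) (a : RepFamilies V) : ‖repMap U a‖ ≤ ‖a‖ :=
  lp.norm_le_of_forall_le (E := fun π : ResolventRep V => (π.H →L[ℂ] π.H)) (norm_nonneg a)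
    fun π => a.norm_eval_le (π.comp U)

theorem continuous_repMap (U : V →ₗᵢ[ℂ] V) : Continuous (repMap U) :=
  AddMonoidHomClass.continuous_of_bound (repMap U) 1 fun a => by
    simpa using norm_repMap_le U a

theorem repMap_mem (U : V →ₗᵢ[ℂ] V) {a : RepFamilies V} (ha : a ∈ resolventSubalgebra V) :
    repMap U a ∈ resolventSubalgebra V := by
  have hcl : IsClosed ((resolventSubalgebra V).comap (repMap U) : Set (RepFamilies V)) :=
    (StarSubalgebra.isClosed_topologicalClosure _).preimage (continuous_repMap U)
  refine StarSubalgebra.topologicalClosure_minimal (t := (resolventSubalgebra V).comap (repMap U))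
    ?_ hcl ha
  refine StarAlgebra.adjoin_le ?_
  rintro _ ⟨l, f, rfl⟩
  change repMap U (repGen l f) ∈ resolventSubalgebra V
  rw [repMap_repGen]
  exact (resolvent l (U f)).2

/-- The Bogoliubov endomorphism `R(l, f) ↦ R(l, U f)` of the resolvent algebra. -/
def bogoliubov (U : V →ₗᵢ[ℂ] V) : ResolventAlgebra V →⋆ₐ[ℂ] ResolventAlgebra V :=
  ((repMap U).comp (resolventSubalgebra V).subtype).codRestrict (resolventSubalgebra V)
    fun a => repMap_mem U a.2

theorem bogoliubov_resolvent (U : V →ₗᵢ[ℂ] V) (l : ℝˣ) (f : V) :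
    bogoliubov U (resolvent l f) = resolvent l (U f) :=
  Subtype.ext (repMap_repGen U l f)

/-- States of the resolvent algebra: normalised positive linear functionals. -/
structure IsState (ψ : ResolventAlgebra V →L[ℂ] ℂ) : Prop where
  map_one : ψ 1 = 1
  nonneg : ∀ a, 0 ≤ (ψ (star a * a)).re ∧ (ψ (star a * a)).im = 0

/-- The value on `W(g₁) ⋯ W(gₙ)` that the Weyl relations
`W(f) W(g) = exp (-(i/2) σ(f, g)) W(f + g)` assign to a functional with `W(f) ↦ χ f`. -/
def weylCorrelation (χ : V → ℂ) {n : ℕ} (g : Fin n → V) : ℂ :=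
  Complex.exp (-(Complex.I / 2) *
    ∑ j, ∑ k, if j < k then (symp (g j) (g k) : ℂ) else 0) * χ (∑ j, g j)

/-- The `n`-point function of `R(l₁, f₁) ⋯ R(lₙ, fₙ)` determined by `χ`, through the Laplace
representation `R(l, f) = -i ∫₀^{sgn(l) ∞} exp (-l t) W(-t f) dt`, each integral being written over
`(0, ∞)`. -/
def resolventCorrelation (χ : V → ℂ) {n : ℕ} (l : Fin n → ℝˣ) (f : Fin n → V) : ℂ :=
  ∫ t in Set.univ.pi (fun _ : Fin n => Set.Ioi (0 : ℝ)),
    (∏ j, (-Complex.I * (Real.sign (l j) : ℂ) * Complex.exp (-(|(l j : ℝ)| * t j : ℝ)))) *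
      weylCorrelation χ (fun j => ((-(Real.sign (l j) * t j) : ℝ) : ℂ) • f j)

/-- `ψ` is the regular state of the resolvent algebra with characteristic function
`ψ(W(f)) = χ f`, expressed through its `n`-point functions. -/
structure IsStateWithCharacteristic (ψ : ResolventAlgebra V →L[ℂ] ℂ) (χ : V → ℂ) : Prop where
  isState : IsState ψ
  npoint : ∀ (n : ℕ) (l : Fin n → ℝˣ) (f : Fin n → V),
    ψ ((List.ofFn fun j => resolvent (l j) (f j)).prod) = resolventCorrelation χ l f

/-- Clustering of `ψ` on the set `S` of observables, for the family `α` along the filter `F`. -/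
def Clusters {ι : Type} (ψ : ResolventAlgebra V →L[ℂ] ℂ) (S : Set (ResolventAlgebra V))
    (α : ι → ResolventAlgebra V →⋆ₐ[ℂ] ResolventAlgebra V) (F : Filter ι) : Prop :=
  ∀ A ∈ S, ∀ B ∈ S, Tendsto (fun i => ψ (A * α i B)) F (𝓝 (ψ A * ψ B))

end ResolventAlgebra

/-! ### One-particle objects -/

section OneParticle

variable (d : ℕ)

/-- Configuration (and momentum) space. -/
abbrev Space : Type := EuclideanSpace ℝ (Fin d)

/-- The one-particle space `L²(ℝᵈ)`. -/
abbrev OneParticle : Type := Lp (α := Space d) ℂ 2 (volume : Measure (Space d))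

variable {d}

/-- The one-particle Hamiltonian `h(k) = |k|ˢ` in momentum space. -/
def dispersion (s : ℝ) (k : Space d) : ℝ := ‖k‖ ^ s

/-- The dispersion in the variable `ξ = k / 2π` of the unitary Fourier transform
`𝓕 f ξ = ∫ exp (-2πi⟨x, ξ⟩) f x dx`. -/
def dispersionF (s : ℝ) (ξ : Space d) : ℝ := dispersion s ((2 * Real.pi) • ξ)

theorem continuous_dispersionF {s : ℝ} (hs : 0 < s) :
    Continuous (dispersionF s : Space d → ℝ) := by
  unfold dispersionF dispersion
  exact (continuous_const_smul _).norm.rpow_const fun _ => Or.inr hs.le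

theorem measurable_dispersionF (s : ℝ) : Measurable (dispersionF s : Space d → ℝ) := by
  unfold dispersionF dispersion
  exact (measurable_const_smul (2 * Real.pi)).norm.pow_const s

/-- `K = coth (β h / 2)`, as a function of `ξ`. -/
def thermalWeight (s β : ℝ) (ξ : Space d) : ℝ :=
  Real.cosh (β * dispersionF s ξ / 2) / Real.sinh (β * dispersionF s ξ / 2)

/-- The function `K^{1/2} f` in momentum space. -/
def thermalRoot (s β : ℝ) (f : OneParticle d) (ξ : Space d) : ℂ :=
  (Real.sqrt (thermalWeight s β ξ) : ℂ) * (𝓕 f : OneParticle d) ξ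

/-- `c = f̂(0)` for `f̂(k) = (2π)^{-d/2} ∫ exp (-i⟨k, x⟩) f x dx`: the Fourier transform of `f` has
a representative that is continuous at the origin, with value `c` there. -/
def HasZeroMode (f : OneParticle d) (c : ℂ) : Prop :=
  ∃ g : Space d → ℂ, ((𝓕 f : OneParticle d) : Space d → ℂ) =ᵐ[volume] g ∧ ContinuousAt g 0 ∧
    c = (((2 * Real.pi) ^ (-(d : ℝ) / 2) : ℝ) : ℂ) * g 0

theorem eq_of_ae_eq_of_continuousAt {g₁ g₂ : Space d → ℂ} (h : g₁ =ᵐ[volume] g₂)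
    (h₁ : ContinuousAt g₁ 0) (h₂ : ContinuousAt g₂ 0) : g₁ 0 = g₂ 0 := by
  have hd : Dense {x | g₁ x = g₂ x} := Measure.dense_of_ae h
  have hne : (𝓝[{x | g₁ x = g₂ x}] (0 : Space d)).NeBot :=
    mem_closure_iff_nhdsWithin_neBot.mp (hd 0)
  refine tendsto_nhds_unique (f := g₁) (l := 𝓝[{x | g₁ x = g₂ x}] (0 : Space d))
    (h₁.tendsto.mono_left nhdsWithin_le_nhds) ?_
  refine (h₂.tendsto.mono_left nhdsWithin_le_nhds).congr' ?_
  filter_upwards [self_mem_nhdsWithin] with x hx using hx.symm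

theorem HasZeroMode.unique {f : OneParticle d} {c c' : ℂ} (h : HasZeroMode f c)
    (h' : HasZeroMode f c') : c = c' := by
  obtain ⟨g, hg, hc, rfl⟩ := h
  obtain ⟨g', hg', hc', rfl⟩ := h'
  rw [eq_of_ae_eq_of_continuousAt (hg.symm.trans hg') hc hc']

theorem HasZeroMode.add {f g : OneParticle d} {c e : ℂ} (h : HasZeroMode f c)
    (h' : HasZeroMode g e) : HasZeroMode (f + g) (c + e) := by
  obtain ⟨u, hu, hc, rfl⟩ := h
  obtain ⟨v, hv, hc', rfl⟩ := h'
  refine ⟨u + v, ?_, hc.add hc', by simp [mul_add]⟩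
  rw [FourierTransform.fourier_add]
  exact (Lp.coeFn_add _ _).trans (hu.add hv)

theorem HasZeroMode.smul {f : OneParticle d} {c : ℂ} (h : HasZeroMode f c) (a : ℂ) :
    HasZeroMode (a • f) (a * c) := by
  obtain ⟨u, hu, hc, rfl⟩ := h
  refine ⟨a • u, ?_, hc.const_smul a, by simp; ring⟩
  rw [FourierTransform.fourier_smul]
  exact (Lp.coeFn_smul _ _).trans (hu.const_smul a)

theorem HasZeroMode.zero : HasZeroMode (0 : OneParticle d) 0 := by
  refine ⟨0, ?_, continuousAt_const, by simp⟩
  rw [FourierTransform.fourier_zero]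
  exact Lp.coeFn_zero _ _ _

theorem thermalRoot_add (s β : ℝ) (f g : OneParticle d) :
    thermalRoot s β (f + g) =ᵐ[volume] thermalRoot s β f + thermalRoot s β g := by
  have := Lp.coeFn_add (𝓕 f : OneParticle d) (𝓕 g)
  filter_upwards [this] with ξ hξ
  simp only [thermalRoot, Pi.add_apply, FourierTransform.fourier_add, hξ, mul_add]

theorem thermalRoot_smul (s β : ℝ) (a : ℂ) (f : OneParticle d) :
    thermalRoot s β (a • f) =ᵐ[volume] a • thermalRoot s β f := by
  have := Lp.coeFn_smul a (𝓕 f : OneParticle d)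
  filter_upwards [this] with ξ hξ
  simp only [thermalRoot, Pi.smul_apply, FourierTransform.fourier_smul, hξ, smul_eq_mul]
  ring

theorem thermalRoot_zero (s β : ℝ) : thermalRoot s β (0 : OneParticle d) =ᵐ[volume] 0 := by
  have := Lp.coeFn_zero ℂ 2 (volume : Measure (Space d))
  filter_upwards [this] with ξ hξ
  simp only [thermalRoot, FourierTransform.fourier_zero, hξ, Pi.zero_apply, mul_zero]

variable (d)

/-- The test functions: `f ∈ L²` in the form domain of `K` (that is, `K^{1/2} f ∈ L²`) for which
`f̂(0)` is defined. -/
def testSpace (s β : ℝ) : Submodule ℂ (OneParticle d) where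
  carrier := {f | MemLp (thermalRoot s β f) 2 ∧ ∃ c, HasZeroMode f c}
  add_mem' := fun {f g} hf hg => by
    obtain ⟨hf, c, hc⟩ := hf
    obtain ⟨hg, e, he⟩ := hg
    exact ⟨(memLp_congr_ae (thermalRoot_add s β f g)).2 (hf.add hg), c + e, hc.add he⟩
  zero_mem' := ⟨(memLp_congr_ae (thermalRoot_zero s β)).2 MemLp.zero, 0, HasZeroMode.zero⟩
  smul_mem' := fun a f hf => by
    obtain ⟨hf, c, hc⟩ := hf
    exact ⟨(memLp_congr_ae (thermalRoot_smul s β a f)).2 (hf.const_smul a), a * c, hc.smul a⟩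

/-- The space `D_{0,β}`: the functions in `L¹ ∩ L²` in the form domain of `K`. -/
def integrableTestSpace (s β : ℝ) : Submodule ℂ (OneParticle d) where
  carrier := {f | Integrable (f : Space d → ℂ) ∧ MemLp (thermalRoot s β f) 2}
  add_mem' := fun {f g} hf hg =>
    ⟨(integrable_congr (Lp.coeFn_add f g)).2 (hf.1.add hg.1),
      (memLp_congr_ae (thermalRoot_add s β f g)).2 (hf.2.add hg.2)⟩
  zero_mem' := ⟨(integrable_congr (Lp.coeFn_zero ℂ 2 volume)).2 (integrable_zero _ _ _),
    (memLp_congr_ae (thermalRoot_zero s β)).2 MemLp.zero⟩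
  smul_mem' := fun a f hf =>
    ⟨(integrable_congr (Lp.coeFn_smul a f)).2 (hf.1.smul a),
      (memLp_congr_ae (thermalRoot_smul s β a f)).2 (hf.2.const_smul a)⟩

variable {d}

/-- On `L¹ ∩ L²` the `L²` Fourier transform is given by the Fourier integral. -/
theorem fourier_ae_eq (f : OneParticle d) (hf : Integrable (f : Space d → ℂ)) :
    ((𝓕 f : OneParticle d) : Space d → ℂ) =ᵐ[volume] 𝓕 (f : Space d → ℂ) := by
  have hc : Continuous (𝓕 (f : Space d → ℂ)) :=
    VectorFourier.fourierIntegral_continuous Real.continuous_fourierChar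
      (by exact continuous_inner) hf
  refine ae_eq_of_integral_contDiff_smul_eq
    ((Lp.memLp (𝓕 f : OneParticle d)).locallyIntegrable (by norm_num)) hc.locallyIntegrable ?_
  intro u hu hu'
  have hv : ContDiff ℝ (⊤ : ℕ∞) (fun x => (u x : ℂ)) := Complex.ofRealCLM.contDiff.comp hu
  have hv' : HasCompactSupport (fun x => (u x : ℂ)) := hu'.comp_left Complex.ofReal_zero
  set φ : SchwartzMap (Space d) ℂ := hv'.toSchwartzMap hv with hφ
  have h1 := congrArg (fun T => T φ) (Lp.fourier_toTemperedDistribution_eq f)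
  simp only [TemperedDistribution.fourier_apply, Lp.toTemperedDistribution_apply] at h1
  have h2 := VectorFourier.integral_fourierIntegral_smul_eq_flip (μ := volume) (ν := volume)
    (L := innerₗ (Space d)) Real.continuous_fourierChar (by exact continuous_inner)
    φ.integrable hf
  have h3 : ∀ x, φ x = (u x : ℂ) := fun _ => rfl
  rw [flip_innerₗ] at h2
  calc ∫ x, u x • (𝓕 f : OneParticle d) x = ∫ x, φ x • (𝓕 f : OneParticle d) x := by
        simp [h3]
    _ = ∫ x, φ x • 𝓕 (f : Space d → ℂ) x := by
        rw [← h1]; exact h2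
    _ = _ := by simp [h3]

/-- For `f ∈ L¹ ∩ L²` one has `f̂(0) = (2π)^{-d/2} ∫ f`. -/
theorem hasZeroMode_of_integrable (f : OneParticle d) (hf : Integrable (f : Space d → ℂ)) :
    HasZeroMode f ((((2 * Real.pi) ^ (-(d : ℝ) / 2) : ℝ) : ℂ) * ∫ x, f x) := by
  refine ⟨_, fourier_ae_eq f hf, ?_, ?_⟩
  · exact (VectorFourier.fourierIntegral_continuous Real.continuous_fourierChar
      (by exact continuous_inner) hf).continuousAt
  · rw [Real.fourier_eq]; simp

theorem integrableTestSpace_le (s β : ℝ) : integrableTestSpace d s β ≤ testSpace d s β :=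
  fun f hf => ⟨hf.2, _, hasZeroMode_of_integrable f hf.1⟩

/-- Multiplication by a measurable phase on `L²`. -/
def phaseMul (m : Space d → ℂ) (hm : Measurable m) (h1 : ∀ ξ, ‖m ξ‖ = 1) :
    OneParticle d →ₗᵢ[ℂ] OneParticle d where
  toFun f := MemLp.toLp (fun ξ => m ξ * f ξ) ((Lp.memLp f).congr_norm
    (hm.aestronglyMeasurable.mul (Lp.aestronglyMeasurable f))
    (Eventually.of_forall fun ξ => by simp [h1]))
  map_add' f g := by
    ext1
    filter_upwards [MemLp.coeFn_toLp (μ := volume) (p := 2) (f := fun ξ => m ξ * (f + g) ξ) _,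
      Lp.coeFn_add f g, Lp.coeFn_add (MemLp.toLp (μ := volume) (p := 2) (fun ξ => m ξ * f ξ) _)
        (MemLp.toLp (μ := volume) (p := 2) (fun ξ => m ξ * g ξ) _),
      MemLp.coeFn_toLp (μ := volume) (p := 2) (f := fun ξ => m ξ * f ξ) _,
      MemLp.coeFn_toLp (μ := volume) (p := 2) (f := fun ξ => m ξ * g ξ) _] with ξ a b c e f'
    rw [a, c, Pi.add_apply, e, f', b, Pi.add_apply, mul_add]
  map_smul' a f := by
    ext1
    filter_upwards [MemLp.coeFn_toLp (μ := volume) (p := 2) (f := fun ξ => m ξ * (a • f) ξ) _,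
      Lp.coeFn_smul a f,
      Lp.coeFn_smul a (MemLp.toLp (μ := volume) (p := 2) (fun ξ => m ξ * f ξ) _),
      MemLp.coeFn_toLp (μ := volume) (p := 2) (f := fun ξ => m ξ * f ξ) _] with ξ x b c e
    rw [x, RingHom.id_apply, c, Pi.smul_apply, e, b, Pi.smul_apply, smul_eq_mul, smul_eq_mul]
    ring
  norm_map' f := by
    change ‖(MemLp.toLp (fun ξ => m ξ * f ξ) ((Lp.memLp f).congr_norm
      (hm.aestronglyMeasurable.mul (Lp.aestronglyMeasurable f))
      (Eventually.of_forall fun ξ => by simp [h1])) : OneParticle d)‖ = ‖f‖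
    rw [Lp.norm_toLp, Lp.norm_def]
    congr 1
    exact eLpNorm_congr_norm_ae (Eventually.of_forall fun ξ => by simp [h1])

theorem coeFn_phaseMul (m : Space d → ℂ) (hm : Measurable m) (h1 : ∀ ξ, ‖m ξ‖ = 1)
    (f : OneParticle d) : (phaseMul m hm h1 f : Space d → ℂ) =ᵐ[volume] fun ξ => m ξ * f ξ :=
  MemLp.coeFn_toLp ((Lp.memLp f).congr_norm
    (hm.aestronglyMeasurable.mul (Lp.aestronglyMeasurable f))
    (Eventually.of_forall fun ξ => by simp [h1]))

/-- The one-particle time evolution `e^{iuh}` on `L²`. -/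
def timeEvolution (s u : ℝ) : OneParticle d →ₗᵢ[ℂ] OneParticle d :=
  (Lp.fourierTransformₗᵢ (Space d) ℂ).symm.toLinearIsometry.comp
    ((phaseMul (fun ξ => Complex.exp ((u * dispersionF s ξ : ℝ) * Complex.I))
      (by have := measurable_dispersionF (d := d) s; fun_prop)
      (fun ξ => Complex.norm_exp_ofReal_mul_I _)).comp
        (Lp.fourierTransformₗᵢ (Space d) ℂ).toLinearIsometry)

/-- The translation `f ↦ f(· - a)` on `L²`. -/
def translation (a : Space d) : OneParticle d →ₗᵢ[ℂ] OneParticle d :=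
  Lp.compMeasurePreservingₗᵢ ℂ (fun x => x - a) (measurePreserving_sub_right volume a)

theorem fourier_timeEvolution (s u : ℝ) (f : OneParticle d) :
    ((𝓕 (timeEvolution s u f) : OneParticle d) : Space d → ℂ) =ᵐ[volume]
      fun ξ => Complex.exp ((u * dispersionF s ξ : ℝ) * Complex.I) *
        (𝓕 f : OneParticle d) ξ := by
  have h : (𝓕 (timeEvolution s u f) : OneParticle d) = phaseMul
      (fun ξ => Complex.exp ((u * dispersionF s ξ : ℝ) * Complex.I))
      (by have := measurable_dispersionF (d := d) s; fun_prop)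
      (fun ξ => Complex.norm_exp_ofReal_mul_I _) (𝓕 f) :=
    (Lp.fourierTransformₗᵢ (Space d) ℂ).apply_symm_apply _
  rw [h]
  exact coeFn_phaseMul _ _ _ _

/-- The phase by which `translation a` acts in momentum space. -/
def translationPhase (a ξ : Space d) : ℂ :=
  Complex.exp ((-(2 * Real.pi * inner ℝ a ξ) : ℝ) * Complex.I)

theorem continuous_translationPhase (a : Space d) : Continuous (translationPhase a) := by
  unfold translationPhase; fun_prop

theorem norm_translationPhase (a ξ : Space d) : ‖translationPhase a ξ‖ = 1 :=
  Complex.norm_exp_ofReal_mul_I _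

theorem fourier_translation (a : Space d) (f : OneParticle d) :
    ((𝓕 (translation a f) : OneParticle d) : Space d → ℂ) =ᵐ[volume]
      fun ξ => translationPhase a ξ * (𝓕 f : OneParticle d) ξ := by
  have key : (𝓕 (translation a f) : OneParticle d) = phaseMul (translationPhase a)
      (continuous_translationPhase a).measurable (norm_translationPhase a) (𝓕 f) := by
    refine DenseRange.induction_on
      (p := fun f : OneParticle d => (𝓕 (translation a f) : OneParticle d) =
        phaseMul (translationPhase a) (continuous_translationPhase a).measurable
          (norm_translationPhase a) (𝓕 f))
      (SchwartzMap.denseRange_toLpCLM (p := 2) ENNReal.ofNat_ne_top) f ?_ ?_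
    · refine isClosed_eq ?_ ?_
      · exact (Lp.fourierTransformₗᵢ (Space d) ℂ).continuous.comp (translation a).continuous
      · exact (phaseMul _ _ _).continuous.comp (Lp.fourierTransformₗᵢ (Space d) ℂ).continuous
    · intro φ
      set g : OneParticle d := SchwartzMap.toLpCLM ℝ ℂ 2 volume φ with hg
      have hgφ : (g : Space d → ℂ) =ᵐ[volume] φ := φ.coeFn_toLp 2 volume
      have hgi : Integrable (g : Space d → ℂ) := (integrable_congr hgφ).2 φ.integrable
      have hT : (translation a g : Space d → ℂ) =ᵐ[volume] fun x => g (x - a) :=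
        Lp.coeFn_compMeasurePreserving g (measurePreserving_sub_right volume a)
      have hTi : Integrable (translation a g : Space d → ℂ) :=
        (integrable_congr hT).2 (hgi.comp_sub_right a)
      change (𝓕 (translation a g) : OneParticle d) = phaseMul (translationPhase a)
        (continuous_translationPhase a).measurable (norm_translationPhase a) (𝓕 g)
      ext1
      refine (fourier_ae_eq _ hTi).trans ?_
      refine EventuallyEq.trans ?_ (coeFn_phaseMul _ _ _ _).symm
      filter_upwards [fourier_ae_eq g hgi] with ξ hξ
      rw [hξ, Real.fourier_congr_ae hT, Real.fourier_eq', Real.fourier_eq',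
        ← integral_add_right_eq_self _ a, ← integral_const_mul]
      refine integral_congr_ae (Eventually.of_forall fun x => ?_)
      simp only [smul_eq_mul, translationPhase, add_sub_cancel_right, inner_add_left]
      rw [← mul_assoc, ← Complex.exp_add]
      congr 2
      push_cast
      ring
  rw [key]
  exact coeFn_phaseMul _ _ _ _

/-- A unitary acting in momentum space by a continuous phase preserves the test functions. -/
theorem mem_testSpace_of_phase {s β : ℝ} {f g : OneParticle d} {m : Space d → ℂ}
    (hm : Continuous m) (h1 : ∀ ξ, ‖m ξ‖ = 1)
    (h : ((𝓕 g : OneParticle d) : Space d → ℂ) =ᵐ[volume]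
      fun ξ => m ξ * (𝓕 f : OneParticle d) ξ)
    (hf : f ∈ testSpace d s β) : g ∈ testSpace d s β := by
  obtain ⟨hf, c, v, hv, hvc, rfl⟩ := hf
  have ht : thermalRoot s β g =ᵐ[volume] fun ξ => m ξ * thermalRoot s β f ξ := by
    filter_upwards [h] with ξ hξ
    simp only [thermalRoot, hξ]; ring
  refine ⟨(memLp_congr_ae ht).2 (hf.congr_norm (hm.aestronglyMeasurable.mul hf.1)
    (Eventually.of_forall fun ξ => by simp [h1])), _, m * v, ?_,
    hm.continuousAt.mul hvc, rfl⟩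
  filter_upwards [h, hv] with ξ h1 h2
  rw [h1, h2, Pi.mul_apply]

variable (d)

/-- Restriction of an isometry to an invariant subspace. -/
def restrictIsometry (p : Submodule ℂ (OneParticle d)) (U : OneParticle d →ₗᵢ[ℂ] OneParticle d)
    (h : ∀ f ∈ p, U f ∈ p) : p →ₗᵢ[ℂ] p where
  toFun f := ⟨U f, h f f.2⟩
  map_add' f g := Subtype.ext (map_add U (f : OneParticle d) g)
  map_smul' c f := Subtype.ext (map_smul U c (f : OneParticle d))
  norm_map' f := U.norm_map (f : OneParticle d)

theorem timeEvolution_mem {s : ℝ} (hs : 0 < s) (β u : ℝ) (f : OneParticle d)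
    (hf : f ∈ testSpace d s β) : timeEvolution s u f ∈ testSpace d s β := by
  have hc : Continuous fun ξ : Space d =>
      Complex.exp ((u * dispersionF s ξ : ℝ) * Complex.I) := by
    have := continuous_dispersionF (d := d) hs
    fun_prop
  exact mem_testSpace_of_phase hc (fun ξ => Complex.norm_exp_ofReal_mul_I _)
    (fourier_timeEvolution s u f) hf

theorem translation_mem (s β : ℝ) (a : Space d) (f : OneParticle d)
    (hf : f ∈ testSpace d s β) : translation a f ∈ testSpace d s β :=
  mem_testSpace_of_phase (continuous_translationPhase a) (norm_translationPhase a)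
    (fourier_translation a f) hf

/-- Time evolution on the test functions. -/
def testTimeEvolution {s : ℝ} (hs : 0 < s) (β u : ℝ) :
    testSpace d s β →ₗᵢ[ℂ] testSpace d s β :=
  restrictIsometry d _ (timeEvolution s u) (timeEvolution_mem d hs β u)

/-- Translations on the test functions. -/
def testTranslation (s β : ℝ) (a : Space d) : testSpace d s β →ₗᵢ[ℂ] testSpace d s β :=
  restrictIsometry d _ (translation a) (translation_mem d s β a)

variable {d} {s β : ℝ}

/-- The value `f̂(0) = (2π)^{-d/2} ∫ f`. -/
def zeroMode (f : testSpace d s β) : ℂ := Classical.choose f.2.2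

theorem zeroMode_spec (f : testSpace d s β) : HasZeroMode (f : OneParticle d) (zeroMode f) :=
  Classical.choose_spec f.2.2

theorem zeroMode_of_integrable (f : testSpace d s β)
    (hf : Integrable ((f : OneParticle d) : Space d → ℂ)) :
    zeroMode f = (((2 * Real.pi) ^ (-(d : ℝ) / 2) : ℝ) : ℂ) * ∫ x, (f : OneParticle d) x :=
  (zeroMode_spec f).unique (hasZeroMode_of_integrable _ hf)

/-- The quadratic form `q_nonzero(f) = ‖K^{1/2} f‖²`. -/
def nonzeroForm (f : testSpace d s β) : ℝ :=
  ∫ ξ, ‖thermalRoot s β (f : OneParticle d) ξ‖ ^ 2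

/-- The constant `c = 2 (2π)ᵈ ρ₀`. -/
def condensateConst (d : ℕ) (ρ₀ : ℝ) : ℝ := 2 * (2 * Real.pi) ^ d * ρ₀

/-- The sesquilinear form `q₀(f, g) = c conj(f̂(0)) ĝ(0)`. -/
def zeroForm (ρ₀ : ℝ) (f g : testSpace d s β) : ℂ :=
  (condensateConst d ρ₀ : ℂ) * (conj (zeroMode f) * zeroMode g)

/-- The quadratic form `q₀(f) = c |f̂(0)|²`. -/
def zeroQuad (ρ₀ : ℝ) (f : testSpace d s β) : ℝ := condensateConst d ρ₀ * ‖zeroMode f‖ ^ 2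

/-- The subset `D_{0,β} \ Ker q₀` of the test functions. -/
def condensateFunctions (d : ℕ) (s β ρ₀ : ℝ) : Set (testSpace d s β) :=
  {f | (f : OneParticle d) ∈ integrableTestSpace d s β ∧ zeroQuad ρ₀ f ≠ 0}

/-- The classical field `ℓ_{r,θ}(f) = √(c r) Re (e^{iθ} f̂(0))`. -/
def classicalField (ρ₀ r θ : ℝ) (f : testSpace d s β) : ℝ :=
  Real.sqrt (condensateConst d ρ₀ * r) * (Complex.exp (θ * Complex.I) * zeroMode f).re

/-- The characteristic function `W(f) ↦ exp (-q_nonzero(f)/4 + i ℓ_{r,θ}(f))` of the component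
state. -/
def componentCharacteristic (ρ₀ r θ : ℝ) (f : testSpace d s β) : ℂ :=
  Complex.exp (-((nonzeroForm f : ℝ) : ℂ) / 4 + Complex.I * (classicalField ρ₀ r θ f : ℂ))

/-- The characteristic function `W(f) ↦ exp (-(q₀(f) + q_nonzero(f))/4)` of the BEC state. -/
def becCharacteristic (ρ₀ : ℝ) (f : testSpace d s β) : ℂ :=
  Complex.exp (-((zeroQuad ρ₀ f + nonzeroForm f : ℝ) : ℂ) / 4)

/-- The limit of the two-point function of the BEC state at infinite separation. -/
def becLimit (ρ₀ : ℝ) (l m : ℝˣ) (f g : testSpace d s β) : ℂ :=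
  ∫ x in Set.Ioi (0 : ℝ), ∫ y in Set.Ioi (0 : ℝ),
    (-Complex.I * (Real.sign l : ℂ)) * (-Complex.I * (Real.sign m : ℂ)) *
      (Real.exp (-(|(l : ℝ)| * x + |(m : ℝ)| * y)) *
        Real.exp (-(1 / 4) * zeroQuad ρ₀
          (((Real.sign l * x : ℝ) : ℂ) • f + ((Real.sign m * y : ℝ) : ℂ) • g)) *
        Real.exp (-(1 / 4) * nonzeroForm ((x : ℂ) • f)) *
        Real.exp (-(1 / 4) * nonzeroForm ((y : ℂ) • g)) : ℝ)

/-- The free dynamics `α_u(R(l, f)) = R(l, e^{iuh} f)` on the resolvent algebra. -/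
def dynamics (d : ℕ) {s : ℝ} (hs : 0 < s) (β u : ℝ) :
    ResolventAlgebra (testSpace d s β) →⋆ₐ[ℂ] ResolventAlgebra (testSpace d s β) :=
  bogoliubov (testTimeEvolution d hs β u)

/-- The spatial translations `R(l, f) ↦ R(l, f(· - a))` on the resolvent algebra. -/
def spaceTranslation (d : ℕ) (s β : ℝ) (a : Space d) :
    ResolventAlgebra (testSpace d s β) →⋆ₐ[ℂ] ResolventAlgebra (testSpace d s β) :=
  bogoliubov (testTranslation d s β a)

/-- `ρ₀` is the condensate density at inverse temperature `β` and particle density `ρ`: with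
`y_L > 1` such that the mean density `L⁻ᵈ ∑_k (y_L e^{βh(k)} - 1)⁻¹` over `k ∈ (2π/L) ℤᵈ` is `ρ`,
one has `ρ₀ = lim L⁻ᵈ (y_L - 1)⁻¹` as `L → ∞`. -/
def IsCondensateDensity (d : ℕ) (s β ρ ρ₀ : ℝ) : Prop :=
  ∃ y : ℝ → ℝ,
    (∀ L : ℝ, 0 < L → 1 < y L ∧
      HasSum (fun n : Fin d → ℤ => (y L * Real.exp (β * dispersion s
        (WithLp.toLp 2 fun j => 2 * Real.pi / L * (n j : ℝ) : Space d)) - 1)⁻¹) (ρ * L ^ d)) ∧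
    Tendsto (fun L : ℝ => (L ^ d)⁻¹ * (y L - 1)⁻¹) atTop (𝓝 ρ₀)

end OneParticle

end FreeBose

end

noncomputable section

namespace FreeBose

/-! ### Strongly continuous unitary one-parameter groups and their resolvents -/

/-! Every state here is quasi-free: its characteristic function is `exp (-‖T f‖² / 4 + i Re (L f))`
with `T`, `L` linear. For a component state `T = K^{1/2}` and `L` is a multiple of the zero mode.
For the BEC state `L = 0` and `T` maps `f` to the pair `(K^{1/2} f, c^{1/2} f̂(0))`, so that `‖T
f‖²` is the sum of the two forms.

Existence. Since `K ≥ 1`, `T` dominates the one-particle norm, hence `Re ⟨T f, T g⟩ + i σ(f, g)` is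
a positive kernel (`posSemidef_re_inner_add_symp`). Exponentials and Schur products of positive
kernels are positive, so the candidate characteristic function is positive definite in the Weyl
sense and comes from a cyclic vector of a regular Weyl system (`exists_weylSystem`). The Laplace
transforms of its one-parameter groups satisfy the resolvent relations
(`WeylSystem.toResolventRep`), and the vector state has the required `n`-point functions. Uniqueness
holds because words in the generators span a dense subspace (`dense_span_word`).

Limits. An `n`-point function is an integral of Weyl correlations against decaying exponentials.
When the last factors are moved by `U i`, only two terms couple them to the first ones: the phase
with `σ(a, U i b)` and the factor `exp (-Re ⟨T a, T (U i b)⟩ / 2)`. In momentum space `U i`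
multiplies by a phase, so the symplectic term and the `K^{1/2}` part of the inner product vanish in
the limit by Riemann–Lebesgue lemmas. The phases equal one at zero momentum, so `f̂(0)` does not
move: in a component state it enters only through `L`, which has no cross term, and the state
clusters; in the BEC state the cross term `Re q₀(f, g)` survives. Dominated convergence carries this
over to the correlations of resolvents.

Failure of clustering. The limit and the product of the one-point functions are the same
Gaussian–Laplace integral over the quadrant, at cross coefficient `± Re q₀(f, g)` and at `0`. That
integral is strictly decreasing in the coefficient (`pairIntegral_lt`), so the two agree only if the
coefficient is zero. -/

/-- A strongly continuous one-parameter group of isometries of `H`. -/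
structure UnitaryFlow (H : Type*) [NormedAddCommGroup H] [InnerProductSpace ℂ H] where
  /-- The operators of the group. -/
  op : ℝ → H →L[ℂ] H
  op_zero : op 0 = 1
  op_add : ∀ s t, op (s + t) = op s * op t
  norm_op : ∀ t v, ‖op t v‖ = ‖v‖
  continuous_op : ∀ v, Continuous fun t => op t v

namespace UnitaryFlow

variable {H : Type*} [NormedAddCommGroup H] [InnerProductSpace ℂ H]

theorem op_add_apply (U : UnitaryFlow H) (s t : ℝ) (v : H) :
    U.op (s + t) v = U.op s (U.op t v) := by rw [U.op_add]; rfl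

theorem op_zero_apply (U : UnitaryFlow H) (v : H) : U.op 0 v = v := by rw [U.op_zero]; rfl

/-- The flow with time rescaled by `c`. -/
def rescale (U : UnitaryFlow H) (c : ℝ) : UnitaryFlow H where
  op t := U.op (c * t)
  op_zero := by rw [mul_zero, U.op_zero]
  op_add s t := by rw [mul_add, U.op_add]
  norm_op t v := U.norm_op _ v
  continuous_op v := (U.continuous_op v).comp (continuous_const_mul c)

/-- A flow may be differentiated along a differentiable curve. -/
theorem hasDerivAt_op_comp (U : UnitaryFlow H) {y : ℝ → H} {y' q : H}
    (hy : HasDerivAt y y' 0) (hU : HasDerivAt (fun t => U.op t (y 0)) q 0) :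
    HasDerivAt (fun t => U.op t (y t)) (q + y') 0 := by
  rw [hasDerivAt_iff_tendsto_slope_zero] at hy hU ⊢
  have h1 : Tendsto (fun t : ℝ => U.op t (t⁻¹ • (y (0 + t) - y 0))) (𝓝[≠] 0) (𝓝 y') := by
    have h2 : Tendsto (fun t : ℝ => U.op t (t⁻¹ • (y (0 + t) - y 0) - y')) (𝓝[≠] 0) (𝓝 0) := by
      rw [tendsto_zero_iff_norm_tendsto_zero]
      simp only [U.norm_op]
      exact tendsto_iff_norm_sub_tendsto_zero.1 hy
    have h3 : Tendsto (fun t : ℝ => U.op t y') (𝓝[≠] 0) (𝓝 y') := by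
      have := ((U.continuous_op y').tendsto 0).mono_left (nhdsWithin_le_nhds (s := {0}ᶜ))
      rwa [U.op_zero_apply] at this
    simpa using h2.add h3
  refine (hU.add h1).congr fun t => ?_
  simp only [zero_add, U.op_zero_apply, ← Complex.coe_smul, map_smul, map_sub]
  rw [← smul_add]
  abel_nf

theorem hasDerivAt_op (U : UnitaryFlow H) {w q : H} (hU : HasDerivAt (fun t => U.op t w) q 0)
    (t : ℝ) : HasDerivAt (fun t => U.op t w) (U.op t q) t := by
  have h1 : HasDerivAt (fun x => U.op t (U.op x w)) (U.op t q) (-t + t) := by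
    rw [neg_add_cancel]
    exact (((U.op t).restrictScalars ℝ).hasFDerivAt).comp_hasDerivAt 0 hU
  have h2 := h1.comp_const_add (-t) t
  refine h2.congr_of_eventuallyEq (Eventually.of_forall fun x => ?_)
  simp only
  rw [← U.op_add_apply]
  congr 2; ring

theorem hasDerivAt_rescale (U : UnitaryFlow H) {w q : H} (c : ℝ)
    (hU : HasDerivAt (fun t => U.op t w) q 0) :
    HasDerivAt (fun t => (U.rescale c).op t w) (c • q) 0 := by
  have h1 : HasDerivAt (fun t : ℝ => c * t) c 0 := by
    simpa using (hasDerivAt_id (0 : ℝ)).const_mul c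
  have h2 : HasDerivAt (fun t => U.op t w) q (c * 0) := by rwa [mul_zero]
  exact h2.scomp (0 : ℝ) h1

theorem integrableOn_exp_neg_mul {a : ℝ} (ha : 0 < a) :
    IntegrableOn (fun t : ℝ => Real.exp (-(a * t))) (Set.Ioi 0) := by
  simpa using exp_neg_integrableOn_Ioi 0 ha

theorem integral_exp_neg_mul {a : ℝ} (ha : 0 < a) :
    ∫ t in Set.Ioi (0 : ℝ), Real.exp (-(a * t)) = a⁻¹ := by
  have := integral_exp_mul_Ioi (a := -a) (by linarith) 0
  simpa [neg_div, one_div] using this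

theorem norm_exp_neg_mul (a : ℂ) (t : ℝ) : ‖Complex.exp (-(a * t))‖ = Real.exp (-(a.re * t)) := by
  simp [Complex.norm_exp]

theorem continuous_laplace (U : UnitaryFlow H) (a : ℂ) (v : H) :
    Continuous fun t : ℝ => Complex.exp (-(a * t)) • U.op t v := by
  have := U.continuous_op v
  fun_prop

theorem integrableOn_laplace (U : UnitaryFlow H) {a : ℂ} (ha : 0 < a.re) (v : H) :
    IntegrableOn (fun t : ℝ => Complex.exp (-(a * t)) • U.op t v) (Set.Ioi 0) := by
  refine Integrable.mono' ((integrableOn_exp_neg_mul ha).mul_const ‖v‖)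
    (U.continuous_laplace a v).aestronglyMeasurable (Eventually.of_forall fun t => ?_)
  rw [norm_smul, U.norm_op, norm_exp_neg_mul]

theorem inner_op_op (U : UnitaryFlow H) (t : ℝ) (v w : H) :
    inner ℂ (U.op t v) (U.op t w) = inner ℂ v w :=
  ({ (U.op t : H →ₗ[ℂ] H) with norm_map' := U.norm_op t } : H →ₗᵢ[ℂ] H).inner_map_map v w

/-- The Laplace transform `∫₀^∞ exp (-a t) U(t) dt` of a flow. -/
def laplace (U : UnitaryFlow H) (a : ℂ) (ha : 0 < a.re) : H →L[ℂ] H :=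
  LinearMap.mkContinuous
    { toFun := fun v => ∫ t in Set.Ioi (0 : ℝ), Complex.exp (-(a * t)) • U.op t v
      map_add' := fun v w => by
        rw [← integral_add (U.integrableOn_laplace ha v) (U.integrableOn_laplace ha w)]
        simp
      map_smul' := fun c v => by
        rw [RingHom.id_apply, ← integral_smul]
        simp only [map_smul, smul_comm c] } a.re⁻¹ fun v => by
      refine (norm_integral_le_integral_norm _).trans ?_
      simp only [norm_smul, U.norm_op, norm_exp_neg_mul]
      rw [integral_mul_const, integral_exp_neg_mul ha]

theorem laplace_apply (U : UnitaryFlow H) (a : ℂ) (ha : 0 < a.re) (v : H) :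
    U.laplace a ha v = ∫ t in Set.Ioi (0 : ℝ), Complex.exp (-(a * t)) • U.op t v := rfl

theorem sign_mul_re_pos {z : ℂ} (hz : z.re ≠ 0) : 0 < ((Real.sign z.re : ℂ) * z).re := by
  rcases lt_or_gt_of_ne hz with h | h
  · simp [Real.sign_of_neg h, h]
  · simp [Real.sign_of_pos h, h]

/-- The resolvent `-i ∫₀^{sgn(Re z) ∞} exp (-z t) U(t) dt` of a flow. -/
def resolvent (U : UnitaryFlow H) (z : ℂ) (hz : z.re ≠ 0) : H →L[ℂ] H :=
  (-Complex.I * (Real.sign z.re : ℂ)) •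
    (U.rescale (Real.sign z.re)).laplace (Real.sign z.re * z) (sign_mul_re_pos hz)

theorem resolvent_apply (U : UnitaryFlow H) {l : ℝ} (hl : (l : ℂ).re ≠ 0) (v : H) :
    U.resolvent l hl v = ∫ t in Set.Ioi (0 : ℝ),
      (-Complex.I * (Real.sign l : ℂ) * Complex.exp (-(|l| * t : ℝ))) •
        U.op (Real.sign l * t) v := by
  change (-Complex.I * (Real.sign (l : ℂ).re : ℂ)) • (∫ t in Set.Ioi (0 : ℝ),
    Complex.exp (-(Real.sign (l : ℂ).re * l * t)) • U.op (Real.sign (l : ℂ).re * t) v) = _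
  rw [← integral_smul]
  simp only [Complex.ofReal_re, smul_smul]
  refine setIntegral_congr_fun measurableSet_Ioi fun t _ => ?_
  have h : |l| = Real.sign l * l := by
    rcases lt_trichotomy l 0 with h | h | h
    · simp [Real.sign_of_neg h, abs_of_neg h]
    · simp [h]
    · simp [Real.sign_of_pos h, abs_of_pos h]
  simp only [h]
  push_cast
  rfl

variable [CompleteSpace H]

/-- Shifting the integration variable by `s` turns the orbit into `exp (a s)` times the tail of the
integral from `s` on. In this form it is visibly differentiable in `s`. -/
theorem op_laplace (U : UnitaryFlow H) (a : ℂ) (ha : 0 < a.re) (v : H) (s : ℝ) :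
    U.op s (U.laplace a ha v) = Complex.exp (a * s) •
      (U.laplace a ha v - ∫ t in (0 : ℝ)..s, Complex.exp (-(a * t)) • U.op t v) := by
  have hc := U.continuous_laplace a v
  have hi := U.integrableOn_laplace ha v
  have key : U.laplace a ha v - ∫ t in (0 : ℝ)..s, Complex.exp (-(a * t)) • U.op t v
      = ∫ t in Set.Ioi s, Complex.exp (-(a * t)) • U.op t v := by
    have his : IntegrableOn (fun t : ℝ => Complex.exp (-(a * t)) • U.op t v) (Set.Ioi s) := by
      have hu : IntegrableOn (fun t : ℝ => Complex.exp (-(a * t)) • U.op t v)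
          (Set.Icc s 0 ∪ Set.Ioi 0) := hc.continuousOn.integrableOn_Icc.union hi
      refine hu.mono_set fun x hx => ?_
      rcases le_or_gt x 0 with h | h
      · exact Or.inl ⟨(Set.mem_Ioi.1 hx).le, h⟩
      · exact Or.inr h
    rw [laplace_apply, sub_eq_iff_eq_add',
      intervalIntegral.integral_interval_add_Ioi hi his]
  rw [key, laplace_apply, ← ContinuousLinearMap.integral_comp_comm _ hi, ← integral_smul]
  have := (measurePreserving_add_right volume s).setIntegral_preimage_emb
    (MeasurableEquiv.addRight s).measurableEmbedding
    (fun t : ℝ => Complex.exp (a * s) • Complex.exp (-(a * t)) • U.op t v) (Set.Ioi s)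
  rw [← this, Set.preimage_add_const_Ioi, sub_self]
  refine setIntegral_congr_fun measurableSet_Ioi fun t _ => ?_
  simp only [map_smul]
  rw [add_comm t s, U.op_add_apply, smul_smul, ← Complex.exp_add]
  congr 2
  push_cast; ring

theorem hasDerivAt_laplace (U : UnitaryFlow H) (a : ℂ) (ha : 0 < a.re) (v : H) :
    HasDerivAt (fun t => U.op t (U.laplace a ha v)) (a • U.laplace a ha v - v) 0 := by
  have hc := U.continuous_laplace a v
  have h1 : HasDerivAt (fun s : ℝ => ∫ t in (0 : ℝ)..s, Complex.exp (-(a * t)) • U.op t v)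
      v 0 := by
    have := intervalIntegral.integral_hasDerivAt_right (hc.intervalIntegrable 0 0)
      (hc.stronglyMeasurableAtFilter _ _) hc.continuousAt
    simpa [U.op_zero_apply] using this
  have h2 : HasDerivAt (fun s : ℝ => Complex.exp (a * s)) a 0 := by
    have h3 : HasDerivAt (fun s : ℝ => a * (s : ℂ)) (a * 1) 0 :=
      (Complex.ofRealCLM.hasDerivAt (x := (0 : ℝ))).const_mul a
    simpa using h3.cexp
  have h4 := h2.smul (h1.const_sub (U.laplace a ha v))
  refine (h4.congr_of_eventuallyEq (Eventually.of_forall fun s => U.op_laplace a ha v s)).congr_deriv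
    ?_
  simp [sub_eq_add_neg, add_comm]

/-- The curve `exp (-a t) U(t) w` has derivative `-exp (-a t) U(t) u` and tends to zero at infinity,
so integrating over the half-line recovers its initial value `w`. -/
theorem eq_laplace_of_hasDerivAt (U : UnitaryFlow H) (a : ℂ) (ha : 0 < a.re) {w u : H}
    (h : HasDerivAt (fun t => U.op t w) (a • w - u) 0) : w = U.laplace a ha u := by
  have hd : ∀ t : ℝ, HasDerivAt (fun t : ℝ => Complex.exp (-(a * t)) • U.op t w)
      (-(Complex.exp (-(a * t)) • U.op t u)) t := fun t => by
    have h3 : HasDerivAt (fun s : ℝ => -(a * (s : ℂ))) (-(a * 1)) t :=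
      ((Complex.ofRealCLM.hasDerivAt (x := t)).const_mul a).neg
    refine (h3.cexp.smul (U.hasDerivAt_op h t)).congr_deriv ?_
    simp only [map_sub, map_smul, smul_sub, smul_smul, mul_one]
    rw [mul_neg, neg_smul]
    abel
  have h0 : Tendsto (fun t : ℝ => Complex.exp (-(a * t)) • U.op t w) atTop (𝓝 0) := by
    rw [tendsto_zero_iff_norm_tendsto_zero]
    simp only [norm_smul, U.norm_op, norm_exp_neg_mul]
    rw [← zero_mul ‖w‖]
    refine Tendsto.mul_const _ (Real.tendsto_exp_atBot.comp ?_)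
    exact tendsto_neg_atTop_atBot.comp (tendsto_id.const_mul_atTop ha)
  have := integral_Ioi_of_hasDerivAt_of_tendsto' (a := 0) (fun t _ => hd t)
    (U.integrableOn_laplace ha u).neg h0
  rw [integral_neg] at this
  rw [laplace_apply]
  simpa [U.op_zero_apply] using this.symm

theorem sign_mul_sign_self {x : ℝ} (hx : x ≠ 0) : (Real.sign x : ℂ) * (Real.sign x : ℂ) = 1 := by
  rcases Real.sign_apply_eq_of_ne_zero x hx with h | h <;> simp [h]

theorem hasDerivAt_resolvent (U : UnitaryFlow H) {z : ℂ} (hz : z.re ≠ 0) (v : H) :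
    HasDerivAt (fun t => U.op t (U.resolvent z hz v))
      (z • U.resolvent z hz v + Complex.I • v) 0 := by
  have he := sign_mul_sign_self hz
  set e := Real.sign z.re with hedef
  set J := (U.rescale e).laplace (e * z) (sign_mul_re_pos hz) v with hJ
  have h1 : HasDerivAt (fun t => ((U.rescale e).rescale e).op t J) (e • ((e * z : ℂ) • J - v)) 0 :=
    (U.rescale e).hasDerivAt_rescale e ((U.rescale e).hasDerivAt_laplace (e * z) _ v)
  have h2 : ∀ t, U.op t (U.resolvent z hz v)
      = (-Complex.I * (e : ℂ)) • ((U.rescale e).rescale e).op t J := fun t => by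
    have : e * (e * t) = t := by
      rw [← mul_assoc, show e * e = 1 by exact_mod_cast he, one_mul]
    change U.op t ((-Complex.I * (e : ℂ)) • J) = _
    rw [map_smul]
    change _ = (-Complex.I * (e : ℂ)) • U.op (e * (e * t)) J
    rw [this]
  simp only [h2]
  refine (h1.const_smul (-Complex.I * (e : ℂ))).congr_deriv ?_
  change _ = z • (-Complex.I * (e : ℂ)) • J + Complex.I • v
  rw [← Complex.coe_smul, smul_sub, smul_sub, smul_smul, smul_smul, smul_smul, smul_smul]
  have h3 : -Complex.I * (e : ℂ) * e * (e * z) = z * (-Complex.I * e) := by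
    linear_combination (-Complex.I * e * z) * he
  have h4 : -Complex.I * (e : ℂ) * e = -Complex.I := by
    linear_combination (-Complex.I) * he
  rw [h3, h4, neg_smul, sub_neg_eq_add]

/-- This uniqueness statement is the tool behind the resolvent relations: to identify a vector as a
resolvent applied to `u`, it suffices to differentiate its orbit at time zero. The unbounded
generator and its domain never appear. -/
theorem eq_resolvent_of_hasDerivAt (U : UnitaryFlow H) {z : ℂ} (hz : z.re ≠ 0) {w u : H}
    (h : HasDerivAt (fun t => U.op t w) (z • w + Complex.I • u) 0) :
    w = U.resolvent z hz u := by
  have h1 := U.hasDerivAt_rescale (Real.sign z.re) h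
  have h2 := (U.rescale (Real.sign z.re)).eq_laplace_of_hasDerivAt (Real.sign z.re * z)
    (sign_mul_re_pos hz) (u := (-Complex.I * (Real.sign z.re : ℂ)) • u) (h1.congr_deriv (by
      rw [← Complex.coe_smul, smul_add, smul_smul, smul_smul, sub_eq_add_neg, ← neg_smul]
      congr 2; ring))
  rw [h2, map_smul]
  rfl

theorem resolvent_sub_apply (U : UnitaryFlow H) {z z' : ℂ} (hz : z.re ≠ 0) (hz' : z'.re ≠ 0)
    (v : H) : U.resolvent z hz v - U.resolvent z' hz' v
      = (Complex.I * (z' - z)) • U.resolvent z hz (U.resolvent z' hz' v) := by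
  -- The vector `u` is chosen so that `z • w + i u` equals the known derivative `z' • w + i v` of
  -- the orbit of `w`.
  have h := U.eq_resolvent_of_hasDerivAt hz (w := U.resolvent z' hz' v)
    (u := v - (Complex.I * (z' - z)) • U.resolvent z' hz' v)
    ((U.hasDerivAt_resolvent hz' v).congr_deriv (by
      rw [smul_sub, smul_smul, ← mul_assoc, Complex.I_mul_I]
      module))
  rw [map_sub, map_smul] at h
  rw [eq_sub_iff_add_eq] at h
  rw [← h]
  abel

/-- The inner product of two orbits of the same flow is constant. Its derivative at zero must
vanish, and after the `l`-terms cancel this is the adjoint relation. -/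
theorem star_resolvent (U : UnitaryFlow H) {l : ℝ} (hl : (l : ℂ).re ≠ 0)
    (hl' : (-(l : ℂ)).re ≠ 0) : star (U.resolvent l hl) = U.resolvent (-l) hl' := by
  symm
  rw [ContinuousLinearMap.star_eq_adjoint, ContinuousLinearMap.eq_adjoint_iff]
  intro x y
  have h1 := U.hasDerivAt_resolvent hl' x
  have h2 := U.hasDerivAt_resolvent hl y
  have h3 := h1.inner ℂ h2
  simp only [inner_op_op] at h3
  have h4 := h3.unique (hasDerivAt_const _ _)
  simp only [op_zero_apply, inner_add_left, inner_add_right, inner_smul_left, inner_smul_right,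
    map_neg, Complex.conj_ofReal, Complex.conj_I] at h4
  have h5 : Complex.I * (inner ℂ (U.resolvent (-l) hl' x) y - inner ℂ x (U.resolvent l hl y)) = 0 := by
    linear_combination h4
  rw [mul_eq_zero, or_iff_right Complex.I_ne_zero, sub_eq_zero] at h5
  exact h5

end UnitaryFlow

/-! ### Weyl systems and the resolvents of their generators -/

section Symplectic

variable {V : Type} [NormedAddCommGroup V] [InnerProductSpace ℂ V]

theorem symp_self (f : V) : symp f f = 0 := by
  exact inner_self_im (𝕜 := ℂ) f

theorem symp_swap (f g : V) : symp g f = -symp f g := by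
  rw [symp, symp, ← inner_conj_symm, Complex.conj_im]

theorem symp_smul_left (a : ℝ) (f g : V) : symp ((a : ℂ) • f) g = a * symp f g := by
  simp [symp]

theorem symp_smul_right (a : ℝ) (f g : V) : symp f ((a : ℂ) • g) = a * symp f g := by
  simp [symp]

theorem symp_add_left (f g h : V) : symp (f + g) h = symp f h + symp g h := by
  simp [symp]

theorem symp_add_right (f g h : V) : symp f (g + h) = symp f g + symp f h := by
  simp [symp]

theorem symp_sum_right {ι : Type*} (s : Finset ι) (f : V) (g : ι → V) :
    symp f (∑ i ∈ s, g i) = ∑ i ∈ s, symp f (g i) := by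
  simp [symp]

theorem symp_zero_left (f : V) : symp 0 f = 0 := by simp [symp]

theorem symp_zero_right (f : V) : symp f 0 = 0 := by simp [symp]

end Symplectic

/-- A regular representation of the Weyl relations over `(V, σ)`. -/
structure WeylSystem (V H : Type) [NormedAddCommGroup V] [InnerProductSpace ℂ V]
    [NormedAddCommGroup H] [InnerProductSpace ℂ H] where
  /-- The Weyl operators. -/
  W : V → H →L[ℂ] H
  W_zero : W 0 = 1
  W_mul : ∀ f g, W f * W g = Complex.exp (-(Complex.I / 2) * symp f g) • W (f + g)
  norm_W : ∀ f v, ‖W f v‖ = ‖v‖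
  continuous_W : ∀ f v, Continuous fun t : ℝ => W ((t : ℂ) • f) v

namespace WeylSystem

variable {V H : Type} [NormedAddCommGroup V] [InnerProductSpace ℂ V]
  [NormedAddCommGroup H] [InnerProductSpace ℂ H]

/-- The one-parameter group `t ↦ W(-t f)`. -/
def flow (S : WeylSystem V H) (f : V) : UnitaryFlow H where
  op t := S.W (((-t : ℝ) : ℂ) • f)
  op_zero := by simp [S.W_zero]
  op_add s t := by
    rw [S.W_mul, symp_smul_left, symp_smul_right, symp_self, ← add_smul]
    simp [add_comm]
  norm_op t v := S.norm_W _ v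
  continuous_op v := (S.continuous_W f v).comp continuous_neg

theorem flow_op (S : WeylSystem V H) (f : V) (t : ℝ) :
    (S.flow f).op t = S.W (((-t : ℝ) : ℂ) • f) := rfl

theorem flow_comm (S : WeylSystem V H) (f g : V) (x t : ℝ) (v : H) :
    (S.flow f).op x ((S.flow g).op t v) =
      Complex.exp (-(Complex.I * t * symp f g) * x) •
        (S.flow g).op t ((S.flow f).op x v) := by
  change (S.W _ * S.W _) v = _ • (S.W _ * S.W _) v
  rw [S.W_mul, S.W_mul, add_comm]
  simp only [smul_apply, smul_smul, ← Complex.exp_add, symp_smul_left,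
    symp_smul_right, symp_swap f g]
  congr 2
  push_cast
  ring

theorem flow_add (S : WeylSystem V H) (f g : V) (t : ℝ) (v : H) :
    (S.flow (f + g)).op t v =
      Complex.exp (-(Complex.I / 2 * symp f g) * t ^ 2) •
        (S.flow g).op t ((S.flow f).op t v) := by
  change S.W _ v = _ • (S.W _ * S.W _) v
  rw [S.W_mul, add_comm _ (((-t : ℝ) : ℂ) • f), ← smul_add]
  simp only [smul_apply, smul_smul, ← Complex.exp_add, symp_smul_left,
    symp_smul_right, symp_swap f g]
  have h : ∀ z : ℂ, z = 0 → Complex.exp z • S.W (((-t : ℝ) : ℂ) • (f + g)) v =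
      S.W (((-t : ℝ) : ℂ) • (f + g)) v := fun z hz => by rw [hz, Complex.exp_zero, one_smul]
  rw [h]
  push_cast
  ring

variable [CompleteSpace H]

/-- Conjugation by a Weyl operator of `g` adds a real constant to the field of `f`, which moves the
spectral parameter in the imaginary direction. For this reason resolvents are defined at complex `z`
with nonzero real part. -/
theorem flow_op_resolvent (S : WeylSystem V H) (f g : V) (t : ℝ) {z z' : ℂ} (hz : z.re ≠ 0)
    (hz' : z'.re ≠ 0) (h : z' = z - Complex.I * t * symp f g) (v : H) :
    (S.flow g).op t ((S.flow f).resolvent z hz v) =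
      (S.flow f).resolvent z' hz' ((S.flow g).op t v) := by
  refine (S.flow f).eq_resolvent_of_hasDerivAt hz' ?_
  simp only [S.flow_comm f g]
  have h1 : HasDerivAt (fun x : ℝ => Complex.exp (-(Complex.I * t * symp f g) * x))
      (-(Complex.I * t * symp f g)) 0 := by
    have h3 := ((Complex.ofRealCLM.hasDerivAt (x := (0 : ℝ))).const_mul
      (-(Complex.I * t * symp f g))).cexp
    simpa using h3
  have h2 := (((S.flow g).op t).restrictScalars ℝ).hasFDerivAt.comp_hasDerivAt (0 : ℝ)
    ((S.flow f).hasDerivAt_resolvent hz v)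
  refine (h1.smul h2).congr_deriv ?_
  simp only [ContinuousLinearMap.coe_restrictScalars', Complex.ofReal_zero, mul_zero,
    Complex.exp_zero, one_smul, Function.comp_apply, UnitaryFlow.op_zero_apply, map_add, map_smul]
  rw [h]
  module

/-- The resolvent of `f` preserves differentiability along the flow of `g`: the shift of the
spectral parameter, rewritten by the first resolvent identity, costs only a term of order `t`. -/
theorem hasDerivAt_flow_resolvent_resolvent (S : WeylSystem V H) (f g : V) {l m : ℝ}
    (hl : (l : ℂ).re ≠ 0) (hm : (m : ℂ).re ≠ 0) (v : H) :
    HasDerivAt (fun t => (S.flow g).op t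
        ((S.flow f).resolvent l hl ((S.flow g).resolvent m hm v)))
      ((m : ℂ) • (S.flow f).resolvent l hl ((S.flow g).resolvent m hm v) +
        Complex.I • ((S.flow f).resolvent l hl v + (Complex.I * symp f g) •
          (S.flow f).resolvent l hl ((S.flow f).resolvent l hl
            ((S.flow g).resolvent m hm v)))) 0 := by
  set Rf := (S.flow f).resolvent l hl with hRf
  set y := (S.flow g).resolvent m hm v with hy
  have key : ∀ t : ℝ, (S.flow g).op t (Rf y) =
      Rf ((S.flow g).op t y) - t • (symp f g : ℂ) • Rf ((S.flow g).op t (Rf y)) := fun t => by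
    have hz : ((l : ℂ) - Complex.I * t * symp f g).re ≠ 0 := by simpa using hl
    have h1 := S.flow_op_resolvent f g t hl hz rfl y
    have h2 := (S.flow f).resolvent_sub_apply hl hz ((S.flow g).op t y)
    rw [← h1] at h2
    rw [eq_sub_iff_add_eq, ← Complex.coe_smul, smul_smul, eq_comm, ← sub_eq_iff_eq_add']
    rw [← hRf] at h2
    rw [h2]
    congr 1
    linear_combination (-(t : ℂ) * symp f g) * Complex.I_mul_I
  have h1 : HasDerivAt (fun t => Rf ((S.flow g).op t y)) (Rf ((m : ℂ) • y + Complex.I • v)) 0 :=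
    (Rf.restrictScalars ℝ).hasFDerivAt.comp_hasDerivAt (0 : ℝ)
      ((S.flow g).hasDerivAt_resolvent hm v)
  -- A product `t • F t` with `F` merely continuous has derivative `F 0` at zero; differentiability
  -- of the orbit of `Rf y` is what is being proved and may not be used here.
  have h2 : HasDerivAt (fun t : ℝ => t • (symp f g : ℂ) • Rf ((S.flow g).op t (Rf y)))
      ((symp f g : ℂ) • Rf (Rf y)) 0 := by
    rw [hasDerivAt_iff_tendsto_slope_zero]
    have hc : Continuous fun t : ℝ => (symp f g : ℂ) • Rf ((S.flow g).op t (Rf y)) :=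
      (Rf.continuous.comp ((S.flow g).continuous_op _)).const_smul _
    have h3 := (hc.tendsto 0).mono_left (nhdsWithin_le_nhds (s := {0}ᶜ))
    rw [UnitaryFlow.op_zero_apply] at h3
    refine h3.congr' ?_
    filter_upwards [self_mem_nhdsWithin] with t ht
    rw [zero_add, zero_smul, sub_zero, inv_smul_smul₀ ht]
  refine ((h1.sub h2).congr_of_eventuallyEq (Eventually.of_forall key)).congr_deriv ?_
  rw [map_add, map_smul, map_smul, smul_add, smul_smul, ← mul_assoc, Complex.I_mul_I]
  module

theorem resolvent_resolvent (S : WeylSystem V H) (f g : V) {l m : ℝ}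
    (hl : (l : ℂ).re ≠ 0) (hm : (m : ℂ).re ≠ 0) (v : H) :
    (S.flow f).resolvent l hl ((S.flow g).resolvent m hm v) =
      (S.flow g).resolvent m hm ((S.flow f).resolvent l hl v + (Complex.I * symp f g) •
          (S.flow f).resolvent l hl ((S.flow f).resolvent l hl
            ((S.flow g).resolvent m hm v))) :=
  (S.flow g).eq_resolvent_of_hasDerivAt hm (S.hasDerivAt_flow_resolvent_resolvent f g hl hm v)

/-- The flow of `f + g` is the product of the two flows up to a phase quadratic in `t`, whose
derivative at zero vanishes. The vector is differentiable along both flows, so the two derivatives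
add up, and `n = l + m` collects the spectral parameters. -/
theorem resolvent_mul_resolvent_add (S : WeylSystem V H) (f g : V) {l m n : ℝ}
    (hl : (l : ℂ).re ≠ 0) (hm : (m : ℂ).re ≠ 0) (hn : (n : ℂ).re ≠ 0) (h : n = l + m) (v : H) :
    (S.flow f).resolvent l hl ((S.flow g).resolvent m hm v) =
      (S.flow (f + g)).resolvent n hn ((S.flow f).resolvent l hl v +
        (S.flow g).resolvent m hm v + (Complex.I * symp f g) •
          (S.flow f).resolvent l hl ((S.flow f).resolvent l hl
            ((S.flow g).resolvent m hm v))) := by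
  refine (S.flow (f + g)).eq_resolvent_of_hasDerivAt hn ?_
  simp only [S.flow_add f g]
  have h1 := (S.flow f).hasDerivAt_resolvent hl ((S.flow g).resolvent m hm v)
  have h2 := (S.flow g).hasDerivAt_op_comp h1 (by
    rw [UnitaryFlow.op_zero_apply]
    exact S.hasDerivAt_flow_resolvent_resolvent f g hl hm v)
  have h3 : HasDerivAt (fun t : ℝ => Complex.exp (-(Complex.I / 2 * symp f g) * t ^ 2)) 0 0 := by
    have h4 := (((Complex.ofRealCLM.hasDerivAt (x := (0 : ℝ))).pow 2).const_mul
      (-(Complex.I / 2 * symp f g))).cexp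
    simpa using h4
  refine (h3.smul h2).congr_deriv ?_
  simp only [Complex.ofReal_zero, UnitaryFlow.op_zero_apply, h]
  simp only [ne_eq, OfNat.ofNat_ne_zero, not_false_eq_true, zero_pow, mul_zero, Complex.exp_zero,
    one_smul, zero_smul, add_zero, Complex.ofReal_add]
  module

theorem ofReal_re_ne_zero (l : ℝˣ) : ((l : ℝ) : ℂ).re ≠ 0 := l.ne_zero

/-- The resolvent of the generator of `t ↦ W(-t f)`. -/
def R (S : WeylSystem V H) (l : ℝˣ) (f : V) : H →L[ℂ] H :=
  (S.flow f).resolvent (l : ℝ) (ofReal_re_ne_zero l)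

/-- The representation of the resolvent relations given by the generators of a Weyl system. -/
def toResolventRep [Nontrivial H] (S : WeylSystem V H) : ResolventRep V where
  H := H
  R l f := S.R l f
  map_zero l := by
    ext v
    symm
    refine (S.flow 0).eq_resolvent_of_hasDerivAt _ ?_
    have h : ((l : ℝ) : ℂ) ≠ 0 := by exact_mod_cast l.ne_zero
    simp only [flow_op, smul_zero, S.W_zero, one_apply_eq_self,
      smul_apply, smul_smul, mul_div_cancel₀ _ h]
    rw [← add_smul, neg_add_cancel, zero_smul]
    exact hasDerivAt_const _ _
  star_eq l f := by
    have h := (S.flow f).star_resolvent (ofReal_re_ne_zero l)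
      (by simp)
    refine h.trans ?_
    unfold R
    congr 1
    simp
  scale n l f := by
    ext v
    rw [smul_apply, ← map_smul]
    symm
    refine (S.flow _).eq_resolvent_of_hasDerivAt _ ?_
    have h1 : HasDerivAt (fun t => ((S.flow f).rescale (n : ℝ)).op t (S.R l f v))
        ((n : ℝ) • (((l : ℝ) : ℂ) • S.R l f v + Complex.I • v)) 0 := (S.flow f).hasDerivAt_rescale (n : ℝ)
      ((S.flow f).hasDerivAt_resolvent (ofReal_re_ne_zero l) v)
    refine (h1.congr_of_eventuallyEq (Eventually.of_forall fun t => ?_)).congr_deriv ?_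
    · change S.W _ _ = S.W _ _
      rw [smul_smul]
      congr 3
      push_cast; ring
    · rw [← Complex.coe_smul]
      push_cast
      module
  resolvent_identity l m f := by
    ext v
    have h := (S.flow f).resolvent_sub_apply (ofReal_re_ne_zero l) (ofReal_re_ne_zero m) v
    rw [← Complex.ofReal_sub] at h
    exact h
  commutator l m f g := by
    ext v
    -- The roles of `f` and `g` are exchanged so that the squared resolvent in the correction term
    -- is the one of `g`; antisymmetry of `σ` then fixes the sign.
    have h := S.resolvent_resolvent g f (ofReal_re_ne_zero m) (ofReal_re_ne_zero l) v
    rw [map_add, map_smul, symp_swap f g] at h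
    simp only [pow_two]
    have key : ∀ X Y Z : H, X = Y + (Complex.I * ((-symp f g : ℝ) : ℂ)) • Z →
        Y - X = (Complex.I * (symp f g : ℂ)) • Z := fun X Y Z h => by
      rw [h]
      push_cast
      module
    exact key _ _ _ h
  product l m n f g h := by
    ext v
    simp only [pow_two]
    exact S.resolvent_mul_resolvent_add f g (ofReal_re_ne_zero l) (ofReal_re_ne_zero m)
      (ofReal_re_ne_zero n) h v

end WeylSystem

/-! ### The `n`-point functions of the resolvents of a Weyl system -/

theorem ofFn_sum_lt_succ {n : ℕ} (a : Fin (n + 1) → Fin (n + 1) → ℂ) :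
    (∑ j, ∑ k, if j < k then a j k else 0) =
      (∑ k : Fin n, a 0 k.succ) + ∑ j : Fin n, ∑ k : Fin n,
        if j < k then a j.succ k.succ else 0 := by
  rw [Fin.sum_univ_succ]
  congr 1
  · rw [Fin.sum_univ_succ]
    simp
  · refine Finset.sum_congr rfl fun j _ => ?_
    rw [Fin.sum_univ_succ]
    simp

/-- The coefficient of `exp (-l t) W(-t f)` in the Laplace representation of the resolvent. -/
def laplaceCoeff (l : ℝˣ) (t : ℝ) : ℂ :=
  -Complex.I * (Real.sign l : ℂ) * Complex.exp (-(|(l : ℝ)| * t : ℝ))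

theorem continuous_laplaceCoeff (l : ℝˣ) : Continuous (laplaceCoeff l) := by
  unfold laplaceCoeff; fun_prop

theorem abs_sign_unit (l : ℝˣ) : |Real.sign (l : ℝ)| = 1 := by
  rcases Real.sign_apply_eq_of_ne_zero (l : ℝ) l.ne_zero with h | h <;> simp [h]

theorem norm_laplaceCoeff (l : ℝˣ) (t : ℝ) :
    ‖laplaceCoeff l t‖ = Real.exp (-(|(l : ℝ)| * t)) := by
  simp [laplaceCoeff, Complex.norm_exp, abs_sign_unit]

theorem integrable_laplaceCoeff (l : ℝˣ) :
    Integrable (laplaceCoeff l) (volume.restrict (Set.Ioi (0 : ℝ))) := by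
  refine Integrable.mono' (UnitaryFlow.integrableOn_exp_neg_mul (abs_pos.2 l.ne_zero))
    (continuous_laplaceCoeff l).aestronglyMeasurable (Eventually.of_forall fun t => ?_)
  rw [norm_laplaceCoeff]

/-- The measure `dt₁ ⋯ dtₙ` on `(0, ∞)ⁿ`. -/
def orthantMeasure (n : ℕ) : Measure (Fin n → ℝ) :=
  Measure.pi fun _ => volume.restrict (Set.Ioi (0 : ℝ))

theorem orthantMeasure_eq (n : ℕ) : orthantMeasure n =
    (volume : Measure (Fin n → ℝ)).restrict (Set.univ.pi fun _ => Set.Ioi (0 : ℝ)) := by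
  rw [orthantMeasure, volume_pi, Measure.restrict_pi_pi]

theorem integrable_prod_laplaceCoeff {n : ℕ} (l : Fin n → ℝˣ) :
    Integrable (fun t : Fin n → ℝ => ∏ j, laplaceCoeff (l j) (t j)) (orthantMeasure n) :=
  Integrable.fintype_prod fun j => integrable_laplaceCoeff (l j)

theorem integral_orthantMeasure_succ {E : Type*} [NormedAddCommGroup E] [NormedSpace ℝ E] {n : ℕ}
    (F : (Fin (n + 1) → ℝ) → E) (hF : Integrable F (orthantMeasure (n + 1))) :
    ∫ t, F t ∂orthantMeasure (n + 1) =
      ∫ x in Set.Ioi (0 : ℝ), ∫ t, F (Fin.cons x t) ∂orthantMeasure n := by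
  have h := (measurePreserving_piFinSuccAbove
    (fun _ : Fin (n + 1) => volume.restrict (Set.Ioi (0 : ℝ))) 0).symm
  have h1 : ∫ x, (F ∘ (MeasurableEquiv.piFinSuccAbove (fun _ => ℝ) 0).symm) x ∂_ = _ :=
    h.integral_comp' F
  have h2 := (h.integrable_comp_emb (MeasurableEquiv.measurableEmbedding _)).2 hF
  rw [orthantMeasure, ← h1, integral_prod _ h2]
  simp_rw [Function.comp_apply, MeasurableEquiv.piFinSuccAbove_symm_apply, Fin.insertNthEquiv,
    Equiv.coe_fn_mk, Fin.insertNth_zero']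
  rfl

namespace WeylSystem

variable {V H : Type} [NormedAddCommGroup V] [InnerProductSpace ℂ V]
  [NormedAddCommGroup H] [InnerProductSpace ℂ H]

theorem prod_W (S : WeylSystem V H) {n : ℕ} (g : Fin n → V) :
    (List.ofFn fun j => S.W (g j)).prod = Complex.exp (-(Complex.I / 2) *
      ∑ j, ∑ k, if j < k then (symp (g j) (g k) : ℂ) else 0) • S.W (∑ j, g j) := by
  induction n with
  | zero => simp [S.W_zero]
  | succ n ih =>
    rw [List.ofFn_succ, List.prod_cons, ih fun j => g j.succ, mul_smul_comm, S.W_mul, smul_smul,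
      ← Complex.exp_add, ofFn_sum_lt_succ (fun j k => (symp (g j) (g k) : ℂ)), Fin.sum_univ_succ g,
      symp_sum_right]
    congr 2
    push_cast
    ring

theorem inner_prod_W (S : WeylSystem V H) {Ω : H} {χ : V → ℂ} (hχ : ∀ f, inner ℂ Ω (S.W f Ω) = χ f)
    {n : ℕ} (g : Fin n → V) :
    inner ℂ Ω ((List.ofFn fun j => S.W (g j)).prod Ω) = weylCorrelation χ g := by
  rw [S.prod_W, smul_apply, inner_smul_right, hχ]
  rfl

/-- The integrand of the Laplace representation of a product of resolvents. -/
def wordIntegrand (S : WeylSystem V H) {n : ℕ} (l : Fin n → ℝˣ) (f : Fin n → V) (v : H)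
    (t : Fin n → ℝ) : H :=
  (∏ j, laplaceCoeff (l j) (t j)) •
    (List.ofFn fun j => S.W (((-(Real.sign (l j) * t j) : ℝ) : ℂ) • f j)).prod v

/-- Strong continuity becomes joint continuity because the operators are isometric. Products of
several Weyl operators are treated with it by induction. -/
theorem continuous_flow_apply (S : WeylSystem V H) {X : Type*} [TopologicalSpace X] (f : V)
    {a : X → ℝ} {y : X → H} (ha : Continuous a) (hy : Continuous y) :
    Continuous fun x => S.W ((a x : ℂ) • f) (y x) := by
  rw [continuous_iff_continuousAt]
  intro x₀
  have h1 : Tendsto (fun x => S.W ((a x : ℂ) • f) (y x - y x₀)) (𝓝 x₀) (𝓝 0) := by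
    rw [tendsto_zero_iff_norm_tendsto_zero]
    simp only [S.norm_W]
    exact tendsto_iff_norm_sub_tendsto_zero.1 (hy.tendsto x₀)
  have h2 := ((S.continuous_W f (y x₀)).comp ha).tendsto x₀
  have h3 := h1.add h2
  rw [zero_add] at h3
  refine h3.congr fun x => ?_
  simp

theorem norm_prod_W (S : WeylSystem V H) {n : ℕ} (g : Fin n → V) (v : H) :
    ‖(List.ofFn fun j => S.W (g j)).prod v‖ = ‖v‖ := by
  induction n with
  | zero => simp
  | succ n ih =>
    rw [List.ofFn_succ, List.prod_cons, mul_apply_eq_comp, S.norm_W, ih]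

theorem continuous_prod_W (S : WeylSystem V H) {n : ℕ} (l : Fin n → ℝ) (f : Fin n → V) (v : H) :
    Continuous fun t : Fin n → ℝ =>
      (List.ofFn fun j => S.W (((-(l j * t j) : ℝ) : ℂ) • f j)).prod v := by
  induction n with
  | zero => simpa using continuous_const
  | succ n ih =>
    simp only [List.ofFn_succ, List.prod_cons]
    refine S.continuous_flow_apply (f 0) (a := fun t => -(l 0 * t 0)) (by fun_prop)
      (y := fun t : Fin (n + 1) → ℝ =>
        (List.ofFn fun j : Fin n => S.W (((-(l j.succ * t j.succ) : ℝ) : ℂ) • f j.succ)).prod v) ?_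
    exact (ih (fun j => l j.succ) fun j => f j.succ).comp
      (continuous_pi fun j => continuous_apply j.succ)

theorem integrable_wordIntegrand (S : WeylSystem V H) {n : ℕ} (l : Fin n → ℝˣ) (f : Fin n → V)
    (v : H) : Integrable (S.wordIntegrand l f v) (orthantMeasure n) := by
  refine Integrable.mono' ((integrable_prod_laplaceCoeff l).norm.mul_const ‖v‖) ?_
    (Eventually.of_forall fun t => ?_)
  · have h1 := S.continuous_prod_W (fun j => Real.sign (l j)) f v
    have h2 : Continuous fun t : Fin n → ℝ => ∏ j, laplaceCoeff (l j) (t j) :=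
      continuous_finsetProd _ fun j _ => (continuous_laplaceCoeff (l j)).comp (continuous_apply j)
    have h3 : Continuous (S.wordIntegrand l f v) := h2.smul h1
    exact h3.aestronglyMeasurable
  · rw [wordIntegrand, norm_smul, S.norm_prod_W]

theorem R_apply (S : WeylSystem V H) (l : ℝˣ) (f : V) (v : H) :
    S.R l f v = ∫ t in Set.Ioi (0 : ℝ),
      laplaceCoeff l t • S.W (((-(Real.sign (l : ℝ) * t) : ℝ) : ℂ) • f) v :=
  (S.flow f).resolvent_apply (ofReal_re_ne_zero l) v

variable [CompleteSpace H]

/-- Induction on the length of the word: the leftmost Weyl operator passes under the Bochner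
integral of the remaining ones, and Fubini joins the integrals. Keeping the identity vector-valued
is what lets the induction run. -/
theorem prod_resolvent_apply (S : WeylSystem V H) {n : ℕ} (l : Fin n → ℝˣ) (f : Fin n → V)
    (v : H) : (List.ofFn fun j => S.R (l j) (f j)).prod v =
      ∫ t, S.wordIntegrand l f v t ∂orthantMeasure n := by
  induction n with
  | zero =>
    rw [orthantMeasure, Measure.pi_of_empty, integral_dirac]
    simp [wordIntegrand]
  | succ n ih =>
    rw [integral_orthantMeasure_succ _ (S.integrable_wordIntegrand l f v), List.ofFn_succ,
      List.prod_cons, mul_apply_eq_comp, ih (fun j => l j.succ) fun j => f j.succ, S.R_apply]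
    refine setIntegral_congr_fun measurableSet_Ioi fun x _ => ?_
    rw [← ContinuousLinearMap.integral_comp_comm _ (S.integrable_wordIntegrand _ _ v),
      ← integral_smul]
    refine integral_congr_ae (Eventually.of_forall fun t => ?_)
    simp only [wordIntegrand, Fin.prod_univ_succ, Fin.cons_zero, Fin.cons_succ, List.ofFn_succ,
      List.prod_cons, map_smul, smul_smul]
    rfl

theorem inner_prod_resolvent (S : WeylSystem V H) {Ω : H} {χ : V → ℂ}
    (hχ : ∀ f, inner ℂ Ω (S.W f Ω) = χ f) {n : ℕ} (l : Fin n → ℝˣ) (f : Fin n → V) :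
    inner ℂ Ω ((List.ofFn fun j => S.R (l j) (f j)).prod Ω) =
      resolventCorrelation χ l f := by
  rw [S.prod_resolvent_apply, ← integral_inner (S.integrable_wordIntegrand l f Ω),
    resolventCorrelation, ← orthantMeasure_eq]
  refine integral_congr_ae (Eventually.of_forall fun t => ?_)
  simp only [wordIntegrand, inner_smul_right, S.inner_prod_W hχ]
  rfl

end WeylSystem

/-! ### States given by vectors of representations -/

section VectorState

variable {V : Type} [NormedAddCommGroup V] [InnerProductSpace ℂ V]

/-- The operator representing an element of the resolvent algebra. -/
def repHom (π : ResolventRep V) : ResolventAlgebra V →⋆ₐ[ℂ] (π.H →L[ℂ] π.H) where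
  toFun a := RepFamilies.eval a.1 π
  map_one' := rfl
  map_mul' _ _ := rfl
  map_zero' := rfl
  map_add' _ _ := rfl
  commutes' _ := rfl
  map_star' _ := rfl

theorem norm_repHom_le (π : ResolventRep V) (a : ResolventAlgebra V) : ‖repHom π a‖ ≤ ‖a‖ :=
  RepFamilies.norm_eval_le a.1 π

/-- The functional `a ↦ ⟨Ω, π(a) Ω⟩`. -/
def vectorState (π : ResolventRep V) (Ω : π.H) : ResolventAlgebra V →L[ℂ] ℂ :=
  LinearMap.mkContinuous
    { toFun := fun a => inner ℂ Ω (repHom π a Ω)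
      map_add' := fun a b => by rw [map_add, add_apply, inner_add_right]
      map_smul' := fun c a => by
        rw [map_smul, smul_apply, inner_smul_right]; rfl } (‖Ω‖ * ‖Ω‖) fun a => by
      change ‖inner ℂ Ω (repHom π a Ω)‖ ≤ _
      refine (norm_inner_le_norm _ _).trans ?_
      have h := ((repHom π a).le_opNorm Ω).trans
        (mul_le_mul_of_nonneg_right (norm_repHom_le π a) (norm_nonneg Ω))
      nlinarith [mul_le_mul_of_nonneg_left h (norm_nonneg Ω)]

theorem vectorState_apply (π : ResolventRep V) (Ω : π.H) (a : ResolventAlgebra V) :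
    vectorState π Ω a = inner ℂ Ω (repHom π a Ω) := rfl

theorem isState_vectorState (π : ResolventRep V) {Ω : π.H} (hΩ : ‖Ω‖ = 1) :
    IsState (vectorState π Ω) where
  map_one := by
    rw [vectorState_apply, map_one, one_apply_eq_self, inner_self_eq_norm_sq_to_K, hΩ]
    simp
  nonneg a := by
    have h : vectorState π Ω (star a * a) = ((‖repHom π a Ω‖ ^ 2 : ℝ) : ℂ) := by
      rw [vectorState_apply, map_mul, map_star, mul_apply_eq_comp, ContinuousLinearMap.star_eq_adjoint,
        ContinuousLinearMap.adjoint_inner_right, inner_self_eq_norm_sq_to_K]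
      simp
    rw [h, Complex.ofReal_re, Complex.ofReal_im]
    exact ⟨by positivity, rfl⟩

theorem vectorState_word (π : ResolventRep V) (Ω : π.H) {n : ℕ} (l : Fin n → ℝˣ) (f : Fin n → V) :
    vectorState π Ω (List.ofFn fun j => resolvent (l j) (f j)).prod =
      inner ℂ Ω ((List.ofFn fun j => π.R (l j) (f j)).prod Ω) := by
  rw [vectorState_apply, map_list_prod, List.map_ofFn]
  rfl

theorem exists_state_of_weylSystem {H : Type} [NormedAddCommGroup H] [InnerProductSpace ℂ H]
    [CompleteSpace H] (S : WeylSystem V H) {Ω : H} {χ : V → ℂ} (hΩ : ‖Ω‖ = 1)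
    (hχ : ∀ f, inner ℂ Ω (S.W f Ω) = χ f) :
    ∃ ψ : ResolventAlgebra V →L[ℂ] ℂ, IsStateWithCharacteristic ψ χ := by
  have : Nontrivial H := ⟨⟨Ω, 0, fun h => by simp [h] at hΩ⟩⟩
  refine ⟨vectorState S.toResolventRep Ω, isState_vectorState _ hΩ, fun n l f => ?_⟩
  exact (vectorState_word S.toResolventRep Ω l f).trans (S.inner_prod_resolvent hχ l f)

end VectorState

/-! ### Weyl systems from positive definite functions -/

section PositiveDefinite

open scoped ComplexOrder

theorem exists_hilbert_of_posSemidef {X : Type} {K : Matrix X X ℂ} (hK : K.PosSemidef) :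
    ∃ (H : Type) (_ : NormedAddCommGroup H) (_ : InnerProductSpace ℂ H) (_ : CompleteSpace H)
      (k : X → H), (∀ x y, inner ℂ (k x) (k y) = K x y) ∧
        DenseRange (Finsupp.linearCombination ℂ k) := by
  -- The Hilbert space is the reproducing kernel space of `K`. The construction takes
  -- operator-valued kernels, so each scalar becomes a multiplication operator on `ℂ`.
  set K' : Matrix X X (ℂ →L[ℂ] ℂ) := Matrix.of fun x y => K x y • 1 with hK'
  have hp : K'.PosSemidef := by
    have htf : K'.PosSemidef ↔ K'.IsHermitian ∧ ∀ v : X →₀ ℂ,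
        0 ≤ RCLike.re (v.sum fun x w => v.sum fun x' w' => inner ℂ (K' x' x w) w') :=
      RKHS.posSemidef_tfae.out 0 2
    refine htf.2 ⟨?_, fun v => ?_⟩
    · ext x y
      have := hK.isHermitian.apply x y
      simp [hK', this]
    · have := hK.2 v
      rw [Finsupp.sum_comm]
      have h2 := (Complex.nonneg_iff.1 this).1
      rw [← Complex.conj_re, map_finsuppSum] at h2
      refine h2.trans_eq (congrArg Complex.re (Finsupp.sum_congr fun i _ => ?_))
      rw [map_finsuppSum]
      refine Finsupp.sum_congr fun j _ => ?_
      simp [hK']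
      ring
  have : Fact K'.PosSemidef := ⟨hp⟩
  refine ⟨RKHS.OfKernel K', inferInstance, inferInstance, inferInstance,
    fun x => RKHS.kerFun _ x 1, fun x y => ?_, ?_⟩
  · rw [← RKHS.kernel_inner, RKHS.OfKernel.kernel_ofKernel]
    have := hK.isHermitian.apply x y
    simp [hK', ← this]
  · have := RKHS.kerFun_dense (RKHS.OfKernel K')
    change Dense (Set.range (Finsupp.linearCombination ℂ fun x =>
      RKHS.kerFun (RKHS.OfKernel K') x 1))
    rw [← LinearMap.coe_range, Finsupp.range_linearCombination,
      Submodule.dense_iff_topologicalClosure_eq_top, eq_top_iff, ← this]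
    refine Submodule.topologicalClosure_mono (Submodule.span_le.2 ?_)
    rintro _ ⟨x, v, rfl⟩
    have hv : RKHS.kerFun (RKHS.OfKernel K') x v = v • RKHS.kerFun (RKHS.OfKernel K') x 1 := by
      rw [← map_smul, smul_eq_mul, mul_one]
    rw [hv]
    exact Submodule.smul_mem _ _ (Submodule.subset_span ⟨x, rfl⟩)

/-- Equal Gram matrices give equal norms of all finite linear combinations, so `k x ↦ k' x` is well
defined and isometric on a dense subspace and extends to `H`. -/
theorem exists_isometry_of_gram {X H : Type} [NormedAddCommGroup H] [InnerProductSpace ℂ H]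
    [CompleteSpace H] {k k' : X → H} (hk : DenseRange (Finsupp.linearCombination ℂ k))
    (h : ∀ x y, inner ℂ (k' x) (k' y) = inner ℂ (k x) (k y)) :
    ∃ T : H →L[ℂ] H, (∀ x, T (k x) = k' x) ∧ ∀ v, ‖T v‖ = ‖v‖ := by
  have hn : ∀ a : X →₀ ℂ, ‖Finsupp.linearCombination ℂ k' a‖ = ‖Finsupp.linearCombination ℂ k a‖ := by
    intro a
    rw [← sq_eq_sq₀ (norm_nonneg _) (norm_nonneg _), ← inner_self_eq_norm_sq (𝕜 := ℂ),
      ← inner_self_eq_norm_sq (𝕜 := ℂ)]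
    congr 1
    simp only [Finsupp.linearCombination_apply, Finsupp.sum_inner, Finsupp.inner_sum,
      inner_smul_left, inner_smul_right, h]
  have hb : ∃ C, ∀ a : X →₀ ℂ,
      ‖Finsupp.linearCombination ℂ k' a‖ ≤ C * ‖Finsupp.linearCombination ℂ k a‖ :=
    ⟨1, fun a => by rw [hn, one_mul]⟩
  have he := LinearMap.extendOfNorm_eq (f := Finsupp.linearCombination ℂ k') hk hb
  refine ⟨(Finsupp.linearCombination ℂ k').extendOfNorm (Finsupp.linearCombination ℂ k),
    fun x => ?_, fun v => ?_⟩
  · simpa using he (Finsupp.single x 1)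
  · refine hk.induction_on (p := fun v => ‖_‖ = ‖v‖) v ?_ fun a => ?_
    · exact isClosed_eq (by fun_prop) (by fun_prop)
    · rw [he, hn]

variable {V : Type} [NormedAddCommGroup V] [InnerProductSpace ℂ V]

/-- The kernel `⟨W(f) Ω, W(g) Ω⟩` determined by `⟨Ω, W(f) Ω⟩ = χ f`. -/
def weylKernel (χ : V → ℂ) : Matrix V V ℂ :=
  Matrix.of fun f g => Complex.exp (Complex.I / 2 * symp f g) * χ (g - f)

/-- A GNS construction. The vectors `k g` play the role of `W(g) Ω`, so the Weyl relations dictate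
the action of `W f` on them; it preserves the Gram matrix because the phases cancel. Regularity
comes from continuity of `χ` along lines. -/
theorem exists_weylSystem {χ : V → ℂ} (hχ : (weylKernel χ).PosSemidef) (h0 : χ 0 = 1)
    (hc : ∀ f g : V, Continuous fun t : ℝ => χ ((t : ℂ) • f + g)) :
    ∃ (H : Type) (_ : NormedAddCommGroup H) (_ : InnerProductSpace ℂ H) (_ : CompleteSpace H)
      (S : WeylSystem V H) (Ω : H), ‖Ω‖ = 1 ∧ ∀ f, inner ℂ Ω (S.W f Ω) = χ f := by
  obtain ⟨H, i1, i2, i3, k, hk, hd⟩ := exists_hilbert_of_posSemidef hχ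
  have hW : ∀ f : V, ∃ T : H →L[ℂ] H, (∀ g, T (k g) =
      Complex.exp (-(Complex.I / 2) * symp f g) • k (f + g)) ∧ ∀ v, ‖T v‖ = ‖v‖ := fun f => by
    refine exists_isometry_of_gram hd (k' := fun g =>
      Complex.exp (-(Complex.I / 2) * symp f g) • k (f + g)) fun g h => ?_
    rw [inner_smul_left, inner_smul_right, hk, hk, ← Complex.exp_conj]
    simp only [weylKernel, Matrix.of_apply, add_sub_add_left_eq_sub, ← mul_assoc, ← Complex.exp_add,
      symp_add_left, symp_add_right, symp_self, symp_swap f g]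
    congr 2
    simp only [map_mul, map_neg, map_div₀, Complex.conj_I, Complex.conj_ofReal, map_ofNat]
    push_cast
    ring
  choose W hWk hWn using hW
  have hext : ∀ T T' : H →L[ℂ] H, (∀ g, T (k g) = T' (k g)) → T = T' := fun T T' h => by
    refine ContinuousLinearMap.ext fun v => ?_
    refine hd.induction_on (p := fun v => T v = T' v) v
      (isClosed_eq T.continuous T'.continuous) fun a => ?_
    simp [Finsupp.linearCombination_apply, Finsupp.sum, h]
  have hcont : ∀ (f : V) (v : H), Continuous fun t : ℝ => W ((t : ℂ) • f) v := by
    intro f v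
    refine hd.induction_on (p := fun v => Continuous fun t : ℝ => W ((t : ℂ) • f) v) v ?_ ?_
    -- Vectors with continuous orbits form a closed set: by isometry, nearby vectors have uniformly
    -- close orbits.
    · refine isClosed_of_closure_subset fun v hv => ?_
      rw [Set.mem_ofPred_eq]
      refine continuous_of_uniform_approx_of_continuous fun u hu => ?_
      obtain ⟨ε, hε, hεu⟩ := Metric.mem_uniformity_dist.1 hu
      obtain ⟨w, hw, hvw⟩ := Metric.mem_closure_iff.1 hv ε hε
      refine ⟨_, hw, fun t => hεu ?_⟩
      rw [dist_eq_norm, ← map_sub, hWn, ← dist_eq_norm]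
      exact hvw
    · intro a
      simp only [Finsupp.linearCombination_apply, Finsupp.sum, map_sum, map_smul]
      refine continuous_finsetSum _ fun g _ => Continuous.const_smul ?_ _
      simp only [hWk, symp_smul_left]
      have hk' : Continuous fun t : ℝ => k ((t : ℂ) • f + g) := by
        rw [continuous_iff_continuousAt]
        intro t₀
        rw [ContinuousAt, tendsto_iff_norm_sub_tendsto_zero]
        -- All `k x` are unit vectors, so their distance is controlled by the real part of the
        -- kernel.
        have h1 : ∀ t : ℝ, ‖k ((t : ℂ) • f + g) - k ((t₀ : ℂ) • f + g)‖ ^ 2 = 2 - 2 *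
            (Complex.exp (Complex.I / 2 * symp ((t : ℂ) • f + g) ((t₀ : ℂ) • f + g)) *
              χ (((t₀ - t : ℝ) : ℂ) • f + 0)).re := fun t => by
          have h2 : ∀ x, ‖k x‖ ^ 2 = 1 := fun x => by
            rw [← inner_self_eq_norm_sq (𝕜 := ℂ), hk]
            simp [weylKernel, symp_self, h0]
          rw [@norm_sub_sq ℂ, h2, h2, hk]
          simp only [weylKernel, Matrix.of_apply, add_sub_add_right_eq_sub, add_zero,
            Complex.ofReal_sub, sub_smul, RCLike.re_eq_complex_re]
          ring
        have h3 : Tendsto (fun t : ℝ => ‖k ((t : ℂ) • f + g) - k ((t₀ : ℂ) • f + g)‖ ^ 2) (𝓝 t₀)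
            (𝓝 0) := by
          simp only [h1]
          have h4 := (hc f 0).comp (continuous_const.sub continuous_id : Continuous fun t => t₀ - t)
          have h5 : Continuous fun t : ℝ => 2 - 2 *
            (Complex.exp (Complex.I / 2 * symp ((t : ℂ) • f + g) ((t₀ : ℂ) • f + g)) *
              χ (((t₀ - t : ℝ) : ℂ) • f + 0)).re := by
            simp only [symp_add_left, symp_smul_left, symp_add_right, symp_smul_right]
            simp only [Function.comp_def] at h4
            exact continuous_const.sub (continuous_const.mul (Complex.continuous_re.comp
              (Continuous.mul (by fun_prop) h4)))
          have h6 := h5.tendsto t₀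
          simpa [symp_self, h0] using h6
        have h7 := h3.sqrt
        simpa using h7
      exact Continuous.smul (by fun_prop) hk'
  have hinner : ∀ f, inner ℂ (k 0) (W f (k 0)) = χ f := fun f => by
    rw [hWk, inner_smul_right, hk]
    simp [weylKernel, symp_zero_left, symp_zero_right]
  refine ⟨H, i1, i2, i3, ⟨W, ?_, fun f g => ?_, hWn, hcont⟩, k 0, ?_, hinner⟩
  · exact hext _ _ fun g => by simp [hWk, symp_zero_left]
  · refine hext _ _ fun h => ?_
    rw [mul_apply_eq_comp, hWk, map_smul, hWk, smul_apply, hWk, smul_smul, smul_smul,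
      ← Complex.exp_add, ← Complex.exp_add, add_assoc]
    simp only [symp_add_left, symp_add_right]
    congr 2
    push_cast
    ring
  · rw [← sq_eq_sq₀ (norm_nonneg _) zero_le_one, ← inner_self_eq_norm_sq (𝕜 := ℂ), hk]
    simp [weylKernel, symp_self, h0]

end PositiveDefinite

/-! ### Quasi-free states -/

section QuasiFree

open scoped ComplexOrder

/-- Entrywise powers are positive by the Schur product theorem, and the exponential series combines
them with nonnegative coefficients. -/
theorem posSemidef_exp {X : Type*} {M : Matrix X X ℂ} (hM : M.PosSemidef) :
    (Matrix.of fun x y => Complex.exp (M x y)).PosSemidef := by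
  have hone : (Matrix.of fun _ _ : X => (1 : ℂ)).PosSemidef := by
    refine ⟨by ext; simp, fun v => ?_⟩
    have h : (v.sum fun i vi => v.sum fun j vj => star vi * (Matrix.of fun _ _ : X => (1 : ℂ)) i j * vj)
        = star (v.sum fun _ vi => vi) * v.sum fun _ vj => vj := by
      simp [Finsupp.sum, Finset.sum_mul_sum]
    rw [h]
    exact star_mul_self_nonneg _
  have hpow : ∀ n : ℕ, (Matrix.of fun x y => M x y ^ n).PosSemidef := fun n => by
    induction n with
    | zero => simpa using hone
    | succ n ih =>
      have h : (Matrix.of fun x y => M x y ^ (n + 1)) =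
          (Matrix.of fun x y => M x y ^ n).hadamard M := by
        ext x y
        simp [pow_succ]
      rw [h]
      exact ih.hadamard hM
  refine ⟨?_, fun v => ?_⟩
  · ext x y
    have := hM.isHermitian.apply x y
    simp only [Matrix.conjTranspose_apply, Matrix.of_apply]
    rw [← this]
    simp [← Complex.exp_conj]
  · have hs : HasSum (fun n : ℕ => v.sum fun i vi => v.sum fun j vj =>
        star vi * ((n.factorial : ℂ)⁻¹ * M i j ^ n) * vj)
        (v.sum fun i vi => v.sum fun j vj => star vi * Complex.exp (M i j) * vj) := by
      refine hasSum_sum fun i _ => hasSum_sum fun j _ => ?_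
      refine HasSum.mul_right _ (HasSum.mul_left _ ?_)
      have := NormedSpace.expSeries_div_hasSum_exp (M i j)
      rw [← Complex.exp_eq_exp_ℂ] at this
      simpa [div_eq_inv_mul] using this
    refine hs.nonneg fun n => ?_
    have h1 := (hpow n).2 v
    have h2 : (0 : ℂ) ≤ (n.factorial : ℂ)⁻¹ := by
      rw [inv_nonneg]
      exact_mod_cast Nat.zero_le _
    refine (mul_nonneg h2 h1).trans_eq ?_
    simp only [Finsupp.sum, Finset.mul_sum, Matrix.of_apply]
    refine Finset.sum_congr rfl fun i _ => Finset.sum_congr rfl fun j _ => ?_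
    ring

variable {V : Type} [NormedAddCommGroup V] [InnerProductSpace ℂ V]
  {E : Type*} [NormedAddCommGroup E] [InnerProductSpace ℂ E]

theorem sum_star_mul_inner_mul (T : V →ₗ[ℂ] E) (x : V →₀ ℂ) :
    (x.sum fun i xi => x.sum fun j xj => star xi * inner ℂ (T i) (T j) * xj) =
      ((‖T (Finsupp.linearCombination ℂ id x)‖ ^ 2 : ℝ) : ℂ) := by
  have h := inner_self_eq_norm_sq_to_K (𝕜 := ℂ) (T (Finsupp.linearCombination ℂ id x))
  rw [Complex.ofReal_pow]
  refine Eq.trans ?_ h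
  simp only [Finsupp.linearCombination_apply, Finsupp.sum, map_sum, map_smul, sum_inner, inner_sum,
    inner_smul_left, inner_smul_right, id]
  rw [Finset.sum_comm]
  refine Finset.sum_congr rfl fun i _ => ?_
  rw [Finset.mul_sum]
  refine Finset.sum_congr rfl fun j _ => ?_
  simp only [RCLike.star_def]
  ring

theorem posSemidef_inner_add {T : V →ₗ[ℂ] E} {ε : ℝ} (hT : ∀ f, ε * ‖f‖ ^ 2 ≤ ‖T f‖ ^ 2) :
    (Matrix.of fun f g : V => inner ℂ (T f) (T g) - ε * inner ℂ f g).PosSemidef := by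
  refine ⟨?_, fun x => ?_⟩
  · ext f g
    rw [Matrix.conjTranspose_apply, Matrix.of_apply, Matrix.of_apply, star_sub, star_mul',
      RCLike.star_def, inner_conj_symm, inner_conj_symm, Complex.conj_ofReal]
  · have h1 := sum_star_mul_inner_mul T x
    have h2 := sum_star_mul_inner_mul (LinearMap.id : V →ₗ[ℂ] V) x
    set F := Finsupp.linearCombination ℂ id x
    have h3 : (x.sum fun i xi => x.sum fun j xj => star xi *
        (Matrix.of fun f g : V => inner ℂ (T f) (T g) - ε * inner ℂ f g) i j * xj) =
        ((‖T F‖ ^ 2 - ε * ‖F‖ ^ 2 : ℝ) : ℂ) := by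
      rw [Complex.ofReal_sub, Complex.ofReal_mul, ← h1]
      change _ = _ - (ε : ℂ) * ((‖(LinearMap.id : V →ₗ[ℂ] V) F‖ ^ 2 : ℝ) : ℂ)
      rw [← h2]
      simp only [Finsupp.sum, Finset.mul_sum, ← Finset.sum_sub_distrib, Matrix.of_apply,
        LinearMap.id_apply]
      refine Finset.sum_congr rfl fun i _ => Finset.sum_congr rfl fun j _ => ?_
      ring
    rw [h3]
    exact_mod_cast sub_nonneg.2 (hT F)

/-- The kernel is the average of `⟨T f, T g⟩ + ⟨f, g⟩` and of the transpose, hence the complex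
conjugate, of `⟨T f, T g⟩ - ⟨f, g⟩`. Domination by `T` makes the second one positive. -/
theorem posSemidef_re_inner_add_symp {T : V →ₗ[ℂ] E} (hT : ∀ f, ‖f‖ ≤ ‖T f‖) :
    (Matrix.of fun f g : V => ((inner ℂ (T f) (T g)).re : ℂ) + Complex.I * symp f g).PosSemidef := by
  have hT2 : ∀ f, ‖f‖ ^ 2 ≤ ‖T f‖ ^ 2 := fun f => pow_le_pow_left₀ (norm_nonneg _) (hT f) 2
  have h1 := posSemidef_inner_add (T := T) (ε := -1) fun f => by
    nlinarith [sq_nonneg ‖f‖, sq_nonneg ‖T f‖]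
  have h2 := (posSemidef_inner_add (T := T) (ε := 1) fun f => by simpa using hT2 f).transpose
  have h3 : (0 : ℂ) ≤ 1 / 2 := by
    rw [Complex.nonneg_iff]
    norm_num
  have h4 := (h1.add h2).smul h3
  refine Eq.mp (congrArg Matrix.PosSemidef ?_) h4
  ext f g
  simp only [Matrix.of_apply, Matrix.smul_apply, Matrix.add_apply, Matrix.transpose_apply, symp,
    smul_eq_mul]
  rw [← inner_conj_symm (T g) (T f), ← inner_conj_symm g f]
  apply Complex.ext <;>
  · simp only [Complex.add_re, Complex.add_im, Complex.mul_re, Complex.mul_im, Complex.sub_re,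
      Complex.sub_im, Complex.ofReal_re, Complex.ofReal_im, Complex.I_re, Complex.I_im,
      Complex.conj_re, Complex.conj_im, Complex.div_ofNat_re, Complex.div_ofNat_im, Complex.one_re,
      Complex.one_im]
    ring

/-- The function `exp (-‖T f‖² / 4 + i Re (L f))`. -/
def quasiFree (T : V →ₗ[ℂ] E) (L : V →ₗ[ℂ] ℂ) (f : V) : ℂ :=
  Complex.exp (-((‖T f‖ ^ 2 : ℝ) : ℂ) / 4 + Complex.I * ((L f).re : ℂ))

/-- Expanding `‖T g - T f‖²` factors the Weyl kernel into the rank-one kernel `conj (χ f) χ g` and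
the exponential of half of `Re ⟨T f, T g⟩ + i σ(f, g)`. The linear term `L` goes entirely into the
first factor. -/
theorem posSemidef_weylKernel_quasiFree {T : V →ₗ[ℂ] E} (L : V →ₗ[ℂ] ℂ)
    (hT : ∀ f, ‖f‖ ≤ ‖T f‖) : (weylKernel (quasiFree T L)).PosSemidef := by
  have h0 : (0 : ℂ) ≤ 1 / 2 := by
    rw [Complex.nonneg_iff]
    norm_num
  have h1 := posSemidef_exp ((posSemidef_re_inner_add_symp hT).smul h0)
  have h2 : (Matrix.of fun f g : V => star (quasiFree T L f) * quasiFree T L g).PosSemidef := by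
    refine ⟨by ext; simp [mul_comm], fun x => ?_⟩
    have h : (x.sum fun i xi => x.sum fun j xj => star xi *
        (Matrix.of fun f g : V => star (quasiFree T L f) * quasiFree T L g) i j * xj)
        = star (x.sum fun i xi => quasiFree T L i * xi) * x.sum fun i xi => quasiFree T L i * xi := by
      simp only [Finsupp.sum, star_sum, Finset.sum_mul_sum, star_mul', Matrix.of_apply]
      refine Finset.sum_congr rfl fun i _ => Finset.sum_congr rfl fun j _ => ?_
      ring
    rw [h]
    exact star_mul_self_nonneg _
  refine Eq.mp (congrArg Matrix.PosSemidef ?_) (h2.hadamard h1)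
  ext f g
  symm
  have hn : ‖T g - T f‖ ^ 2 = ‖T g‖ ^ 2 + ‖T f‖ ^ 2 - 2 * (inner ℂ (T f) (T g)).re := by
    rw [norm_sub_rev, @norm_sub_sq ℂ]
    simp only [RCLike.re_eq_complex_re]
    ring
  simp only [weylKernel, Matrix.of_apply, Matrix.hadamard_apply, quasiFree, Matrix.smul_apply,
    smul_eq_mul, RCLike.star_def, ← Complex.exp_conj, ← Complex.exp_add, hn, map_sub,
    Complex.sub_re]
  congr 1
  simp only [map_add, map_mul, map_neg, map_div₀, Complex.conj_I, Complex.conj_ofReal, map_ofNat]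
  push_cast
  ring

theorem exists_state_quasiFree {T : V →ₗ[ℂ] E} (L : V →ₗ[ℂ] ℂ) (hT : ∀ f, ‖f‖ ≤ ‖T f‖) :
    ∃ ψ : ResolventAlgebra V →L[ℂ] ℂ, IsStateWithCharacteristic ψ (quasiFree T L) := by
  obtain ⟨H, _, _, _, S, Ω, hΩ, hS⟩ := exists_weylSystem (posSemidef_weylKernel_quasiFree L hT)
    (by simp [quasiFree]) fun f g => by
      simp only [quasiFree, map_add, map_smul]
      fun_prop
  exact exists_state_of_weylSystem S hΩ hS

end QuasiFree

/-! ### Density of words in the resolvents -/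

section Words

variable {V : Type} [NormedAddCommGroup V] [InnerProductSpace ℂ V]

/-- The product of the resolvents in a list. -/
def word (L : List (ℝˣ × V)) : ResolventAlgebra V :=
  (L.map fun p => resolvent p.1 p.2).prod

theorem word_append (L M : List (ℝˣ × V)) : word (L ++ M) = word L * word M := by
  simp [word]

theorem ofFn_resolvent_prod {n : ℕ} (l : Fin n → ℝˣ) (f : Fin n → V) :
    (List.ofFn fun j => resolvent (l j) (f j)).prod = word (List.ofFn fun j => (l j, f j)) := by
  rw [word, List.map_ofFn]
  rfl

theorem word_eq_ofFn (L : List (ℝˣ × V)) :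
    word L = (List.ofFn fun j => resolvent (L.get j).1 (L.get j).2).prod := by
  rw [ofFn_resolvent_prod]
  exact congrArg word (List.ofFn_get L).symm

theorem star_repGen (l : ℝˣ) (f : V) : star (repGen l f) = repGen (-l) f :=
  RepFamilies.ext' fun π => π.star_eq l f

/-- Since `R(l, f)* = R(-l, f)`, the set of generators is closed under the adjoint, so the
`*`-algebra they generate is already spanned by products of generators. -/
theorem dense_span_word :
    Dense (Submodule.span ℂ (Set.range (word (V := V))) : Set (ResolventAlgebra V)) := by
  set G : Set (RepFamilies V) := {a | ∃ (l : ℝˣ) (f : V), a = repGen l f} with hG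
  set D := Submodule.span ℂ (Set.range (word (V := V))) with hD
  let v : ResolventAlgebra V →ₗ[ℂ] RepFamilies V := (resolventSubalgebra V).subtype.toLinearMap
  have hv : Topology.IsInducing (v : ResolventAlgebra V → RepFamilies V) :=
    Topology.IsInducing.subtypeVal
  have hstar : star G ⊆ G := by
    rintro a ⟨l, f, h⟩
    refine ⟨-l, f, ?_⟩
    rw [← star_repGen, ← h, star_star]
  have hwords : ∀ m ∈ Submonoid.closure (G ∪ star G), ∃ L : List (ℝˣ × V), v (word L) = m := by
    intro m hm
    induction hm using Submonoid.closure_induction with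
    | mem x hx =>
      obtain ⟨l, f, rfl⟩ := Set.union_subset le_rfl hstar hx
      exact ⟨[(l, f)], by rw [word, List.map_singleton, List.prod_singleton]; rfl⟩
    | one => exact ⟨[], rfl⟩
    | mul x y _ _ hx hy =>
      obtain ⟨L, rfl⟩ := hx
      obtain ⟨M, rfl⟩ := hy
      exact ⟨L ++ M, by rw [word_append]; rfl⟩
  have hsub : ((StarAlgebra.adjoin ℂ G : StarSubalgebra ℂ (RepFamilies V)) : Set (RepFamilies V)) ⊆
      v '' D := by
    intro x hx
    have h1 : x ∈ Submodule.span ℂ (Submonoid.closure (G ∪ star G) : Set (RepFamilies V)) := by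
      rw [← StarAlgebra.adjoin_eq_span]
      exact hx
    have h2 : Submodule.span ℂ (Submonoid.closure (G ∪ star G) : Set (RepFamilies V)) ≤ D.map v := by
      refine Submodule.span_le.2 fun m hm => ?_
      obtain ⟨L, rfl⟩ := hwords m hm
      exact ⟨_, Submodule.subset_span ⟨L, rfl⟩, rfl⟩
    exact h2 h1
  intro a
  rw [hv.closure_eq_preimage_closure_image]
  exact closure_mono hsub a.2

theorem resolventAlgebra_induction {p : ResolventAlgebra V → Prop} (hc : IsClosed {a | p a})
    (hz : p 0) (ha : ∀ a b, p a → p b → p (a + b)) (hs : ∀ (c : ℂ) a, p a → p (c • a))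
    (hw : ∀ (n : ℕ) (l : Fin n → ℝˣ) (f : Fin n → V),
      p (List.ofFn fun j => resolvent (l j) (f j)).prod) (a : ResolventAlgebra V) : p a := by
  refine hc.closure_subset_iff.2 (fun x hx => ?_) (dense_span_word a)
  induction hx using Submodule.span_induction with
  | mem x hx =>
    obtain ⟨L, rfl⟩ := hx
    rw [word_eq_ofFn]
    exact hw _ _ _
  | zero => exact hz
  | add x y _ _ hx hy => exact ha x y hx hy
  | smul c x _ hx => exact hs c x hx

theorem IsStateWithCharacteristic.unique {ψ ψ' : ResolventAlgebra V →L[ℂ] ℂ} {χ : V → ℂ}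
    (h : IsStateWithCharacteristic ψ χ) (h' : IsStateWithCharacteristic ψ' χ) : ψ' = ψ := by
  refine ContinuousLinearMap.ext fun a => ?_
  refine resolventAlgebra_induction (p := fun a => ψ' a = ψ a)
    (isClosed_eq ψ'.continuous ψ.continuous) (by simp) (fun a b ha hb => by simp [ha, hb])
    (fun c a ha => by simp [ha]) (fun n l f => ?_) a
  rw [h.npoint, h'.npoint]

theorem norm_bogoliubov_le (U : V →ₗᵢ[ℂ] V) (a : ResolventAlgebra V) : ‖bogoliubov U a‖ ≤ ‖a‖ :=
  norm_repMap_le U a.1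

theorem bogoliubov_word (U : V →ₗᵢ[ℂ] V) {n : ℕ} (l : Fin n → ℝˣ) (f : Fin n → V) :
    bogoliubov U (List.ofFn fun j => resolvent (l j) (f j)).prod =
      (List.ofFn fun j => resolvent (l j) (U (f j))).prod := by
  rw [map_list_prod, List.map_ofFn]
  simp only [Function.comp_def, bogoliubov_resolvent]

/-- An `ε/2` argument: the Lipschitz bound is uniform in `i`. It serves both the density argument
for words and the approximation in `L¹`. -/
theorem isClosed_setOf_tendsto_zero {ι E : Type*} [NormedAddCommGroup E] {F : Filter ι} {C : ℝ}
    {φ : ι → E → ℂ} (hφ : ∀ i a b, ‖φ i a - φ i b‖ ≤ C * ‖a - b‖) :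
    IsClosed {a | Tendsto (fun i => φ i a) F (𝓝 0)} := by
  refine isClosed_of_closure_subset fun a ha => ?_
  rw [Set.mem_ofPred_eq, Metric.tendsto_nhds]
  intro ε hε
  obtain ⟨b, hb, hab⟩ := Metric.mem_closure_iff.1 ha (ε / (2 * (|C| + 1))) (by positivity)
  filter_upwards [Metric.tendsto_nhds.1 hb (ε / 2) (by positivity)] with i hi
  rw [dist_zero_right] at hi ⊢
  rw [dist_eq_norm, lt_div_iff₀ (by positivity)] at hab
  have h1 := hφ i a b
  have h2 : ‖φ i a‖ ≤ ‖φ i a - φ i b‖ + ‖φ i b‖ := by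
    simpa using norm_add_le (φ i a - φ i b) (φ i b)
  have h3 : C * ‖a - b‖ ≤ (|C| + 1) * ‖a - b‖ :=
    mul_le_mul_of_nonneg_right ((le_abs_self C).trans (by linarith)) (norm_nonneg _)
  linarith

/-- Clustering has to be checked on words only. -/
theorem clusters_of_words {ι : Type} {F : Filter ι} {ψ : ResolventAlgebra V →L[ℂ] ℂ}
    {U : ι → V →ₗᵢ[ℂ] V}
    (h : ∀ (n m : ℕ) (l : Fin n → ℝˣ) (f : Fin n → V) (l' : Fin m → ℝˣ) (g : Fin m → V),
      Tendsto (fun i => ψ ((List.ofFn fun j => resolvent (l j) (f j)).prod *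
        (List.ofFn fun j => resolvent (l' j) (U i (g j))).prod)) F
        (𝓝 (ψ (List.ofFn fun j => resolvent (l j) (f j)).prod *
          ψ (List.ofFn fun j => resolvent (l' j) (g j)).prod))) :
    Clusters ψ Set.univ (fun i => bogoliubov (U i)) F := by
  have hiff : ∀ A B : ResolventAlgebra V,
      Tendsto (fun i => ψ (A * bogoliubov (U i) B)) F (𝓝 (ψ A * ψ B)) ↔
        Tendsto (fun i => ψ (A * bogoliubov (U i) B) - ψ A * ψ B) F (𝓝 0) := fun A B => by
    rw [← sub_self (ψ A * ψ B)]
    exact ⟨fun h => h.sub_const _, fun h => by simpa using h.add_const (ψ A * ψ B)⟩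
  -- A bound uniform in `i` makes the clustering relation a closed condition on `A` and on `B`. The
  -- reduction to words is then done first in `A` for all `B`, and next in `B` with `A` a word.
  have hb : ∀ A B i, ‖ψ (A * bogoliubov (U i) B) - ψ A * ψ B‖ ≤
      (‖ψ‖ + ‖ψ‖ * ‖ψ‖) * ‖A‖ * ‖B‖ := fun A B i => by
    have h1 : ‖ψ (A * bogoliubov (U i) B)‖ ≤ ‖ψ‖ * (‖A‖ * ‖B‖) :=
      (ψ.le_opNorm _).trans (mul_le_mul_of_nonneg_left ((norm_mul_le _ _).trans
        (mul_le_mul_of_nonneg_left (norm_bogoliubov_le _ _) (norm_nonneg _))) (norm_nonneg _))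
    have h2 : ‖ψ A * ψ B‖ ≤ (‖ψ‖ * ‖A‖) * (‖ψ‖ * ‖B‖) := by
      rw [norm_mul]
      exact mul_le_mul (ψ.le_opNorm _) (ψ.le_opNorm _) (norm_nonneg _) (by positivity)
    refine (norm_sub_le _ _).trans ((add_le_add h1 h2).trans_eq ?_)
    ring
  intro A _ B _
  revert B
  refine resolventAlgebra_induction (p := fun A => ∀ B, B ∈ Set.univ →
    Tendsto (fun i => ψ (A * bogoliubov (U i) B)) F (𝓝 (ψ A * ψ B))) ?_ ?_ ?_ ?_ ?_ A
  · simp only [Set.mem_univ, forall_const, hiff, Set.ofPred_forall]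
    refine isClosed_iInter fun B => isClosed_setOf_tendsto_zero
      (C := (‖ψ‖ + ‖ψ‖ * ‖ψ‖) * ‖B‖) fun i a b => ?_
    refine le_trans (le_of_eq (congrArg norm ?_)) ((hb (a - b) B i).trans_eq (by ring))
    simp only [sub_mul, map_sub]
    ring
  · intro B _
    simpa using tendsto_const_nhds
  · intro a b ha hb B hB
    simpa only [add_mul, map_add] using (ha B hB).add (hb B hB)
  · intro c a ha B hB
    simpa only [smul_mul_assoc, map_smul, smul_eq_mul, mul_assoc] using (ha B hB).const_mul c
  · intro n l f B _
    refine resolventAlgebra_induction (p := fun B => Tendsto (fun i => ψ (_ * bogoliubov (U i) B)) F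
      (𝓝 (ψ _ * ψ B))) ?_ ?_ ?_ ?_ ?_ B
    · simp only [hiff]
      refine isClosed_setOf_tendsto_zero (C := (‖ψ‖ + ‖ψ‖ * ‖ψ‖) *
        ‖(List.ofFn fun j => resolvent (l j) (f j)).prod‖) fun i a b => ?_
      refine le_trans (le_of_eq (congrArg norm ?_)) (hb _ (a - b) i)
      simp only [mul_sub, map_sub]
      ring
    · simpa using tendsto_const_nhds
    · intro a b ha hb
      simpa only [mul_add, map_add] using ha.add hb
    · intro c a ha
      simpa only [mul_smul_comm, map_smul, smul_eq_mul, mul_left_comm] using ha.const_mul c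
    · intro m l' g
      simp only [bogoliubov_word]
      exact h n m l f l' g

end Words

/-! ### Limits of correlation functions -/

section Limits

instance (n : ℕ) : SigmaFinite (orthantMeasure n) := by
  unfold orthantMeasure
  infer_instance

theorem measurePreserving_append (n m : ℕ) :
    MeasurePreserving (fun p : (Fin n → ℝ) × (Fin m → ℝ) => Fin.append p.1 p.2)
      ((orthantMeasure n).prod (orthantMeasure m)) (orthantMeasure (n + m)) := by
  have h1 := measurePreserving_sumPiEquivProdPi_symm (X := fun _ : Fin n ⊕ Fin m => ℝ)
    fun _ => volume.restrict (Set.Ioi (0 : ℝ))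
  have h2 := measurePreserving_piCongrLeft (α := fun _ : Fin (n + m) => ℝ)
    (fun _ => volume.restrict (Set.Ioi (0 : ℝ))) finSumFinEquiv
  have h3 := h2.comp h1
  refine Eq.mp (congrArg (fun φ => MeasurePreserving φ _ _) ?_) h3
  funext p j
  symm
  refine Fin.addCases (fun i => ?_) (fun i => ?_) j
  · have h := MeasurableEquiv.piCongrLeft_apply_apply (β := fun _ : Fin (n + m) => ℝ) finSumFinEquiv
      ((MeasurableEquiv.sumPiEquivProdPi fun _ : Fin n ⊕ Fin m => ℝ).symm p) (Sum.inl i)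
    rw [Fin.append_left]
    exact h.symm
  · have h := MeasurableEquiv.piCongrLeft_apply_apply (β := fun _ : Fin (n + m) => ℝ) finSumFinEquiv
      ((MeasurableEquiv.sumPiEquivProdPi fun _ : Fin n ⊕ Fin m => ℝ).symm p) (Sum.inr i)
    rw [Fin.append_right]
    exact h.symm

theorem integral_append_mul {n m : ℕ} (F : (Fin n → ℝ) → ℂ) (G : (Fin m → ℝ) → ℂ)
    {K : (Fin (n + m) → ℝ) → ℂ} (hK : AEStronglyMeasurable K (orthantMeasure (n + m)))
    (h : ∀ x y, K (Fin.append x y) = F x * G y) :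
    ∫ t, K t ∂orthantMeasure (n + m) =
      (∫ x, F x ∂orthantMeasure n) * ∫ y, G y ∂orthantMeasure m := by
  have hp := measurePreserving_append n m
  rw [← hp.map_eq] at hK
  rw [← hp.map_eq, integral_map hp.measurable.aemeasurable hK, ← integral_prod_mul]
  simp only [h]

/-- Every index of the first block precedes every index of the second, so all cross pairs
contribute, each exactly once. -/
theorem sum_lt_append {V : Type*} {n m : ℕ} (s : V → V → ℂ) (a : Fin n → V) (b : Fin m → V) :
    (∑ j, ∑ k, if j < k then s (Fin.append a b j) (Fin.append a b k) else 0) =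
      (∑ j, ∑ k, if j < k then s (a j) (a k) else 0) +
        (∑ j, ∑ k, if j < k then s (b j) (b k) else 0) + ∑ j, ∑ k, s (a j) (b k) := by
  simp only [Fin.sum_univ_add, Fin.append_left, Fin.append_right, Finset.sum_add_distrib]
  have h1 : ∀ (i : Fin n) (k : Fin m), Fin.castAdd m i < Fin.natAdd n k := fun i k => by
    rw [Fin.lt_def, Fin.val_castAdd, Fin.val_natAdd]
    omega
  simp only [h1, (h1 _ _).not_gt, if_true, if_false, Finset.sum_const_zero, Fin.lt_def,
    Fin.val_castAdd, Fin.val_natAdd, add_lt_add_iff_left]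
  ring

variable {V : Type} [NormedAddCommGroup V] [InnerProductSpace ℂ V]
  {E : Type*} [NormedAddCommGroup E] [InnerProductSpace ℂ E] {T : V →ₗ[ℂ] E} {L : V →ₗ[ℂ] ℂ}

/-- The arguments of the Weyl operators in the Laplace representation of a word. -/
def laplaceArg {n : ℕ} (l : Fin n → ℝˣ) (f : Fin n → V) (t : Fin n → ℝ) (j : Fin n) : V :=
  ((-(Real.sign (l j) * t j) : ℝ) : ℂ) • f j

theorem resolventCorrelation_eq (χ : V → ℂ) {n : ℕ} (l : Fin n → ℝˣ) (f : Fin n → V) :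
    resolventCorrelation χ l f = ∫ t, (∏ j, laplaceCoeff (l j) (t j)) *
      weylCorrelation χ (laplaceArg l f t) ∂orthantMeasure n := by
  rw [orthantMeasure_eq]
  rfl

theorem norm_quasiFree_le (f : V) : ‖quasiFree T L f‖ ≤ 1 := by
  rw [quasiFree, Complex.norm_exp, Real.exp_le_one_iff]
  have : (-((‖T f‖ ^ 2 : ℝ) : ℂ) / 4 + Complex.I * ((L f).re : ℂ)).re = -‖T f‖ ^ 2 / 4 := by
    rw [Complex.add_re, Complex.I_mul_re, Complex.ofReal_im, ← Complex.ofReal_neg,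
      Complex.div_ofNat_re, Complex.ofReal_re]
    ring
  rw [this]
  have := sq_nonneg ‖T f‖
  linarith

theorem norm_weylCorrelation_le {n : ℕ} (g : Fin n → V) :
    ‖weylCorrelation (quasiFree T L) g‖ ≤ 1 := by
  have h : -(Complex.I / 2) * ∑ j, ∑ k, (if j < k then (symp (g j) (g k) : ℂ) else 0) =
      ((-(1 / 2) * ∑ j, ∑ k, if j < k then symp (g j) (g k) else 0 : ℝ) : ℂ) * Complex.I := by
    simp only [Complex.ofReal_mul, Complex.ofReal_sum, apply_ite Complex.ofReal,
      Complex.ofReal_zero]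
    push_cast
    ring
  rw [weylCorrelation, norm_mul, h, Complex.norm_exp_ofReal_mul_I, one_mul]
  exact norm_quasiFree_le _

theorem continuous_weylCorrelation {n : ℕ} (l : Fin n → ℝˣ) (f : Fin n → V) :
    Continuous fun t => weylCorrelation (quasiFree T L) (laplaceArg l f t) := by
  simp only [weylCorrelation, quasiFree, laplaceArg, map_sum, map_smul, symp_smul_left,
    symp_smul_right]
  refine Continuous.mul (Complex.continuous_exp.comp (continuous_const.mul
    (continuous_finsetSum _ fun j _ => continuous_finsetSum _ fun k _ => ?_))) (by fun_prop)
  split_ifs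
  · fun_prop
  · fun_prop

/-- Weyl correlations of a quasi-free function are bounded by one, so the product of the exponential
coefficients dominates the integrand. Dominated convergence is where the filter has to be countably
generated. -/
theorem tendsto_resolventCorrelation {ι : Type*} {F : Filter ι} [F.IsCountablyGenerated] {n : ℕ}
    (l : Fin n → ℝˣ) (f : ι → Fin n → V) {Φ : (Fin n → ℝ) → ℂ}
    (h : ∀ t, Tendsto (fun i => weylCorrelation (quasiFree T L) (laplaceArg l (f i) t)) F
      (𝓝 (Φ t))) :
    Tendsto (fun i => resolventCorrelation (quasiFree T L) l (f i)) F
      (𝓝 (∫ t, (∏ j, laplaceCoeff (l j) (t j)) * Φ t ∂orthantMeasure n)) := by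
  simp only [resolventCorrelation_eq]
  refine tendsto_integral_filter_of_dominated_convergence
    (fun t => ‖∏ j, laplaceCoeff (l j) (t j)‖) (Eventually.of_forall fun i => ?_)
    (Eventually.of_forall fun i => Eventually.of_forall fun t => ?_)
    (integrable_prod_laplaceCoeff l).norm (Eventually.of_forall fun t => (h t).const_mul _)
  · exact (integrable_prod_laplaceCoeff l).aestronglyMeasurable.mul
      (continuous_weylCorrelation l (f i)).aestronglyMeasurable
  · rw [norm_mul]
    exact mul_le_of_le_one_right (norm_nonneg _) (norm_weylCorrelation_le _)

theorem quasiFree_add (a b : V) : quasiFree T L (a + b) =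
    quasiFree T L a * quasiFree T L b * Complex.exp (-((inner ℂ (T a) (T b)).re : ℂ) / 2) := by
  have h : ‖T a + T b‖ ^ 2 = ‖T a‖ ^ 2 + 2 * (inner ℂ (T a) (T b)).re + ‖T b‖ ^ 2 :=
    @norm_add_sq ℂ _ _ _ _ (T a) (T b)
  rw [quasiFree, quasiFree, quasiFree, ← Complex.exp_add, ← Complex.exp_add, map_add, map_add, h,
    Complex.add_re]
  congr 1
  push_cast
  ring

theorem quasiFree_congr {a b : V} (hT : ‖T a‖ = ‖T b‖) (hL : L a = L b) :
    quasiFree T L a = quasiFree T L b := by rw [quasiFree, quasiFree, hT, hL]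

theorem weylCorrelation_append (χ : V → ℂ) {n m : ℕ} (a : Fin n → V) (b : Fin m → V)
    (U : V →ₗᵢ[ℂ] V) : weylCorrelation χ (Fin.append a fun j => U (b j)) =
      Complex.exp (-(Complex.I / 2) * ∑ j, ∑ k, if j < k then (symp (a j) (a k) : ℂ) else 0) *
      Complex.exp (-(Complex.I / 2) * ∑ j, ∑ k, if j < k then (symp (b j) (b k) : ℂ) else 0) *
      Complex.exp (-(Complex.I / 2) * ∑ j, ∑ k, (symp (a j) (U (b k)) : ℂ)) *
      χ ((∑ j, a j) + U (∑ j, b j)) := by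
  rw [weylCorrelation, sum_lt_append (fun f g => (symp f g : ℂ)), ← Complex.exp_add,
    ← Complex.exp_add, Fin.sum_univ_add]
  simp only [Fin.append_left, Fin.append_right, map_sum]
  congr 2
  · simp only [symp, U.inner_map_map]
    ring

/-- Only two factors depend on `i`: the symplectic phase between the blocks, which tends to one, and
the Gaussian cross term. The field `L` is additive and invariant, so it couples nothing. -/
theorem tendsto_weylCorrelation_append {ι : Type*} {F : Filter ι} {U : ι → V →ₗᵢ[ℂ] V}
    (hT : ∀ i f, ‖T (U i f)‖ = ‖T f‖) (hL : ∀ i f, L (U i f) = L f)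
    (hσ : ∀ f g, Tendsto (fun i => symp f (U i g)) F (𝓝 0)) {n m : ℕ} (a : Fin n → V)
    (b : Fin m → V) {q : ℝ}
    (hq : Tendsto (fun i => (inner ℂ (T (∑ j, a j)) (T (U i (∑ j, b j)))).re) F (𝓝 q)) :
    Tendsto (fun i => weylCorrelation (quasiFree T L) (Fin.append a fun j => U i (b j))) F
      (𝓝 (weylCorrelation (quasiFree T L) a * weylCorrelation (quasiFree T L) b *
        Complex.exp (-(q : ℂ) / 2))) := by
  have h1 : Tendsto (fun i => Complex.exp (-(Complex.I / 2) *
      ∑ j, ∑ k, (symp (a j) (U i (b k)) : ℂ))) F (𝓝 1) := by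
    have : Tendsto (fun i => ∑ j, ∑ k, (symp (a j) (U i (b k)) : ℂ)) F
        (𝓝 (∑ j : Fin n, ∑ k : Fin m, ((0 : ℝ) : ℂ))) :=
      tendsto_finsetSum _ fun j _ => tendsto_finsetSum _ fun k _ =>
        (Complex.continuous_ofReal.tendsto 0).comp (hσ (a j) (b k))
    have h2 := (this.const_mul (-(Complex.I / 2))).cexp
    simpa using h2
  have h3 : Tendsto (fun i => Complex.exp
      (-((inner ℂ (T (∑ j, a j)) (T (U i (∑ j, b j)))).re : ℂ) / 2)) F
      (𝓝 (Complex.exp (-(q : ℂ) / 2))) :=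
    (((Complex.continuous_ofReal.tendsto q).comp hq).neg.div_const 2).cexp
  simp only [weylCorrelation_append, quasiFree_add,
    fun i => quasiFree_congr (hT i (∑ j, b j)) (hL i (∑ j, b j))]
  have h4 := ((h1.const_mul (Complex.exp (-(Complex.I / 2) * ∑ j, ∑ k,
      if j < k then (symp (a j) (a k) : ℂ) else 0) * Complex.exp (-(Complex.I / 2) *
      ∑ j, ∑ k, if j < k then (symp (b j) (b k) : ℂ) else 0))).mul
    (h3.const_mul (quasiFree T L (∑ j, a j) * quasiFree T L (∑ j, b j))))
  refine h4.trans (le_of_eq (congrArg 𝓝 ?_))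
  simp only [weylCorrelation]
  ring

theorem laplaceArg_append {n m : ℕ} (l : Fin n → ℝˣ) (l' : Fin m → ℝˣ) (f : Fin n → V)
    (g : Fin m → V) (U : V →ₗᵢ[ℂ] V) (t : Fin (n + m) → ℝ) :
    laplaceArg (Fin.append l l') (Fin.append f fun j => U (g j)) t =
      Fin.append (laplaceArg l f fun j => t (Fin.castAdd m j))
        fun j => U (laplaceArg l' g (fun j => t (Fin.natAdd n j)) j) := by
  funext j
  refine Fin.addCases (fun i => ?_) (fun i => ?_) j
  · simp [laplaceArg]
  · simp [laplaceArg]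

theorem ofFn_append_prod {n m : ℕ} (l : Fin n → ℝˣ) (l' : Fin m → ℝˣ) (f : Fin n → V)
    (g : Fin m → V) : (List.ofFn fun j => resolvent (l j) (f j)).prod *
      (List.ofFn fun j => resolvent (l' j) (g j)).prod =
      (List.ofFn fun j => resolvent (Fin.append l l' j) (Fin.append f g j)).prod := by
  rw [← List.prod_append, ← List.ofFn_fin_append]
  congr 2
  funext j
  refine Fin.addCases (fun i => ?_) (fun i => ?_) j
  · simp
  · simp

/-- The `(n + m)`-point functions of a quasi-free state at infinite separation. -/
theorem tendsto_word_mul_word {ι : Type*} {F : Filter ι} [F.IsCountablyGenerated]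
    {U : ι → V →ₗᵢ[ℂ] V} {ψ : ResolventAlgebra V →L[ℂ] ℂ}
    (hψ : IsStateWithCharacteristic ψ (quasiFree T L))
    (hT : ∀ i f, ‖T (U i f)‖ = ‖T f‖) (hL : ∀ i f, L (U i f) = L f)
    (hσ : ∀ f g, Tendsto (fun i => symp f (U i g)) F (𝓝 0)) {q : V → V → ℝ}
    (hq : ∀ f g, Tendsto (fun i => (inner ℂ (T f) (T (U i g))).re) F (𝓝 (q f g)))
    {n m : ℕ} (l : Fin n → ℝˣ) (f : Fin n → V) (l' : Fin m → ℝˣ) (g : Fin m → V) :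
    Tendsto (fun i => ψ ((List.ofFn fun j => resolvent (l j) (f j)).prod *
        (List.ofFn fun j => resolvent (l' j) (U i (g j))).prod)) F
      (𝓝 (∫ t, (∏ j, laplaceCoeff (Fin.append l l' j) (t j)) *
        (weylCorrelation (quasiFree T L) (laplaceArg l f fun j => t (Fin.castAdd m j)) *
          weylCorrelation (quasiFree T L) (laplaceArg l' g fun j => t (Fin.natAdd n j)) *
          Complex.exp (-(q (∑ j, laplaceArg l f (fun j => t (Fin.castAdd m j)) j)
            (∑ j, laplaceArg l' g (fun j => t (Fin.natAdd n j)) j) : ℂ) / 2))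
        ∂orthantMeasure (n + m))) := by
  simp only [ofFn_append_prod, hψ.npoint]
  refine tendsto_resolventCorrelation _ _ fun t => ?_
  simp only [laplaceArg_append]
  exact tendsto_weylCorrelation_append hT hL hσ _ _ (hq _ _)

/-- Without a cross term in the limit the integrand is a product of functions of separate variables,
and Fubini factorises the integral. -/
theorem clusters_quasiFree {ι : Type} {F : Filter ι} [F.IsCountablyGenerated]
    {U : ι → V →ₗᵢ[ℂ] V} {ψ : ResolventAlgebra V →L[ℂ] ℂ}
    (hψ : IsStateWithCharacteristic ψ (quasiFree T L))
    (hT : ∀ i f, ‖T (U i f)‖ = ‖T f‖) (hL : ∀ i f, L (U i f) = L f)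
    (hσ : ∀ f g, Tendsto (fun i => symp f (U i g)) F (𝓝 0))
    (hq : ∀ f g, Tendsto (fun i => (inner ℂ (T f) (T (U i g))).re) F (𝓝 0)) :
    Clusters ψ Set.univ (fun i => bogoliubov (U i)) F := by
  refine clusters_of_words fun n m l f l' g => ?_
  refine (tendsto_word_mul_word hψ hT hL hσ hq l f l' g).trans (le_of_eq (congrArg 𝓝 ?_))
  rw [hψ.npoint, hψ.npoint, resolventCorrelation_eq, resolventCorrelation_eq]
  refine integral_append_mul _ _ ?_ fun x y => ?_
  · refine (integrable_prod_laplaceCoeff _).aestronglyMeasurable.mul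
      (Continuous.aestronglyMeasurable ?_)
    simp only [Complex.ofReal_zero, neg_zero, zero_div, Complex.exp_zero, mul_one]
    exact ((continuous_weylCorrelation l f).comp (by fun_prop)).mul
      ((continuous_weylCorrelation l' g).comp (by fun_prop))
  · simp only [Fin.prod_univ_add, Fin.append_left, Fin.append_right, Complex.ofReal_zero, neg_zero,
      zero_div, Complex.exp_zero, mul_one]
    ring

end Limits

/-! ### Riemann–Lebesgue lemmas -/

section RiemannLebesgue

variable {d : ℕ}

instance isCountablyGenerated_cocompact {E : Type*} [SeminormedAddGroup E] [ProperSpace E] :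
    (cocompact E).IsCountablyGenerated := by
  rw [← Metric.cobounded_eq_cocompact, ← comap_norm_atTop]
  infer_instance

/-- Phases of modulus one make these functionals uniformly Lipschitz on `L¹`, so indicators of sets
of finite measure suffice. -/
theorem tendsto_integral_phase_mul {ι : Type*} {F : Filter ι} {m : ι → Space d → ℂ}
    (hm : ∀ i, Measurable (m i)) (h1 : ∀ i ξ, ‖m i ξ‖ = 1)
    (hS : ∀ S : Set (Space d), MeasurableSet S → volume S < ⊤ →
      Tendsto (fun i => ∫ ξ in S, m i ξ) F (𝓝 0)) {Φ : Space d → ℂ} (hΦ : Integrable Φ) :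
    Tendsto (fun i => ∫ ξ, m i ξ * Φ ξ) F (𝓝 0) := by
  have hint : ∀ i {f : Space d → ℂ}, Integrable f → Integrable fun ξ => m i ξ * f ξ :=
    fun i f hf => hf.bdd_mul (hm i).aestronglyMeasurable (Eventually.of_forall fun ξ => (h1 i ξ).le)
  refine Integrable.induction (P := fun f => Tendsto (fun i => ∫ ξ, m i ξ * f ξ) F (𝓝 0))
    ?_ ?_ ?_ ?_ hΦ
  · intro c S hSm hSf
    have h := (hS S hSm hSf).mul_const c
    rw [zero_mul] at h
    refine h.congr fun i => ?_
    rw [← integral_mul_const, ← integral_indicator hSm]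
    refine integral_congr_ae (Eventually.of_forall fun ξ => ?_)
    by_cases hξ : ξ ∈ S <;> simp [hξ]
  · intro f g _ hf hg hf' hg'
    have h := hf'.add hg'
    rw [add_zero] at h
    refine h.congr fun i => ?_
    rw [← integral_add (hint i hf) (hint i hg)]
    simp [mul_add]
  · refine isClosed_setOf_tendsto_zero (E := Lp ℂ 1 (volume : Measure (Space d)))
      (φ := fun i f => ∫ ξ, m i ξ * f ξ) (C := 1) fun i a b => ?_
    rw [← integral_sub (hint i (L1.integrable_coeFn a)) (hint i (L1.integrable_coeFn b)), one_mul,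
      L1.norm_eq_integral_norm]
    refine (norm_integral_le_integral_norm _).trans_eq (integral_congr_ae ?_)
    filter_upwards [Lp.coeFn_sub a b] with ξ hξ
    rw [hξ, ← mul_sub, norm_mul, h1, one_mul, Pi.sub_apply]
  · intro f g hfg _ hf
    refine hf.congr fun i => integral_congr_ae ?_
    filter_upwards [hfg] with ξ hξ
    rw [hξ]

theorem tendsto_integral_translationPhase (Φ : Space d → ℂ) :
    Tendsto (fun a : Space d => ∫ ξ, translationPhase a ξ * Φ ξ) (cocompact (Space d)) (𝓝 0) := by
  refine (tendsto_integral_exp_inner_smul_cocompact Φ).congr fun a => ?_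
  refine integral_congr_ae (Eventually.of_forall fun ξ => ?_)
  simp only [translationPhase, Circle.smul_def, Real.fourierChar_apply, smul_eq_mul]
  rw [real_inner_comm]
  congr 3
  push_cast
  ring

/-- Polar coordinates reduce the claim to `r ↦ (2πr)^s` on the positive half-line, whose inverse is
differentiable there and therefore maps null sets to null sets. -/
theorem volume_preimage_dispersionF (hd : d ≠ 0) {s : ℝ} (hs : 0 < s) {N : Set ℝ}
    (hN : volume N = 0) :
    volume ((dispersionF s : Space d → ℝ) ⁻¹' N) = 0 := by
  have : Nonempty (Fin d) := ⟨⟨0, Nat.pos_of_ne_zero hd⟩⟩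
  set p : ℝ → ℝ := fun r => (2 * Real.pi * r) ^ s with hp
  have hpm : Measurable p := (measurable_const_mul (2 * Real.pi)).pow_const s
  have hM : volume (p ⁻¹' N ∩ Set.Ioi 0) = 0 := by
    have h1 : volume ((fun t : ℝ => t ^ s⁻¹ / (2 * Real.pi)) '' (N ∩ Set.Ioi 0)) = 0 := by
      refine addHaar_image_eq_zero_of_differentiableOn_of_addHaar_eq_zero volume ?_
        (measure_mono_null Set.inter_subset_left hN)
      intro t ht
      have ht' : t ≠ 0 := (Set.mem_Ioi.1 ht.2).ne'
      exact ((Real.differentiableAt_rpow_const_of_ne _ ht').div_const _).differentiableWithinAt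
    refine measure_mono_null (fun r hr => ?_) h1
    have hr0 : 0 < 2 * Real.pi * r := mul_pos Real.two_pi_pos hr.2
    refine ⟨p r, ⟨hr.1, Real.rpow_pos_of_pos hr0 s⟩, ?_⟩
    simp only [hp]
    rw [← Real.rpow_mul hr0.le, mul_inv_cancel₀ hs.ne', Real.rpow_one,
      mul_div_cancel_left₀ _ Real.two_pi_pos.ne']
  set f : ℝ → ℝ := (p ⁻¹' N).indicator 1 with hf
  have hz : (fun y : ℝ => y ^ (Module.finrank ℝ (Space d) - 1) • f y) =ᵐ[volume.restrict (Set.Ioi 0)]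
      0 := by
    rw [EventuallyEq, ae_restrict_iff' measurableSet_Ioi]
    have : ∀ᵐ y : ℝ, y ∉ p ⁻¹' N ∩ Set.Ioi 0 := measure_eq_zero_iff_ae_notMem.1 hM
    filter_upwards [this] with y hy hy0
    have : y ∉ p ⁻¹' N := fun h => hy ⟨h, hy0⟩
    simp [hf, this]
  have hi : Integrable (fun ξ : Space d => f ‖ξ‖) :=
    (integrable_fun_norm_addHaar volume).2 ((integrable_zero _ _ _).congr hz.symm)
  have h0 : ∫ ξ : Space d, f ‖ξ‖ = 0 := by
    rw [integral_fun_norm_addHaar volume f, integral_congr_ae hz]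
    simp
  have h2 := (integral_eq_zero_iff_of_nonneg
    (fun ξ => Set.indicator_nonneg (fun _ _ => zero_le_one) _) hi).1 h0
  rw [measure_eq_zero_iff_ae_notMem]
  filter_upwards [h2] with ξ hξ hξN
  have hmem : ‖ξ‖ ∈ p ⁻¹' N := by
    have : dispersionF s ξ = p ‖ξ‖ := by
      simp only [dispersionF, dispersion, hp, norm_smul, Real.norm_eq_abs,
        abs_of_pos Real.two_pi_pos]
    rw [Set.mem_preimage, ← this]
    exact hξN
  simp [hmem] at hξ

/-- The energy distribution of a set of finite measure, its image under the dispersion, is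
absolutely continuous. Its density turns the oscillating integral into a one-dimensional Fourier
transform, to which the classical Riemann–Lebesgue lemma applies. -/
theorem tendsto_integral_timePhase (hd : d ≠ 0) {s : ℝ} (hs : 0 < s) {Φ : Space d → ℂ}
    (hΦ : Integrable Φ) :
    Tendsto (fun u : ℝ => ∫ ξ, Complex.exp ((u * dispersionF s ξ : ℝ) * Complex.I) * Φ ξ)
      (cocompact ℝ) (𝓝 0) := by
  have hh := measurable_dispersionF (d := d) s
  refine tendsto_integral_phase_mul (fun u => by fun_prop)
    (fun u ξ => Complex.norm_exp_ofReal_mul_I _) (fun S hS hSf => ?_) hΦ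
  have : IsFiniteMeasure (volume.restrict S) := ⟨by simpa using hSf⟩
  set ν : Measure ℝ := (volume.restrict S).map (dispersionF s) with hν
  have hac : ν ≪ volume := by
    refine Measure.AbsolutelyContinuous.mk fun N hNm hN => ?_
    rw [hν, Measure.map_apply hh hNm]
    exact Measure.restrict_le_self.absolutelyContinuous (volume_preimage_dispersionF hd hs hN)
  have hRL := Real.tendsto_integral_exp_smul_cocompact
    (fun x : ℝ => ((ν.rnDeriv volume x).toReal : ℂ))
  -- The rescaling converts `exp (-2πi w x)` into `exp (i u x)`.
  have hc : Tendsto (fun u : ℝ => u * (-(2 * Real.pi)⁻¹)) (cocompact ℝ) (cocompact ℝ) :=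
    (Homeomorph.mulRight₀ (-(2 * Real.pi)⁻¹)
      (neg_ne_zero.2 (inv_ne_zero Real.two_pi_pos.ne'))).isClosedEmbedding.tendsto_cocompact
  refine (hRL.comp hc).congr fun u => ?_
  have h1 : ∫ ξ in S, Complex.exp ((u * dispersionF s ξ : ℝ) * Complex.I) =
      ∫ x, Complex.exp ((u * x : ℝ) * Complex.I) ∂ν := by
    rw [hν, integral_map hh.aemeasurable (Continuous.aestronglyMeasurable (by fun_prop))]
  rw [h1, ← integral_rnDeriv_smul hac]
  refine integral_congr_ae (Eventually.of_forall fun x => ?_)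
  simp only [Circle.smul_def, Real.fourierChar_apply, smul_eq_mul, Complex.real_smul]
  rw [mul_comm]
  congr 3
  have := Real.two_pi_pos.ne'
  push_cast
  field_simp

end RiemannLebesgue

/-! ### The one-particle structure of the free Bose gas -/

section FreeBoseGas

variable {d : ℕ} {s β : ℝ}

theorem dispersionF_pos {ξ : Space d} (hξ : ξ ≠ 0) : 0 < dispersionF s ξ :=
  Real.rpow_pos_of_pos (norm_pos_iff.2 (smul_ne_zero Real.two_pi_pos.ne' hξ)) s

/-- Both bounds come from `cosh x = sinh x + exp (-x)` and `x ≤ sinh x`. The lower one gives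
domination of the one-particle norm, the upper one controls `K` at small momentum. -/
theorem cosh_div_sinh_bounds {x : ℝ} (hx : 0 < x) :
    1 ≤ Real.cosh x / Real.sinh x ∧ Real.cosh x / Real.sinh x ≤ 1 + 1 / x := by
  have hs : 0 < Real.sinh x := Real.sinh_pos_iff.2 hx
  have h1 := Real.cosh_sub_sinh x
  refine ⟨?_, ?_⟩
  · rw [le_div_iff₀ hs]
    linarith [Real.exp_pos (-x)]
  · rw [div_le_iff₀ hs]
    have h2 : Real.exp (-x) ≤ 1 := Real.exp_le_one_iff.2 (by linarith)
    have h3 : x ≤ Real.sinh x := Real.self_le_sinh_iff.2 hx.le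
    have h4 : 1 ≤ 1 / x * Real.sinh x := by
      rw [one_div, inv_mul_eq_div, le_div_iff₀ hx]
      linarith
    linarith

theorem ae_ne_zero (hd : d ≠ 0) : ∀ᵐ ξ : Space d, ξ ≠ 0 := by
  have : Nonempty (Fin d) := ⟨⟨0, Nat.pos_of_ne_zero hd⟩⟩
  exact Measure.ae_ne volume 0

/-- The map `f ↦ K^{1/2} f` into `L²`. -/
def thermalMap (d : ℕ) (s β : ℝ) : testSpace d s β →ₗ[ℂ] OneParticle d where
  toFun f := MemLp.toLp (thermalRoot s β (f : OneParticle d)) f.2.1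
  map_add' f g := by
    ext1
    filter_upwards [MemLp.coeFn_toLp (f + g).2.1, thermalRoot_add s β f g, MemLp.coeFn_toLp f.2.1,
      MemLp.coeFn_toLp g.2.1, Lp.coeFn_add (MemLp.toLp (thermalRoot s β (f : OneParticle d)) f.2.1)
        (MemLp.toLp (thermalRoot s β (g : OneParticle d)) g.2.1)] with ξ h1 h2 h3 h4 h5
    rw [h1, h5, Pi.add_apply, h3, h4]
    exact h2
  map_smul' c f := by
    ext1
    filter_upwards [MemLp.coeFn_toLp (c • f).2.1, thermalRoot_smul s β c f, MemLp.coeFn_toLp f.2.1,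
      Lp.coeFn_smul c (MemLp.toLp (thermalRoot s β (f : OneParticle d)) f.2.1)] with ξ h1 h2 h3 h4
    rw [h1, RingHom.id_apply, h4, Pi.smul_apply, h3]
    exact h2

theorem coeFn_thermalMap (f : testSpace d s β) :
    (thermalMap d s β f : Space d → ℂ) =ᵐ[volume] thermalRoot s β (f : OneParticle d) :=
  MemLp.coeFn_toLp f.2.1

theorem norm_thermalMap_sq (f : testSpace d s β) : ‖thermalMap d s β f‖ ^ 2 = nonzeroForm f := by
  rw [← inner_self_eq_norm_sq (𝕜 := ℂ), L2.inner_def, nonzeroForm, ← integral_re]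
  · refine integral_congr_ae ?_
    filter_upwards [coeFn_thermalMap f] with ξ hξ
    rw [inner_self_eq_norm_sq, hξ]
  · exact L2.integrable_inner _ _

theorem norm_le_norm_thermalMap (hd : d ≠ 0) (hβ : 0 < β) (f : testSpace d s β) :
    ‖f‖ ≤ ‖thermalMap d s β f‖ := by
  have h1 : ‖(f : OneParticle d)‖ = ‖(𝓕 (f : OneParticle d) : OneParticle d)‖ :=
    ((Lp.fourierTransformₗᵢ (Space d) ℂ).norm_map _).symm
  rw [Submodule.coe_norm, h1]
  refine Lp.norm_le_norm_of_ae_le ?_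
  -- The origin is excluded: for `s > 0` the quotient defining `thermalWeight` there is `1 / 0 = 0`,
  -- and the lower bound fails.
  filter_upwards [coeFn_thermalMap f, ae_ne_zero hd] with ξ hξ h0
  have hw : 1 ≤ thermalWeight s β ξ :=
    (cosh_div_sinh_bounds (by have := dispersionF_pos (s := s) h0; positivity)).1
  rw [hξ, thermalRoot, norm_mul, Complex.norm_real, Real.norm_of_nonneg (Real.sqrt_nonneg _)]
  exact le_mul_of_one_le_left (norm_nonneg _) (Real.one_le_sqrt.2 hw)

/-- The map `f ↦ f̂(0)`. -/
def zeroModeMap (d : ℕ) (s β : ℝ) : testSpace d s β →ₗ[ℂ] ℂ where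
  toFun := zeroMode
  map_add' f g := (zeroMode_spec (f + g)).unique ((zeroMode_spec f).add (zeroMode_spec g))
  map_smul' c f := (zeroMode_spec (c • f)).unique ((zeroMode_spec f).smul c)

theorem zeroMode_of_phase {f g : testSpace d s β} {m : Space d → ℂ} (hm : Continuous m)
    (h0 : m 0 = 1) (h : ((𝓕 (g : OneParticle d) : OneParticle d) : Space d → ℂ) =ᵐ[volume]
      fun ξ => m ξ * (𝓕 (f : OneParticle d) : OneParticle d) ξ) : zeroMode g = zeroMode f := by
  obtain ⟨v, hv, hvc, hz⟩ := zeroMode_spec f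
  refine (zeroMode_spec g).unique ⟨m * v, ?_, hm.continuousAt.mul hvc, ?_⟩
  · filter_upwards [h, hv] with ξ h1 h2
    rw [h1, h2, Pi.mul_apply]
  · rw [Pi.mul_apply, h0, one_mul, hz]

/-- A family of one-particle unitaries which act by multiplication with continuous phases that are
one at the origin and satisfy a Riemann–Lebesgue lemma. -/
structure IsMixing {ι : Type} (U : ι → testSpace d s β →ₗᵢ[ℂ] testSpace d s β)
    (m : ι → Space d → ℂ) (F : Filter ι) : Prop where
  continuous_phase : ∀ i, Continuous (m i)
  norm_phase : ∀ i ξ, ‖m i ξ‖ = 1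
  phase_zero : ∀ i, m i 0 = 1
  fourier : ∀ i (f : testSpace d s β),
    ((𝓕 (U i f : OneParticle d) : OneParticle d) : Space d → ℂ) =ᵐ[volume]
      fun ξ => m i ξ * (𝓕 (f : OneParticle d) : OneParticle d) ξ
  tendsto : ∀ Φ : Space d → ℂ, Integrable Φ → Tendsto (fun i => ∫ ξ, m i ξ * Φ ξ) F (𝓝 0)

namespace IsMixing

variable {ι : Type} {U : ι → testSpace d s β →ₗᵢ[ℂ] testSpace d s β} {m : ι → Space d → ℂ}
  {F : Filter ι}

theorem zeroMode_eq (h : IsMixing U m F) (i : ι) (f : testSpace d s β) :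
    zeroMode (U i f) = zeroMode f :=
  zeroMode_of_phase (h.continuous_phase i) (h.phase_zero i) (h.fourier i f)

theorem thermalRoot_eq (h : IsMixing U m F) (i : ι) (f : testSpace d s β) :
    (thermalMap d s β (U i f) : Space d → ℂ) =ᵐ[volume]
      fun ξ => m i ξ * (thermalMap d s β f : Space d → ℂ) ξ := by
  filter_upwards [coeFn_thermalMap f, coeFn_thermalMap (U i f), h.fourier i f] with ξ h1 h2 h3
  rw [h1, h2, thermalRoot, thermalRoot, h3]
  ring

theorem norm_thermalMap (h : IsMixing U m F) (i : ι) (f : testSpace d s β) :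
    ‖thermalMap d s β (U i f)‖ = ‖thermalMap d s β f‖ := by
  rw [Lp.norm_def, Lp.norm_def]
  congr 1
  refine eLpNorm_congr_norm_ae ?_
  filter_upwards [h.thermalRoot_eq i f] with ξ hξ
  rw [hξ, norm_mul, h.norm_phase, one_mul]

/-- The pointwise inner product of two `L²` functions is integrable, and the phase factors out of
it. -/
theorem tendsto_inner (h : IsMixing U m F) {a b : OneParticle d} {c : ι → OneParticle d}
    (hc : ∀ i, (c i : Space d → ℂ) =ᵐ[volume] fun ξ => m i ξ * b ξ) :
    Tendsto (fun i => inner ℂ a (c i)) F (𝓝 0) := by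
  refine (h.tendsto _ (L2.integrable_inner a b)).congr fun i => ?_
  rw [L2.inner_def]
  refine integral_congr_ae ?_
  filter_upwards [hc i] with ξ hξ
  rw [hξ, RCLike.inner_apply, RCLike.inner_apply]
  ring

theorem tendsto_inner_thermalMap (h : IsMixing U m F) (f g : testSpace d s β) :
    Tendsto (fun i => inner ℂ (thermalMap d s β f) (thermalMap d s β (U i g))) F (𝓝 0) :=
  h.tendsto_inner fun i => h.thermalRoot_eq i g

theorem tendsto_symp (h : IsMixing U m F) (f g : testSpace d s β) :
    Tendsto (fun i => symp f (U i g)) F (𝓝 0) := by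
  have h1 := h.tendsto_inner (a := (𝓕 (f : OneParticle d) : OneParticle d)) fun i => h.fourier i g
  have h2 : ∀ i, inner ℂ (𝓕 (f : OneParticle d) : OneParticle d) (𝓕 (U i g : OneParticle d)) =
      inner ℂ f (U i g) := fun i =>
    (Lp.fourierTransformₗᵢ (Space d) ℂ).inner_map_map (f : OneParticle d) (U i g : OneParticle d)
  simp only [h2] at h1
  exact (Complex.continuous_im.tendsto 0).comp h1

end IsMixing

theorem isMixing_timeEvolution (hd : d ≠ 0) (hs : 0 < s) (β : ℝ) :
    IsMixing (testTimeEvolution d hs β)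
      (fun u ξ => Complex.exp ((u * dispersionF s ξ : ℝ) * Complex.I)) (cocompact ℝ) where
  continuous_phase u := by
    have := continuous_dispersionF (d := d) hs
    fun_prop
  norm_phase u ξ := Complex.norm_exp_ofReal_mul_I _
  phase_zero u := by simp [dispersionF, dispersion, Real.zero_rpow hs.ne']
  fourier u f := fourier_timeEvolution s u (f : OneParticle d)
  tendsto Φ hΦ := tendsto_integral_timePhase hd hs hΦ

theorem isMixing_translation (d : ℕ) (s β : ℝ) :
    IsMixing (testTranslation d s β) translationPhase (cocompact (Space d)) where
  continuous_phase := continuous_translationPhase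
  norm_phase := norm_translationPhase
  phase_zero a := by simp [translationPhase]
  fourier a f := fourier_translation a (f : OneParticle d)
  tendsto Φ _ := tendsto_integral_translationPhase Φ

/-- In polar coordinates the radial integrand is `r^(d - 1 - s)`, and `s < d` makes the exponent
larger than `-1`. -/
theorem integrableOn_norm_rpow_neg (hd : d ≠ 0) (hsd : s < d) :
    IntegrableOn (fun ξ : Space d => ‖ξ‖ ^ (-s)) (Metric.ball 0 1) := by
  have : Nonempty (Fin d) := ⟨⟨0, Nat.pos_of_ne_zero hd⟩⟩
  refine (integrableOn_fun_norm_addHaar volume (f := fun r : ℝ => r ^ (-s))).2 ?_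
  have h1 : IntegrableOn (fun r : ℝ => r ^ ((d : ℝ) - 1 - s)) (Set.Ioo 0 1) :=
    (intervalIntegral.integrableOn_Ioo_rpow_iff zero_lt_one).2 (by linarith)
  refine h1.congr_fun (fun r hr => ?_) measurableSet_Ioo
  simp only [finrank_euclideanSpace, Fintype.card_fin, smul_eq_mul]
  rw [← Real.rpow_natCast, ← Real.rpow_add hr.1, Nat.cast_sub (Nat.one_le_iff_ne_zero.2 hd)]
  congr 1
  push_cast
  ring

/-- `L¹ ∩ L²` is contained in the form domain of `K`. -/
theorem mem_integrableTestSpace (hd : d ≠ 0) (hs : 0 < s) (hsd : s < d) (hβ : 0 < β)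
    {f : OneParticle d} (hf : Integrable (f : Space d → ℂ)) : f ∈ integrableTestSpace d s β := by
  refine ⟨hf, ?_⟩
  set φ : Space d → ℂ := ((𝓕 f : OneParticle d) : Space d → ℂ) with hφ
  set M : ℝ := ∫ x, ‖(f : Space d → ℂ) x‖ with hM
  have hbd : ∀ᵐ ξ, ‖φ ξ‖ ≤ M := by
    filter_upwards [fourier_ae_eq f hf] with ξ hξ
    rw [hφ, hξ]
    exact VectorFourier.norm_fourierIntegral_le_integral_norm _ _ _ _ _
  have hφ2 : Integrable fun ξ => ‖φ ξ‖ ^ 2 := (Lp.memLp (𝓕 f : OneParticle d)).integrable_norm_pow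
    (by norm_num)
  have hwm : Measurable (thermalWeight s β : Space d → ℝ) := by
    have := measurable_dispersionF (d := d) s
    unfold thermalWeight
    exact (Real.measurable_cosh.comp ((this.const_mul β).div_const 2)).div
      (Real.measurable_sinh.comp ((this.const_mul β).div_const 2))
  have hmeas : AEStronglyMeasurable (thermalRoot s β f) volume := by
    unfold thermalRoot
    exact (Complex.measurable_ofReal.comp hwm.sqrt).aestronglyMeasurable.mul
      (Lp.aestronglyMeasurable _)
  rw [memLp_two_iff_integrable_sq_norm hmeas]
  -- Chosen so that `2 / (β h) = C ‖ξ‖^(-s)`, the singular term in the upper bound for `K`.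
  set C : ℝ := 2 / (β * (2 * Real.pi) ^ s) with hC
  have hC0 : 0 < C := by positivity
  have hball := (integrableOn_norm_rpow_neg (s := s) hd hsd).integrable_indicator
    Metric.isOpen_ball.measurableSet
  -- Inside the unit ball `φ` is bounded by the `L¹` norm `M` and the singularity is integrable;
  -- outside, `‖ξ‖^(-s) ≤ 1` and `φ ∈ L²` suffices.
  have hdom : Integrable fun ξ : Space d => (1 + C) * ‖φ ξ‖ ^ 2 + C * M ^ 2 *
      (Metric.ball (0 : Space d) 1).indicator (fun ξ => ‖ξ‖ ^ (-s)) ξ :=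
    (hφ2.const_mul _).add (hball.const_mul _)
  refine hdom.mono' (hmeas.norm.pow 2) ?_
  filter_upwards [hbd, ae_ne_zero hd] with ξ hξ h0
  have hn : 0 < ‖ξ‖ := norm_pos_iff.2 h0
  have hh : dispersionF s ξ = (2 * Real.pi) ^ s * ‖ξ‖ ^ s := by
    rw [dispersionF, dispersion, norm_smul, Real.norm_of_nonneg Real.two_pi_pos.le,
      Real.mul_rpow Real.two_pi_pos.le hn.le]
  have hhp := dispersionF_pos (s := s) h0
  obtain ⟨hw1, hw2⟩ := cosh_div_sinh_bounds (x := β * dispersionF s ξ / 2) (by positivity)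
  have hw3 : thermalWeight s β ξ ≤ 1 + C * ‖ξ‖ ^ (-s) := by
    refine hw2.trans_eq ?_
    have := Real.rpow_pos_of_pos hn s
    have := Real.rpow_pos_of_pos Real.two_pi_pos s
    rw [hh, Real.rpow_neg hn.le, hC]
    field_simp
  have hw0 : 0 ≤ thermalWeight s β ξ := zero_le_one.trans hw1
  have hφ0 : 0 ≤ ‖φ ξ‖ ^ 2 := by positivity
  have hval : ‖thermalRoot s β f ξ‖ ^ 2 = thermalWeight s β ξ * ‖φ ξ‖ ^ 2 := by
    rw [thermalRoot, norm_mul, Complex.norm_real, Real.norm_of_nonneg (Real.sqrt_nonneg _), mul_pow,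
      Real.sq_sqrt hw0]
  rw [Real.norm_of_nonneg (by positivity), hval]
  have hsq : ‖φ ξ‖ ^ 2 ≤ M ^ 2 := pow_le_pow_left₀ (norm_nonneg _) hξ 2
  refine (mul_le_mul_of_nonneg_right hw3 hφ0).trans ?_
  rw [add_mul, add_mul, add_assoc]
  refine add_le_add le_rfl ?_
  by_cases hb : ξ ∈ Metric.ball (0 : Space d) 1
  · rw [Set.indicator_of_mem hb]
    have h1 : 0 ≤ C * ‖φ ξ‖ ^ 2 := by positivity
    have h2 : 0 ≤ C * ‖ξ‖ ^ (-s) := by positivity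
    nlinarith [mul_le_mul_of_nonneg_left hsq h2]
  · rw [Set.indicator_of_notMem hb, mul_zero, add_zero]
    have h1 : ‖ξ‖ ^ (-s) ≤ 1 :=
      Real.rpow_le_one_of_one_le_of_nonpos (by simpa using hb) (neg_nonpos.2 hs.le)
    have h2 : 0 ≤ C * ‖φ ξ‖ ^ 2 := by positivity
    nlinarith [mul_le_mul_of_nonneg_left h1 h2]

theorem condensateConst_pos (d : ℕ) {ρ₀ : ℝ} (hρ : 0 < ρ₀) : 0 < condensateConst d ρ₀ := by
  unfold condensateConst
  positivity

/-- The indicator of the unit ball works: its zero mode is a nonzero multiple of the volume of the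
ball. -/
theorem condensateFunctions_nonempty (hd : d ≠ 0) (hs : 0 < s) (hsd : s < d) (hβ : 0 < β)
    {ρ₀ : ℝ} (hρ : 0 < ρ₀) : (condensateFunctions d s β ρ₀).Nonempty := by
  have hfin : volume (Metric.ball (0 : Space d) 1) ≠ ⊤ := measure_ball_lt_top.ne
  set f : OneParticle d := indicatorConstLp 2 Metric.isOpen_ball.measurableSet hfin (1 : ℂ) with hf
  have hae : (f : Space d → ℂ) =ᵐ[volume] (Metric.ball (0 : Space d) 1).indicator fun _ => 1 :=
    indicatorConstLp_coeFn
  have hfi : Integrable (f : Space d → ℂ) :=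
    ((integrable_indicator_iff Metric.isOpen_ball.measurableSet).2
      (integrableOn_const hfin)).congr hae.symm
  have hmem := mem_integrableTestSpace hd hs hsd hβ hfi
  refine ⟨⟨f, integrableTestSpace_le s β hmem⟩, hmem, ?_⟩
  have hint : ∫ x, (f : Space d → ℂ) x ≠ 0 := by
    rw [integral_congr_ae hae, integral_indicator Metric.isOpen_ball.measurableSet]
    simp only [setIntegral_const, Measure.real]
    rw [Complex.real_smul, mul_one]
    exact_mod_cast (ENNReal.toReal_pos (Metric.measure_ball_pos volume 0 one_pos).ne' hfin).ne'
  have hz : zeroMode (⟨f, integrableTestSpace_le s β hmem⟩ : testSpace d s β) ≠ 0 := by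
    rw [zeroMode_of_integrable _ hfi]
    refine mul_ne_zero ?_ hint
    exact_mod_cast (Real.rpow_pos_of_pos Real.two_pi_pos _).ne'
  exact mul_ne_zero (condensateConst_pos d hρ).ne' (pow_ne_zero 2 (norm_ne_zero_iff.2 hz))

end FreeBoseGas

/-! ### Two-point functions at infinite separation -/

section TwoPoint

/-- The integral of `exp (-(a x + b y)) exp (-(p x² + q y² + 2 κ x y) / 4)` over `(0, ∞)²`. -/
def pairIntegral (a b p q κ : ℝ) : ℝ :=
  ∫ z : ℝ × ℝ, Real.exp (-(a * z.1 + b * z.2)) *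
      Real.exp (-(p * z.1 ^ 2 + q * z.2 ^ 2 + 2 * κ * (z.1 * z.2)) / 4)
    ∂(volume.restrict (Set.Ioi 0)).prod (volume.restrict (Set.Ioi 0))

variable {a b p q κ : ℝ}

theorem ae_pos_prod : ∀ᵐ z : ℝ × ℝ ∂(volume.restrict (Set.Ioi (0 : ℝ))).prod
    (volume.restrict (Set.Ioi (0 : ℝ))), 0 < z.1 ∧ 0 < z.2 := by
  rw [Measure.prod_restrict, ae_restrict_iff' (measurableSet_Ioi.prod measurableSet_Ioi)]
  exact Eventually.of_forall fun z hz => ⟨hz.1, hz.2⟩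

theorem integrable_pairIntegrand (ha : 0 < a) (hb : 0 < b)
    (h : ∀ x y : ℝ, 0 < x → 0 < y → 0 ≤ p * x ^ 2 + q * y ^ 2 + 2 * κ * (x * y)) :
    Integrable (fun z : ℝ × ℝ => Real.exp (-(a * z.1 + b * z.2)) *
      Real.exp (-(p * z.1 ^ 2 + q * z.2 ^ 2 + 2 * κ * (z.1 * z.2)) / 4))
      ((volume.restrict (Set.Ioi 0)).prod (volume.restrict (Set.Ioi 0))) := by
  have h1 : Integrable (fun z : ℝ × ℝ => Real.exp (-(a * z.1)) * Real.exp (-(b * z.2)))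
      ((volume.restrict (Set.Ioi 0)).prod (volume.restrict (Set.Ioi 0))) :=
    Integrable.mul_prod (UnitaryFlow.integrableOn_exp_neg_mul ha)
      (UnitaryFlow.integrableOn_exp_neg_mul hb)
  refine h1.mono' (Continuous.aestronglyMeasurable (by fun_prop)) ?_
  filter_upwards [ae_pos_prod] with z hz
  rw [Real.norm_of_nonneg (by positivity), ← Real.exp_add (-(a * z.1)), ← neg_add]
  refine mul_le_of_le_one_right (Real.exp_pos _).le (Real.exp_le_one_iff.2 ?_)
  linarith [h z.1 z.2 hz.1 hz.2]

/-- On the open quadrant `x y > 0`, so the integrand is pointwise strictly decreasing in `κ`.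
Nonnegativity of the form is needed only at the smaller coefficient, since it then holds at the
larger one. -/
theorem pairIntegral_lt (ha : 0 < a) (hb : 0 < b) {κ' : ℝ}
    (h : ∀ x y : ℝ, 0 < x → 0 < y → 0 ≤ p * x ^ 2 + q * y ^ 2 + 2 * κ * (x * y)) (hκ : κ < κ') :
    pairIntegral a b p q κ' < pairIntegral a b p q κ := by
  have h' : ∀ x y : ℝ, 0 < x → 0 < y → 0 ≤ p * x ^ 2 + q * y ^ 2 + 2 * κ' * (x * y) := by
    intro x y hx hy
    nlinarith [h x y hx hy, mul_pos (sub_pos.2 hκ) (mul_pos hx hy)]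
  have hi := integrable_pairIntegrand ha hb h
  have hi' := integrable_pairIntegrand ha hb h'
  have hlt : ∀ᵐ z : ℝ × ℝ ∂(volume.restrict (Set.Ioi (0 : ℝ))).prod
      (volume.restrict (Set.Ioi (0 : ℝ))), 0 < Real.exp (-(a * z.1 + b * z.2)) *
        Real.exp (-(p * z.1 ^ 2 + q * z.2 ^ 2 + 2 * κ * (z.1 * z.2)) / 4) -
        Real.exp (-(a * z.1 + b * z.2)) *
        Real.exp (-(p * z.1 ^ 2 + q * z.2 ^ 2 + 2 * κ' * (z.1 * z.2)) / 4) := by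
    filter_upwards [ae_pos_prod] with z hz
    refine sub_pos.2 (mul_lt_mul_of_pos_left (Real.exp_lt_exp.2 ?_) (Real.exp_pos _))
    nlinarith [mul_pos (sub_pos.2 hκ) (mul_pos hz.1 hz.2)]
  rw [← sub_pos, pairIntegral, pairIntegral, ← integral_sub hi hi']
  refine lt_of_le_of_ne (integral_nonneg_of_ae (hlt.mono fun z hz => hz.le)) fun h0 => ?_
  have h1 := (integral_eq_zero_iff_of_nonneg_ae (hlt.mono fun z hz => hz.le) (hi.sub hi')).1 h0.symm
  -- An almost everywhere positive function with zero integral would force the measure of the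
  -- quadrant to vanish.
  have h2 : ∀ᵐ z : ℝ × ℝ ∂(volume.restrict (Set.Ioi (0 : ℝ))).prod
      (volume.restrict (Set.Ioi (0 : ℝ))), False := by
    filter_upwards [hlt, h1] with z hz hz'
    exact hz.ne' hz'
  rw [eventually_false_iff_eq_bot, ae_eq_bot] at h2
  have h3 := congrArg (fun μ => μ Set.univ) h2
  simp [← Set.univ_prod_univ, Measure.prod_prod] at h3

theorem pairIntegral_eq_iff (ha : 0 < a) (hb : 0 < b) (hp : 0 ≤ p) (hq : 0 ≤ q)
    (h : ∀ x y : ℝ, 0 < x → 0 < y → 0 ≤ p * x ^ 2 + q * y ^ 2 + 2 * κ * (x * y)) :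
    pairIntegral a b p q κ = pairIntegral a b p q 0 ↔ κ = 0 := by
  refine ⟨fun he => ?_, fun he => by rw [he]⟩
  rcases lt_trichotomy κ 0 with hκ | hκ | hκ
  · exact absurd he (pairIntegral_lt ha hb h hκ).ne'
  · exact hκ
  · refine absurd he (pairIntegral_lt ha hb (fun x y hx hy => ?_) hκ).ne
    rw [mul_zero, zero_mul, add_zero]
    positivity

theorem pairIntegral_eq_integral_integral (ha : 0 < a) (hb : 0 < b)
    (h : ∀ x y : ℝ, 0 < x → 0 < y → 0 ≤ p * x ^ 2 + q * y ^ 2 + 2 * κ * (x * y)) :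
    pairIntegral a b p q κ = ∫ x in Set.Ioi (0 : ℝ), ∫ y in Set.Ioi (0 : ℝ),
      Real.exp (-(a * x + b * y)) *
        Real.exp (-(p * x ^ 2 + q * y ^ 2 + 2 * κ * (x * y)) / 4) :=
  integral_prod _ (integrable_pairIntegrand ha hb h)

theorem integral_orthantMeasure_two (F : ℝ → ℝ → ℂ) :
    ∫ t, F (t 0) (t 1) ∂orthantMeasure 2 = ∫ z : ℝ × ℝ, F z.1 z.2
      ∂(volume.restrict (Set.Ioi 0)).prod (volume.restrict (Set.Ioi 0)) :=
  (measurePreserving_finTwoArrow (volume.restrict (Set.Ioi (0 : ℝ)))).integral_comp'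
    fun z : ℝ × ℝ => F z.1 z.2

variable {V : Type} [NormedAddCommGroup V] [InnerProductSpace ℂ V]
  {E : Type*} [NormedAddCommGroup E] [InnerProductSpace ℂ E] {T : V →ₗ[ℂ] E}

theorem weylCorrelation_one (χ : V → ℂ) (g : Fin 1 → V) : weylCorrelation χ g = χ (g 0) := by
  simp [weylCorrelation]

theorem quasiFree_zero_smul (x : ℝ) (f : V) : quasiFree T 0 ((x : ℂ) • f) =
    Real.exp (-(x ^ 2 * ‖T f‖ ^ 2) / 4) := by
  rw [quasiFree, map_smul, norm_smul, Complex.norm_real, mul_pow, Real.norm_eq_abs, sq_abs]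
  simp

/-- The coefficient `(-i sgn l) (-i sgn m)` of the two-point functions. -/
def pairCoeff (l m : ℝˣ) : ℂ :=
  (-Complex.I * (Real.sign l : ℂ)) * (-Complex.I * (Real.sign m : ℂ))

theorem sign_unit_ne_zero (l : ℝˣ) : Real.sign (l : ℝ) ≠ 0 := by
  rw [← abs_ne_zero, abs_sign_unit]
  exact one_ne_zero

theorem sign_unit_sq (l : ℝˣ) : Real.sign (l : ℝ) ^ 2 = 1 := by
  rw [← sq_abs, abs_sign_unit, one_pow]

theorem pairCoeff_ne_zero (l m : ℝˣ) : pairCoeff l m ≠ 0 :=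
  mul_ne_zero
    (mul_ne_zero (neg_ne_zero.2 Complex.I_ne_zero) (Complex.ofReal_ne_zero.2 (sign_unit_ne_zero l)))
    (mul_ne_zero (neg_ne_zero.2 Complex.I_ne_zero) (Complex.ofReal_ne_zero.2 (sign_unit_ne_zero m)))

/-- The integration variables enter through `-sgn(l) x` and `-sgn(m) y`: squares lose the signs,
while the bilinear cross term keeps `sgn(l) sgn(m)`. -/
theorem integral_pair (l m : ℝˣ) {f g : V} {q : V → V → ℝ}
    (hq : ∀ x y : ℝ, q ((x : ℂ) • f) ((y : ℂ) • g) = x * y * q f g) :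
    ∫ t, (∏ j, laplaceCoeff (Fin.append (fun _ : Fin 1 => l) (fun _ : Fin 1 => m) j) (t j)) *
        (weylCorrelation (quasiFree T 0)
            (laplaceArg (fun _ : Fin 1 => l) (fun _ => f) fun j => t (Fin.castAdd 1 j)) *
          weylCorrelation (quasiFree T 0)
            (laplaceArg (fun _ : Fin 1 => m) (fun _ => g) fun j => t (Fin.natAdd 1 j)) *
          Complex.exp (-(q
            (∑ j, laplaceArg (fun _ : Fin 1 => l) (fun _ => f) (fun j => t (Fin.castAdd 1 j)) j)
            (∑ j, laplaceArg (fun _ : Fin 1 => m) (fun _ => g) (fun j => t (Fin.natAdd 1 j)) j)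
              : ℂ) / 2)) ∂orthantMeasure (1 + 1) =
      pairCoeff l m * (pairIntegral |(l : ℝ)| |(m : ℝ)| (‖T f‖ ^ 2) (‖T g‖ ^ 2)
        (Real.sign l * Real.sign m * q f g) : ℂ) := by
  rw [pairIntegral, ← integral_complex_ofReal, ← integral_const_mul,
    ← integral_orthantMeasure_two fun x y => pairCoeff l m * ((Real.exp (-(|(l : ℝ)| * x +
      |(m : ℝ)| * y)) * Real.exp (-(‖T f‖ ^ 2 * x ^ 2 + ‖T g‖ ^ 2 * y ^ 2 +
        2 * (Real.sign l * Real.sign m * q f g) * (x * y)) / 4) : ℝ) : ℂ)]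
  refine integral_congr_ae (Eventually.of_forall fun t => ?_)
  have hl := sign_unit_sq l
  have hm := sign_unit_sq m
  have e1 : ∏ j, laplaceCoeff (Fin.append (fun _ : Fin 1 => l) (fun _ : Fin 1 => m) j) (t j) =
      laplaceCoeff l (t 0) * laplaceCoeff m (t 1) := Fin.prod_univ_two _
  beta_reduce
  rw [e1]
  simp only [weylCorrelation_one, Fin.sum_univ_one, laplaceArg, quasiFree_zero_smul, hq,
    laplaceCoeff, pairCoeff, neg_sq, mul_pow, hl, hm, one_mul]
  have e2 : Fin.castAdd 1 (0 : Fin 1) = (0 : Fin 2) := rfl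
  have e3 : Fin.natAdd 1 (0 : Fin 1) = (1 : Fin 2) := rfl
  rw [e2, e3]
  push_cast
  have e4 : ∀ c c' u v w x y u' v' : ℂ, u + v + w + x + y = u' + v' →
      c * Complex.exp u * (c' * Complex.exp v) * (Complex.exp w * Complex.exp x * Complex.exp y) =
        c * c' * (Complex.exp u' * Complex.exp v') := by
    intro c c' u v w x y u' v' huv
    rw [← Complex.exp_add u', ← huv, Complex.exp_add, Complex.exp_add, Complex.exp_add,
      Complex.exp_add]
    ring
  refine e4 _ _ _ _ _ _ _ _ _ ?_
  ring

variable {ψ : ResolventAlgebra V →L[ℂ] ℂ}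

theorem ofFn_resolvent_one (l : ℝˣ) (f : V) :
    (List.ofFn fun _ : Fin 1 => resolvent l f).prod = resolvent l f := by
  simp [List.ofFn_succ]

/-- The two-point functions of a quasi-free state at infinite separation. -/
theorem tendsto_twoPoint {ι : Type*} {F : Filter ι} [F.IsCountablyGenerated]
    {U : ι → V →ₗᵢ[ℂ] V} (hψ : IsStateWithCharacteristic ψ (quasiFree T 0))
    (hT : ∀ i f, ‖T (U i f)‖ = ‖T f‖) (hσ : ∀ f g, Tendsto (fun i => symp f (U i g)) F (𝓝 0))
    {q : V → V → ℝ} (hq : ∀ f g, Tendsto (fun i => (inner ℂ (T f) (T (U i g))).re) F (𝓝 (q f g)))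
    (l m : ℝˣ) {f g : V} (hb : ∀ x y : ℝ, q ((x : ℂ) • f) ((y : ℂ) • g) = x * y * q f g) :
    Tendsto (fun i => ψ (resolvent l f * bogoliubov (U i) (resolvent m g))) F
      (𝓝 (pairCoeff l m * (pairIntegral |(l : ℝ)| |(m : ℝ)| (‖T f‖ ^ 2) (‖T g‖ ^ 2)
        (Real.sign l * Real.sign m * q f g) : ℂ))) := by
  have h := tendsto_word_mul_word hψ hT (fun _ _ => rfl) hσ hq (fun _ : Fin 1 => l) (fun _ => f)
    (fun _ : Fin 1 => m) fun _ => g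
  rw [integral_pair l m hb] at h
  refine h.congr fun i => ?_
  rw [ofFn_resolvent_one, ofFn_resolvent_one, bogoliubov_resolvent]

/-- The case `q = 0` of the same computation, read backwards through Fubini. It puts the product
into the form of the two-point limit. -/
theorem apply_resolvent_mul_apply_resolvent (hψ : IsStateWithCharacteristic ψ (quasiFree T 0))
    (l m : ℝˣ) (f g : V) : ψ (resolvent l f) * ψ (resolvent m g) =
      pairCoeff l m * (pairIntegral |(l : ℝ)| |(m : ℝ)| (‖T f‖ ^ 2) (‖T g‖ ^ 2) 0 : ℂ) := by
  have h := integral_pair (T := T) l m (f := f) (g := g) (q := fun _ _ => 0) fun _ _ => by simp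
  rw [mul_zero] at h
  rw [← h, ← ofFn_resolvent_one l f, ← ofFn_resolvent_one m g, hψ.npoint, hψ.npoint,
    resolventCorrelation_eq, resolventCorrelation_eq]
  symm
  refine integral_append_mul _ _ ?_ fun x y => ?_
  · refine (integrable_prod_laplaceCoeff _).aestronglyMeasurable.mul
      (Continuous.aestronglyMeasurable ?_)
    simp only [Complex.ofReal_zero, neg_zero, zero_div, Complex.exp_zero, mul_one]
    exact ((continuous_weylCorrelation _ _).comp (by fun_prop)).mul
      ((continuous_weylCorrelation _ _).comp (by fun_prop))
  · simp only [Fin.prod_univ_add, Fin.append_left, Fin.append_right, Complex.ofReal_zero, neg_zero,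
      zero_div, Complex.exp_zero, mul_one]
    ring

end TwoPoint

/-! ### The states of the free Bose gas -/

section FreeBoseStates

variable {d : ℕ} {s β ρ₀ : ℝ}

theorem componentCharacteristic_eq (ρ₀ r θ : ℝ) :
    (componentCharacteristic ρ₀ r θ : testSpace d s β → ℂ) = quasiFree (thermalMap d s β)
      (((Real.sqrt (condensateConst d ρ₀ * r) : ℂ) * Complex.exp (θ * Complex.I)) •
        zeroModeMap d s β) := by
  funext f
  rw [componentCharacteristic, quasiFree, norm_thermalMap_sq, classicalField,
    LinearMap.smul_apply, smul_eq_mul, mul_assoc, Complex.re_ofReal_mul]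
  rfl

/-- The map `f ↦ (K^{1/2} f, c^{1/2} f̂(0))`. -/
def becMap (d : ℕ) (s β ρ₀ : ℝ) : testSpace d s β →ₗ[ℂ] WithLp 2 (OneParticle d × ℂ) :=
  (WithLp.linearEquiv 2 ℂ (OneParticle d × ℂ)).symm.toLinearMap ∘ₗ
    (thermalMap d s β).prod ((Real.sqrt (condensateConst d ρ₀) : ℂ) • zeroModeMap d s β)

theorem inner_becMap (hρ : 0 ≤ condensateConst d ρ₀) (f g : testSpace d s β) :
    inner ℂ (becMap d s β ρ₀ f) (becMap d s β ρ₀ g) =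
      inner ℂ (thermalMap d s β f) (thermalMap d s β g) + zeroForm ρ₀ f g := by
  have h : ((Real.sqrt (condensateConst d ρ₀) : ℝ) : ℂ) * (Real.sqrt (condensateConst d ρ₀) : ℝ) =
      (condensateConst d ρ₀ : ℂ) := by
    rw [← Complex.ofReal_mul, Real.mul_self_sqrt hρ]
  rw [WithLp.prod_inner_apply]
  change _ + inner ℂ ((Real.sqrt (condensateConst d ρ₀) : ℂ) * zeroMode f)
    ((Real.sqrt (condensateConst d ρ₀) : ℂ) * zeroMode g) = _
  rw [RCLike.inner_apply, map_mul, Complex.conj_ofReal, zeroForm, ← h]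
  congr 1
  ring

theorem zeroForm_self (ρ₀ : ℝ) (f : testSpace d s β) : zeroForm ρ₀ f f = zeroQuad ρ₀ f := by
  rw [zeroForm, Complex.conj_mul', zeroQuad]
  push_cast
  rfl

theorem norm_becMap_sq (hρ : 0 ≤ condensateConst d ρ₀) (f : testSpace d s β) :
    ‖becMap d s β ρ₀ f‖ ^ 2 = zeroQuad ρ₀ f + nonzeroForm f := by
  rw [← inner_self_eq_norm_sq (𝕜 := ℂ), inner_becMap hρ, zeroForm_self, map_add,
    inner_self_eq_norm_sq, norm_thermalMap_sq, add_comm]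
  rfl

theorem zeroQuad_nonneg (hρ : 0 ≤ condensateConst d ρ₀) (f : testSpace d s β) :
    0 ≤ zeroQuad ρ₀ f := mul_nonneg hρ (sq_nonneg _)

theorem becCharacteristic_eq (hρ : 0 ≤ condensateConst d ρ₀) :
    (becCharacteristic ρ₀ : testSpace d s β → ℂ) = quasiFree (becMap d s β ρ₀) 0 := by
  funext f
  rw [becCharacteristic, quasiFree, norm_becMap_sq hρ]
  simp

theorem norm_le_norm_becMap (hd : d ≠ 0) (hβ : 0 < β) (hρ : 0 ≤ condensateConst d ρ₀)
    (f : testSpace d s β) : ‖f‖ ≤ ‖becMap d s β ρ₀ f‖ := by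
  refine (norm_le_norm_thermalMap hd hβ f).trans (le_of_sq_le_sq ?_ (norm_nonneg _))
  rw [norm_becMap_sq hρ, norm_thermalMap_sq]
  exact le_add_of_nonneg_left (zeroQuad_nonneg hρ f)

theorem zeroForm_smul (ρ₀ : ℝ) (x y : ℝ) (f g : testSpace d s β) :
    (zeroForm ρ₀ ((x : ℂ) • f) ((y : ℂ) • g)).re = x * y * (zeroForm ρ₀ f g).re := by
  have h : ∀ (c : ℂ) (f : testSpace d s β), zeroMode (c • f) = c * zeroMode f :=
    fun c f => (zeroModeMap d s β).map_smul c f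
  have : zeroForm ρ₀ ((x : ℂ) • f) ((y : ℂ) • g) = ((x * y : ℝ) : ℂ) * zeroForm ρ₀ f g := by
    rw [zeroForm, zeroForm, h, h, map_mul, Complex.conj_ofReal]
    push_cast
    ring
  rw [this, Complex.re_ofReal_mul]

theorem zeroQuad_add (ρ₀ : ℝ) (f g : testSpace d s β) :
    zeroQuad ρ₀ (f + g) = zeroQuad ρ₀ f + zeroQuad ρ₀ g + 2 * (zeroForm ρ₀ f g).re := by
  have h1 : zeroMode (f + g) = zeroMode f + zeroMode g := (zeroModeMap d s β).map_add f g
  have h2 : ‖zeroMode f + zeroMode g‖ ^ 2 = _ := @norm_add_sq ℂ _ _ _ _ (zeroMode f) (zeroMode g)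
  rw [zeroQuad, h1, h2, zeroForm, Complex.re_ofReal_mul, RCLike.inner_apply, zeroQuad, zeroQuad,
    mul_comm (zeroMode g)]
  change condensateConst d ρ₀ * (_ + 2 * (conj (zeroMode f) * zeroMode g).re + _) = _
  ring

theorem zeroQuad_smul (ρ₀ : ℝ) (x : ℝ) (f : testSpace d s β) :
    zeroQuad ρ₀ ((x : ℂ) • f) = x ^ 2 * zeroQuad ρ₀ f := by
  have h := zeroForm_smul ρ₀ x x f f
  rwa [zeroForm_self, zeroForm_self, Complex.ofReal_re, Complex.ofReal_re, ← sq] at h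

theorem nonzeroForm_smul (x : ℝ) (f : testSpace d s β) :
    nonzeroForm ((x : ℂ) • f) = x ^ 2 * nonzeroForm f := by
  rw [← norm_thermalMap_sq, ← norm_thermalMap_sq, map_smul, norm_smul, mul_pow, Complex.norm_real,
    Real.norm_eq_abs, sq_abs]

/-- The form equals `q₀` of the signed combination of `f` and `g` plus nonnegative thermal terms
without a cross term. -/
theorem pairForm_nonneg (hρ : 0 ≤ condensateConst d ρ₀) (l m : ℝˣ) (f g : testSpace d s β)
    (x y : ℝ) : 0 ≤ ‖becMap d s β ρ₀ f‖ ^ 2 * x ^ 2 + ‖becMap d s β ρ₀ g‖ ^ 2 * y ^ 2 +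
      2 * (Real.sign l * Real.sign m * (zeroForm ρ₀ f g).re) * (x * y) := by
  have h := zeroQuad_nonneg hρ
    (((Real.sign l * x : ℝ) : ℂ) • f + ((Real.sign m * y : ℝ) : ℂ) • g)
  rw [zeroQuad_add, zeroQuad_smul, zeroQuad_smul, zeroForm_smul, mul_pow, mul_pow, sign_unit_sq,
    sign_unit_sq] at h
  have hf : 0 ≤ nonzeroForm f := norm_thermalMap_sq f ▸ sq_nonneg _
  have hg : 0 ≤ nonzeroForm g := norm_thermalMap_sq g ▸ sq_nonneg _
  rw [norm_becMap_sq hρ, norm_becMap_sq hρ]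
  nlinarith [mul_nonneg hf (sq_nonneg x), mul_nonneg hg (sq_nonneg y)]

theorem becLimit_eq (hρ : 0 ≤ condensateConst d ρ₀) (l m : ℝˣ) (f g : testSpace d s β) :
    becLimit ρ₀ l m f g = pairCoeff l m * (pairIntegral |(l : ℝ)| |(m : ℝ)|
      (‖becMap d s β ρ₀ f‖ ^ 2) (‖becMap d s β ρ₀ g‖ ^ 2)
      (Real.sign l * Real.sign m * (zeroForm ρ₀ f g).re) : ℂ) := by
  rw [pairIntegral_eq_integral_integral (abs_pos.2 l.ne_zero) (abs_pos.2 m.ne_zero)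
    fun x y _ _ => pairForm_nonneg hρ l m f g x y, ← integral_complex_ofReal, ← integral_const_mul,
    becLimit]
  refine integral_congr_ae (Eventually.of_forall fun x => ?_)
  simp only
  rw [← integral_complex_ofReal, ← integral_const_mul]
  refine integral_congr_ae (Eventually.of_forall fun y => ?_)
  simp only [pairCoeff]
  congr 2
  rw [zeroQuad_add, zeroQuad_smul, zeroQuad_smul, zeroForm_smul, nonzeroForm_smul,
    nonzeroForm_smul, norm_becMap_sq hρ, norm_becMap_sq hρ, mul_pow, mul_pow, sign_unit_sq,
    sign_unit_sq, mul_assoc (Real.exp _), mul_assoc (Real.exp _), ← Real.exp_add, ← Real.exp_add]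
  congr 2
  ring

/-- Both sides are the same nonzero coefficient times `pairIntegral`, at cross coefficients `sgn(l)
sgn(m) Re q₀(f, g)` and `0`; strict monotonicity separates them. -/
theorem becLimit_ne_iff (hρ : 0 ≤ condensateConst d ρ₀)
    {ψ : ResolventAlgebra (testSpace d s β) →L[ℂ] ℂ}
    (hψ : IsStateWithCharacteristic ψ (becCharacteristic ρ₀)) (l m : ℝˣ) (f g : testSpace d s β) :
    becLimit ρ₀ l m f g ≠ ψ (resolvent l f) * ψ (resolvent m g) ↔ (zeroForm ρ₀ f g).re ≠ 0 := by
  rw [becCharacteristic_eq hρ] at hψ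
  rw [apply_resolvent_mul_apply_resolvent hψ, becLimit_eq hρ, Ne,
    mul_right_inj' (pairCoeff_ne_zero l m), Complex.ofReal_inj,
    pairIntegral_eq_iff (abs_pos.2 l.ne_zero) (abs_pos.2 m.ne_zero) (sq_nonneg _) (sq_nonneg _)
      fun x y _ _ => pairForm_nonneg hρ l m f g x y]
  simp

theorem becLimit_self_ne (hρ : 0 ≤ condensateConst d ρ₀)
    {ψ : ResolventAlgebra (testSpace d s β) →L[ℂ] ℂ}
    (hψ : IsStateWithCharacteristic ψ (becCharacteristic ρ₀)) {f : testSpace d s β}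
    (hf : f ∈ condensateFunctions d s β ρ₀) (l m : ℝˣ) :
    becLimit ρ₀ l m f f ≠ ψ (resolvent l f) * ψ (resolvent m f) := by
  rw [becLimit_ne_iff hρ hψ, zeroForm_self, Complex.ofReal_re]
  exact hf.2

namespace IsMixing

variable {ι : Type} {U : ι → testSpace d s β →ₗᵢ[ℂ] testSpace d s β} {m : ι → Space d → ℂ}
  {F : Filter ι}

theorem zeroForm_eq (h : IsMixing U m F) (ρ₀ : ℝ) (f g : testSpace d s β) (i : ι) :
    zeroForm ρ₀ f (U i g) = zeroForm ρ₀ f g := by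
  rw [zeroForm, zeroForm, h.zeroMode_eq]

theorem norm_becMap (h : IsMixing U m F) (hρ : 0 ≤ condensateConst d ρ₀) (i : ι)
    (f : testSpace d s β) : ‖becMap d s β ρ₀ (U i f)‖ = ‖becMap d s β ρ₀ f‖ := by
  rw [← sq_eq_sq₀ (norm_nonneg _) (norm_nonneg _), norm_becMap_sq hρ, norm_becMap_sq hρ, zeroQuad,
    h.zeroMode_eq, ← norm_thermalMap_sq, h.norm_thermalMap, norm_thermalMap_sq, zeroQuad]

theorem tendsto_re_inner_becMap (h : IsMixing U m F) (hρ : 0 ≤ condensateConst d ρ₀)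
    (f g : testSpace d s β) :
    Tendsto (fun i => (inner ℂ (becMap d s β ρ₀ f) (becMap d s β ρ₀ (U i g))).re) F
      (𝓝 (zeroForm ρ₀ f g).re) := by
  simp only [inner_becMap hρ, h.zeroForm_eq, Complex.add_re]
  have h1 := (Complex.continuous_re.tendsto 0).comp (h.tendsto_inner_thermalMap f g)
  simpa using h1.add_const (zeroForm ρ₀ f g).re

theorem clusters_component [F.IsCountablyGenerated] (h : IsMixing U m F) {r θ : ℝ}
    {ψ : ResolventAlgebra (testSpace d s β) →L[ℂ] ℂ}
    (hψ : IsStateWithCharacteristic ψ (componentCharacteristic ρ₀ r θ)) :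
    Clusters ψ Set.univ (fun i => bogoliubov (U i)) F := by
  rw [componentCharacteristic_eq] at hψ
  refine clusters_quasiFree hψ h.norm_thermalMap (fun i f => ?_) h.tendsto_symp fun f g => ?_
  · rw [LinearMap.smul_apply, LinearMap.smul_apply]
    exact congrArg _ (h.zeroMode_eq i f)
  · exact (Complex.continuous_re.tendsto 0).comp (h.tendsto_inner_thermalMap f g)

theorem tendsto_becLimit [F.IsCountablyGenerated] (h : IsMixing U m F)
    (hρ : 0 ≤ condensateConst d ρ₀) {ψ : ResolventAlgebra (testSpace d s β) →L[ℂ] ℂ}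
    (hψ : IsStateWithCharacteristic ψ (becCharacteristic ρ₀)) (l m : ℝˣ) (f g : testSpace d s β) :
    Tendsto (fun i => ψ (resolvent l f * bogoliubov (U i) (resolvent m g))) F
      (𝓝 (becLimit ρ₀ l m f g)) := by
  rw [becCharacteristic_eq hρ] at hψ
  rw [becLimit_eq hρ]
  exact tendsto_twoPoint (q := fun f g => (zeroForm ρ₀ f g).re) hψ (h.norm_becMap hρ)
    h.tendsto_symp (h.tendsto_re_inner_becMap hρ) l m fun x y => zeroForm_smul ρ₀ x y f g

/-- A single generator with nonzero condensate form is a witness: along any nontrivial finer filter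
its two-point function still converges to the full limit, which is not the product. -/
theorem not_clusters_bec [F.IsCountablyGenerated] (h : IsMixing U m F)
    (hρ : 0 ≤ condensateConst d ρ₀) (hne : (condensateFunctions d s β ρ₀).Nonempty)
    {ψ : ResolventAlgebra (testSpace d s β) →L[ℂ] ℂ}
    (hψ : IsStateWithCharacteristic ψ (becCharacteristic ρ₀)) {G : Filter ι} [G.NeBot]
    (hG : G ≤ F) : ¬ Clusters ψ (resolventAlgebraOver (condensateFunctions d s β ρ₀))
      (fun i => bogoliubov (U i)) G := by
  obtain ⟨f, hf⟩ := hne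
  intro hc
  have hmem : resolvent 1 f ∈ (resolventAlgebraOver (condensateFunctions d s β ρ₀) :
      Set (ResolventAlgebra (testSpace d s β))) :=
    StarSubalgebra.le_topologicalClosure _ (StarAlgebra.subset_adjoin ℂ _ ⟨1, f, hf, rfl⟩)
  exact becLimit_self_ne hρ hψ hf 1 1 (tendsto_nhds_unique
    ((h.tendsto_becLimit hρ hψ 1 1 f f).mono_left hG) (hc _ hmem _ hmem))

end IsMixing

end FreeBoseStates

end FreeBose

end

theorem mainTheorem10 (d : ℕ) (s β ρ ρ₀ : ℝ) (hs : 0 < s) (hsd : s < d) (hβ : 0 < β)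
    (hρ : FreeBose.IsCondensateDensity d s β ρ ρ₀) (hρ₀ : 0 < ρ₀) :
    -- the component states exist, are unique, and cluster in time and in space
    (∀ r θ : ℝ, 0 ≤ r →
      ∃ ψ : FreeBose.ResolventAlgebra (FreeBose.testSpace d s β) →L[ℂ] ℂ,
        FreeBose.IsStateWithCharacteristic ψ (FreeBose.componentCharacteristic ρ₀ r θ) ∧
        (∀ ψ', FreeBose.IsStateWithCharacteristic ψ'
          (FreeBose.componentCharacteristic ρ₀ r θ) → ψ' = ψ) ∧
        FreeBose.Clusters ψ Set.univ (FreeBose.dynamics d hs β) (Filter.cocompact ℝ) ∧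
        FreeBose.Clusters ψ Set.univ (FreeBose.spaceTranslation d s β)
          (Filter.cocompact (FreeBose.Space d))) ∧
    -- the zero-mode cross term is invariant under the free dynamics and under translations
    (∀ f g : FreeBose.testSpace d s β,
      (∀ u : ℝ, FreeBose.zeroForm ρ₀ f (FreeBose.testTimeEvolution d hs β u g)
        = FreeBose.zeroForm ρ₀ f g) ∧
      (∀ a : FreeBose.Space d, FreeBose.zeroForm ρ₀ f (FreeBose.testTranslation d s β a g)
        = FreeBose.zeroForm ρ₀ f g)) ∧
    -- the BEC state exists, is unique, and clusters neither in time nor in space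
    (∃ ψ : FreeBose.ResolventAlgebra (FreeBose.testSpace d s β) →L[ℂ] ℂ,
      FreeBose.IsStateWithCharacteristic ψ (FreeBose.becCharacteristic ρ₀) ∧
      (∀ ψ', FreeBose.IsStateWithCharacteristic ψ' (FreeBose.becCharacteristic ρ₀) → ψ' = ψ) ∧
      (∀ (l m : ℝˣ) (f g : FreeBose.testSpace d s β),
        Filter.Tendsto (fun u : ℝ => ψ (FreeBose.resolvent l f *
            FreeBose.dynamics d hs β u (FreeBose.resolvent m g)))
          (Filter.cocompact ℝ) (nhds (FreeBose.becLimit ρ₀ l m f g)) ∧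
        Filter.Tendsto (fun a : FreeBose.Space d => ψ (FreeBose.resolvent l f *
            FreeBose.spaceTranslation d s β a (FreeBose.resolvent m g)))
          (Filter.cocompact (FreeBose.Space d)) (nhds (FreeBose.becLimit ρ₀ l m f g)) ∧
        (FreeBose.becLimit ρ₀ l m f g
            ≠ ψ (FreeBose.resolvent l f) * ψ (FreeBose.resolvent m g) ↔
          (FreeBose.zeroForm ρ₀ f g).re ≠ 0)) ∧
      (FreeBose.condensateFunctions d s β ρ₀).Nonempty ∧
      (∀ f ∈ FreeBose.condensateFunctions d s β ρ₀, ∀ l m : ℝˣ,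
        FreeBose.becLimit ρ₀ l m f f
          ≠ ψ (FreeBose.resolvent l f) * ψ (FreeBose.resolvent m f)) ∧
      (∀ F : Filter ℝ, F.NeBot → F ≤ Filter.cocompact ℝ →
        ¬ FreeBose.Clusters ψ
          (FreeBose.resolventAlgebraOver (FreeBose.condensateFunctions d s β ρ₀))
          (FreeBose.dynamics d hs β) F) ∧
      (∀ F : Filter (FreeBose.Space d), F.NeBot → F ≤ Filter.cocompact (FreeBose.Space d) →
        ¬ FreeBose.Clusters ψ
          (FreeBose.resolventAlgebraOver (FreeBose.condensateFunctions d s β ρ₀))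
          (FreeBose.spaceTranslation d s β) F)) := by
  -- In dimension zero the condition `0 < s < d` is empty; in positive dimension the origin is a
  -- null set, as the bounds on `K` require.
  have hd : d ≠ 0 := by
    rintro rfl
    exact absurd (hs.trans hsd) (by simp)
  have hc : 0 ≤ FreeBose.condensateConst d ρ₀ := (FreeBose.condensateConst_pos d hρ₀).le
  have ht := FreeBose.isMixing_timeEvolution hd hs β
  have hx := FreeBose.isMixing_translation d s β
  have hne := FreeBose.condensateFunctions_nonempty hd hs hsd hβ hρ₀
  refine ⟨fun r θ _ => ?_, fun f g => ⟨ht.zeroForm_eq ρ₀ f g, hx.zeroForm_eq ρ₀ f g⟩, ?_⟩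
  · obtain ⟨ψ, hψ⟩ := FreeBose.exists_state_quasiFree
      (((Real.sqrt (FreeBose.condensateConst d ρ₀ * r) : ℂ) * Complex.exp (θ * Complex.I)) •
        FreeBose.zeroModeMap d s β) (FreeBose.norm_le_norm_thermalMap hd hβ)
    rw [← FreeBose.componentCharacteristic_eq] at hψ
    exact ⟨ψ, hψ, fun ψ' hψ' => hψ.unique hψ', ht.clusters_component hψ, hx.clusters_component hψ⟩
  · obtain ⟨ψ, hψ⟩ := FreeBose.exists_state_quasiFree (V := FreeBose.testSpace d s β) 0
      (FreeBose.norm_le_norm_becMap hd hβ hc)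
    rw [← FreeBose.becCharacteristic_eq hc] at hψ
    exact ⟨ψ, hψ, fun ψ' hψ' => hψ.unique hψ', fun l m f g =>
      ⟨ht.tendsto_becLimit hc hψ l m f g, hx.tendsto_becLimit hc hψ l m f g,
        FreeBose.becLimit_ne_iff hc hψ l m f g⟩, hne,
      fun f hf l m => FreeBose.becLimit_self_ne hc hψ hf l m,
      fun _ _ hF => ht.not_clusters_bec hc hne hψ hF,
      fun _ _ hF => hx.not_clusters_bec hc hne hψ hF⟩
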